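/- **Setting.** A Young function is a convex, left-continuous function $\Phi:[0,\infty)\to[0,\infty]$ with $\lim_{r\to0+}\Phi(r)=\Phi(0)=0$ and $\lim_{r\to\infty}\Phi(r)=\infty$. For a non-decreasing function $A:[0,\infty)\to[0,\infty]$ put $A^{-1}(s)=\inf\{r\ge 0: A(r)>s\}$ ($\inf\emptyset=\infty$); for a Young function $\Phi$ put $\widetilde\Phi(r)=\sup_{s\ge0}(rs-\Phi(s))$. For measurable $f$ on $\mathbb R^n$ let $$\|f\|_{L_\Phi}=\inf\Big\{\lambda>0:\int_{\mathbb R^n}\Phi\Big(\frac{|f(x)|}{\lambda}\Big)dx\le1\Big\},\qquad \|f\|_{WL_\Phi}=\inf\Big\{\lambda>0:\sup_{t>0}\Phi(t)\,\Big|\Big\{x:\frac{|f(x)|}{\lambda}>t\Big\}\Big|\le1\Big\}.$$ $L_\Phi(\mathbb R^n)$ is the set of $f\in L_1^{\rm loc}(\mathbb R^n)$ with $\int_{\mathbb R^n}\Phi(k|f(x)|)\,dx<\infty$ for some $k>0$, and $WL_\Phi(\mathbb R^n)$ is the set of $f\in L_1^{\rm loc}(\mathbb R^n)$ with $\|f\|_{WL_\Phi}<\infty$;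 $f\in L_\Phi^{\rm loc}$ (resp. $WL_\Phi^{\rm loc}$) means $f\chi_B\in L_\Phi$ (resp. $WL_\Phi$) for every ball $B$. For a positive measurable function $\varphi$ on $\mathbb R^n\times(0,\infty)$, $M_{\Phi,\varphi}(\mathbb R^n)$ is the space of $f\in L_\Phi^{\rm loc}(\mathbb R^n)$ with $$\|f\|_{M_{\Phi,\varphi}}=\sup_{x\in\mathbb R^n,\,r>0}\varphi(x,r)^{-1}\,\Phi^{-1}\big(|B(x,r)|^{-1}\big)\,\|f\chi_{B(x,r)}\|_{L_\Phi}<\infty,$$ and $WM_{\Phi,\varphi}(\mathbb R^n)$ is the space of $f\in WL_\Phi^{\rm loc}(\mathbb R^n)$ for which the same expression with $WL_\Phi$ in place of $L_\Phi$, denoted $\|f\|_{WM_{\Phi,\varphi}}$, is finite. For $0<\alpha<n$ let $I_\alpha f(x)=\int_{\mathbb R^n}\frac{f(y)}{|x-y|^{n-\alpha}}\,dy$. For $1<p<\infty$, $p'=p/(p-1)$, and Young functions $\Phi,\Psi$, let $$\Phi_p(s)=\int_0^s r^{p'-1}\big(\mathcal A_p^{-1}(r^{p'})\big)^{p'}dr,\qquad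 \mathcal A_p(s)=\int_0^s\frac{\widetilde\Phi(t)}{t^{1+p'}}\,dt,$$ and let $\Psi_p$ be the Young function whose complementary function is $$\widetilde{\Psi_p}(s)=\int_0^s r^{p'-1}\big(\mathcal B_p^{-1}(r^{p'})\big)^{p'}dr,\qquad \mathcal B_p(s)=\int_0^s\frac{\Psi(t)}{t^{1+p'}}\,dt.$$ One says that $G$ dominates $F$ globally if there is $c>0$ with $F(s)\le G(cs)$ for all $s\ge0$. **Theorem.** Let $0<\alpha<n$, let $\Phi,\Psi$ be Young functions, let $\varphi_1,\varphi_2$ be positive measurable functions on $\mathbb R^n\times(0,\infty)$, and suppose that there is a constant $C$ such that for all $x\in\mathbb R^n$ and $r>0$ $$\int_r^\infty\Big(\operatorname*{ess\,inf}_{t<s<\infty}\frac{\varphi_1(x,s)}{\Phi^{-1}(s^{-n})}\Big)\Psi^{-1}(t^{-n})\,\frac{dt}{t}\le C\,\varphi_2(x,r).$$ (i) If $\int_0^1\widetilde\Phi(t)\,t^{-1-n/(n-\alpha)}dt<\infty$, $\int_0^1\Psi(t)\,t^{-1-n/(n-\alpha)}dt<\infty$, $\Phi$ dominates $\Psi_{n/\alpha}$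 globally and $\Phi_{n/\alpha}$ dominates $\Psi$ globally, then $I_\alpha$ is bounded from $M_{\Phi,\varphi_1}(\mathbb R^n)$ to $M_{\Psi,\varphi_2}(\mathbb R^n)$. (ii) If $\int_0^1\widetilde\Phi(t)\,t^{-1-n/(n-\alpha)}dt<\infty$ and $\Phi_{n/\alpha}$ dominates $\Psi$ globally, then $I_\alpha$ is bounded from $M_{\Phi,\varphi_1}(\mathbb R^n)$ to $WM_{\Psi,\varphi_2}(\mathbb R^n)$. Here bounded means: for every $f\in M_{\Phi,\varphi_1}(\mathbb R^n)$ the integral defining $I_\alpha f(x)$ converges absolutely for almost every $x$, $I_\alpha f$ belongs to the target space, and its quasinorm there is at most $C'\|f\|_{M_{\Phi,\varphi_1}}$ with $C'$ independent of $f$. -/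

import Mathlib

open MeasureTheory Filter Topology Set
open scoped NNReal ENNReal

noncomputable section

namespace OrliczMorrey

/-- Young functions `Φ : [0,∞) → [0,∞]`. -/
structure IsYoung (Φ : ℝ≥0 → ℝ≥0∞) : Prop where
  convex : ConvexOn ℝ≥0 univ Φ
  left_continuous : ∀ r, ContinuousWithinAt Φ (Iic r) r
  map_zero : Φ 0 = 0
  tendsto_zero : Tendsto Φ (𝓝[>] 0) (𝓝 0)
  tendsto_top : Tendsto Φ atTop (𝓝 ∞)

/-- The generalized inverse `s ↦ inf {r ≥ 0 : Φ r > s}`, with `inf ∅ = ∞`. -/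
def genInv (Φ : ℝ≥0 → ℝ≥0∞) (s : ℝ≥0∞) : ℝ≥0∞ :=
  ⨅ (r : ℝ≥0) (_ : s < Φ r), (r : ℝ≥0∞)

/-- The complementary function `r ↦ sup {r s - Φ s : s ≥ 0}`. The subtraction is truncated at `0`,
which does not change the supremum since `s = 0` contributes the value `0` when `Φ 0 = 0`. -/
def compl (Φ : ℝ≥0 → ℝ≥0∞) (r : ℝ≥0) : ℝ≥0∞ :=
  ⨆ s : ℝ≥0, (((r * s : ℝ≥0) : ℝ≥0∞) - Φ s)

/-- `s ↦ ∫₀ˢ A(t) / t^(1 + q) dt`. -/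
def primitiveDiv (A : ℝ≥0 → ℝ≥0∞) (q : ℝ) (s : ℝ≥0) : ℝ≥0∞ :=
  ∫⁻ t in Ioc (0 : ℝ) s, A t.toNNReal / ENNReal.ofReal (t ^ (1 + q))

/-- `s ↦ ∫₀ˢ r^(q - 1) (𝒜⁻¹(r^q))^q dr`, where `𝒜(s) = ∫₀ˢ A(t) / t^(1 + q) dt`. -/
def cianchiTransform (A : ℝ≥0 → ℝ≥0∞) (q : ℝ) (s : ℝ≥0) : ℝ≥0∞ :=
  ∫⁻ r in Ioc (0 : ℝ) s,
    ENNReal.ofReal (r ^ (q - 1)) * genInv (primitiveDiv A q) (ENNReal.ofReal (r ^ q)) ^ q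

/-- The Young function `Φ_p`, built from the complementary function of `Φ` with `p' = p / (p - 1)`. -/
def upperConj (Φ : ℝ≥0 → ℝ≥0∞) (p : ℝ) : ℝ≥0 → ℝ≥0∞ :=
  cianchiTransform (compl Φ) (p / (p - 1))

/-- The Young function `Ψ_p`: the one whose complementary function is the transform of `Ψ`
with `p' = p / (p - 1)`, that is, the complementary function of that transform. -/
def lowerConj (Ψ : ℝ≥0 → ℝ≥0∞) (p : ℝ) : ℝ≥0 → ℝ≥0∞ :=
  compl (cianchiTransform Ψ (p / (p - 1)))

/-- `Ψ` dominates `Φ` globally. -/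
def Dominates (Ψ Φ : ℝ≥0 → ℝ≥0∞) : Prop :=
  ∃ c : ℝ≥0, 0 < c ∧ ∀ s, Φ s ≤ Ψ (c * s)

/-- Cianchi's conditions for the weak type boundedness of the Riesz potential. -/
def CondWeak (n : ℕ) (α : ℝ) (Φ Ψ : ℝ≥0 → ℝ≥0∞) : Prop :=
  primitiveDiv (compl Φ) (n / (n - α)) 1 < ∞ ∧ Dominates (upperConj Φ (n / α)) Ψ

/-- Cianchi's conditions for the strong type boundedness of the Riesz potential. -/
def CondStrong (n : ℕ) (α : ℝ) (Φ Ψ : ℝ≥0 → ℝ≥0∞) : Prop :=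
  primitiveDiv (compl Φ) (n / (n - α)) 1 < ∞ ∧ primitiveDiv Ψ (n / (n - α)) 1 < ∞ ∧
    Dominates Φ (lowerConj Ψ (n / α)) ∧ Dominates (upperConj Φ (n / α)) Ψ

section Spaces

variable {n : ℕ} {𝕜 : Type*} [RCLike 𝕜]

/-- The Luxemburg norm of `L_Φ(ℝⁿ)`, with values in `[0,∞]`. -/
def orliczNorm (Φ : ℝ≥0 → ℝ≥0∞) (f : EuclideanSpace ℝ (Fin n) → 𝕜) : ℝ≥0∞ :=
  ⨅ (l : ℝ≥0) (_ : 0 < l) (_ : ∫⁻ x, Φ (‖f x‖₊ / l) ≤ 1), (l : ℝ≥0∞)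

/-- The quasinorm of the weak space `WL_Φ(ℝⁿ)`, with values in `[0,∞]`. -/
def weakOrliczNorm (Φ : ℝ≥0 → ℝ≥0∞) (f : EuclideanSpace ℝ (Fin n) → 𝕜) : ℝ≥0∞ :=
  ⨅ (l : ℝ≥0) (_ : 0 < l)
    (_ : ⨆ (t : ℝ≥0) (_ : 0 < t), Φ t * volume {x | t < ‖f x‖₊ / l} ≤ 1), (l : ℝ≥0∞)

/-- `f ∈ L_Φ(ℝⁿ)`. -/
def MemOrlicz (Φ : ℝ≥0 → ℝ≥0∞) (f : EuclideanSpace ℝ (Fin n) → 𝕜) : Prop :=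
  LocallyIntegrable f volume ∧ ∃ k : ℝ≥0, 0 < k ∧ ∫⁻ x, Φ (k * ‖f x‖₊) < ∞

/-- `f ∈ WL_Φ(ℝⁿ)`. -/
def MemWeakOrlicz (Φ : ℝ≥0 → ℝ≥0∞) (f : EuclideanSpace ℝ (Fin n) → 𝕜) : Prop :=
  LocallyIntegrable f volume ∧ weakOrliczNorm Φ f < ∞

/-- A positive (Lebesgue) measurable function on `ℝⁿ × (0,∞)`; its values at `r ≤ 0` play no
role. -/
def IsMorreyWeight (φ : EuclideanSpace ℝ (Fin n) → ℝ → ℝ) : Prop :=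
  (∀ x, ∀ r > 0, 0 < φ x r) ∧
    AEMeasurable (fun p : EuclideanSpace ℝ (Fin n) × ℝ => φ p.1 p.2)
      (volume.restrict (univ ×ˢ Ioi (0 : ℝ)))

/-- `sup_{x, r > 0} φ(x,r)⁻¹ Φ⁻¹(|B(x,r)|⁻¹) ‖f‖_{L_Φ(B(x,r))}`. -/
def morreyNorm (Φ : ℝ≥0 → ℝ≥0∞) (φ : EuclideanSpace ℝ (Fin n) → ℝ → ℝ)
    (f : EuclideanSpace ℝ (Fin n) → 𝕜) : ℝ≥0∞ :=
  ⨆ (x : EuclideanSpace ℝ (Fin n)) (r : ℝ) (_ : 0 < r),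
    (ENNReal.ofReal (φ x r))⁻¹ * genInv Φ ((volume (Metric.ball x r))⁻¹) *
      orliczNorm Φ ((Metric.ball x r).indicator f)

/-- `sup_{x, r > 0} φ(x,r)⁻¹ Φ⁻¹(|B(x,r)|⁻¹) ‖f‖_{WL_Φ(B(x,r))}`. -/
def weakMorreyNorm (Φ : ℝ≥0 → ℝ≥0∞) (φ : EuclideanSpace ℝ (Fin n) → ℝ → ℝ)
    (f : EuclideanSpace ℝ (Fin n) → 𝕜) : ℝ≥0∞ :=
  ⨆ (x : EuclideanSpace ℝ (Fin n)) (r : ℝ) (_ : 0 < r),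
    (ENNReal.ofReal (φ x r))⁻¹ * genInv Φ ((volume (Metric.ball x r))⁻¹) *
      weakOrliczNorm Φ ((Metric.ball x r).indicator f)

/-- `f ∈ M_{Φ,φ}(ℝⁿ)`: `f` is locally in `L_Φ` and has finite quasinorm. -/
def MemMorrey (Φ : ℝ≥0 → ℝ≥0∞) (φ : EuclideanSpace ℝ (Fin n) → ℝ → ℝ)
    (f : EuclideanSpace ℝ (Fin n) → 𝕜) : Prop :=
  (∀ x, ∀ r > 0, MemOrlicz Φ ((Metric.ball x r).indicator f)) ∧ morreyNorm Φ φ f < ∞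

/-- `f ∈ WM_{Φ,φ}(ℝⁿ)`: `f` is locally in `WL_Φ` and has finite weak quasinorm. -/
def MemWeakMorrey (Φ : ℝ≥0 → ℝ≥0∞) (φ : EuclideanSpace ℝ (Fin n) → ℝ → ℝ)
    (f : EuclideanSpace ℝ (Fin n) → 𝕜) : Prop :=
  (∀ x, ∀ r > 0, MemWeakOrlicz Φ ((Metric.ball x r).indicator f)) ∧ weakMorreyNorm Φ φ f < ∞

/-- The integrand `y ↦ f(y) / |x - y|^(n - α)` of the Riesz potential at `x`. -/
def rieszIntegrand (α : ℝ) (f : EuclideanSpace ℝ (Fin n) → 𝕜) (x y : EuclideanSpace ℝ (Fin n)) :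
    𝕜 :=
  (‖x - y‖ ^ ((n : ℝ) - α))⁻¹ • f y

/-- The Riesz potential `I_α f`. -/
def rieszPotential (α : ℝ) (f : EuclideanSpace ℝ (Fin n) → 𝕜) (x : EuclideanSpace ℝ (Fin n)) : 𝕜 :=
  ∫ y, rieszIntegrand α f x y

/-- The Zygmund-type condition
`∫_r^∞ (ess inf_{t<s<∞} φ₁(x,s) / Φ⁻¹(s⁻ⁿ)) Ψ⁻¹(t⁻ⁿ) dt/t ≤ C φ₂(x,r)`
with `C` independent of `x` and `r`. -/
def ZygmundCond (φ₁ φ₂ : EuclideanSpace ℝ (Fin n) → ℝ → ℝ) (Φ Ψ : ℝ≥0 → ℝ≥0∞) : Prop :=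
  ∃ C : ℝ≥0, ∀ x, ∀ r > 0,
    ∫⁻ t in Ioi r,
      essInf (fun s : ℝ => ENNReal.ofReal (φ₁ x s) / genInv Φ (ENNReal.ofReal ((s ^ n)⁻¹)))
          (volume.restrict (Ioi t)) *
        genInv Ψ (ENNReal.ofReal ((t ^ n)⁻¹)) / ENNReal.ofReal t
      ≤ C * ENNReal.ofReal (φ₂ x r)

end Spaces

end OrliczMorrey

end

noncomputable section

namespace OrliczMorrey

/-! Put p = n/α and q = p' = n/(n-α). The transform defining Φ_p is awkward because it passes
through the inverse of a primitive of the complementary function. It is replaced by a condition on Φ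
itself, `SlopeDominated`: Ψ(c K(T)) ≤ Φ(T), where K(T)^q is the integral of (t/Φ(t))^(q-1) over
(0,T]. Young's inequality and Tonelli compare K with that primitive (`slopeInt_le`), and
`exists_slopeDominated` turns the domination hypothesis into this condition. The same statement
applied to complementary functions handles the second domination hypothesis
(`exists_slopeDominated_compl`).

On all of ℝⁿ the potential is studied through distribution functions. Since the kernel has integral
at most C|S|^(α/n) over any set S, the integral of I_α F over S splits into an upper part (levels t
with |{F>t}| ≥ |S|) and a lower part (`setLIntegral_potential_le`). If F has Φ-modular at most 1,
Hölder's inequality bounds the integral of |{F>t}|^(α/n) over (0,T] by K(T), which is exactly what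
slope domination converts into a bound on Ψ. With S a level set of the potential this gives the weak
type estimate (`exists_weak_potential`).

For the strong type estimate, S runs over the level sets of a test function G. The upper part is
controlled by Young's inequality and a comparison of distribution functions
(`mul_lintegral_distrib_mul_upperPart_le`). The lower part, after exchanging integrals, is the upper
part with F and G interchanged, so it is controlled by the dual condition. A duality argument
returns from the bilinear form to the modular (`lintegral_apply_le_one_of_bilinear`).

In the Morrey setting f is split at the ball of radius 2r. The near part is covered by the global
estimates. The far part is bounded pointwise by the integral over t > r of the Orlicz norm of f on
B(x,t) times Ψ⁻¹(t⁻ⁿ)/t; these norms increase with t, so the essential infimum in the hypothesis may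
be inserted (`exists_tailInt_le`). -/

/-! ### Star-shaped functions and complementary functions -/

/-- `Φ` is star-shaped at the origin: `Φ (a s) ≤ a Φ s` for `a ≤ 1`. -/
def StarShaped (Φ : ℝ≥0 → ℝ≥0∞) : Prop :=
  ∀ a : ℝ≥0, a ≤ 1 → ∀ s, Φ (a * s) ≤ a * Φ s

theorem IsYoung.starShaped {Φ : ℝ≥0 → ℝ≥0∞} (h : IsYoung Φ) : StarShaped Φ := by
  intro a ha s
  have := h.convex.2 (mem_univ s) (mem_univ 0) (zero_le (a := a)) (zero_le (a := 1 - a))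
    (add_tsub_cancel_of_le ha)
  simpa [h.map_zero, ENNReal.smul_def] using this

/-- No assumption on Φ is needed. Working with star-shapedness instead of the full Young axioms
therefore lets every later estimate be applied to complementary functions directly. -/
theorem starShaped_compl (Φ : ℝ≥0 → ℝ≥0∞) : StarShaped (compl Φ) := by
  intro a ha s
  refine iSup_le fun r => ?_
  rw [tsub_le_iff_right]
  calc ((a * s * r : ℝ≥0) : ℝ≥0∞) = a * ((s * r : ℝ≥0) : ℝ≥0∞) := by push_cast; ring
    _ ≤ a * (compl Φ s + Φ r) := by
        gcongr
        rw [← tsub_le_iff_right]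
        exact le_iSup (fun r : ℝ≥0 => ((s * r : ℝ≥0) : ℝ≥0∞) - Φ r) r
    _ ≤ a * compl Φ s + Φ r := by
        rw [mul_add]
        gcongr
        exact mul_le_of_le_one_left' (by exact_mod_cast ha)

namespace StarShaped

variable {Φ : ℝ≥0 → ℝ≥0∞}

theorem monotone (h : StarShaped Φ) : Monotone Φ := by
  intro s t hst
  rcases eq_or_ne t 0 with rfl | ht
  · simp [le_antisymm hst zero_le]
  have h1 := h (s / t) (div_le_one_of_le₀ hst zero_le) t
  rw [div_mul_cancel₀ _ ht] at h1
  exact h1.trans (mul_le_of_le_one_left' (by exact_mod_cast div_le_one_of_le₀ hst zero_le))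

theorem measurable (h : StarShaped Φ) : Measurable Φ := h.monotone.measurable

theorem map_zero (h : StarShaped Φ) : Φ 0 = 0 := by
  simpa using h 0 zero_le_one 0

/-- The slope `Φ(s)/s` is non-decreasing. -/
theorem mul_le_mul (h : StarShaped Φ) {s t : ℝ≥0} (hst : s ≤ t) :
    (t : ℝ≥0∞) * Φ s ≤ s * Φ t := by
  rcases eq_or_ne t 0 with rfl | ht
  · simp
  have h1 := h (s / t) (div_le_one_of_le₀ hst zero_le) t
  rw [div_mul_cancel₀ _ ht] at h1
  calc (t : ℝ≥0∞) * Φ s ≤ t * ((s / t : ℝ≥0) * Φ t) := by gcongr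
    _ = ((t * (s / t) : ℝ≥0) : ℝ≥0∞) * Φ t := by push_cast; ring
    _ = s * Φ t := by rw [mul_div_cancel₀ _ ht]

theorem div_le_div (h : StarShaped Φ) {s t : ℝ≥0} (hs : 0 < s) (hst : s ≤ t) :
    Φ s / s ≤ Φ t / t := by
  have ht := hs.trans_le hst
  rw [ENNReal.div_le_iff (by simpa using hs.ne') ENNReal.coe_ne_top, mul_comm, ← mul_div_assoc,
    ENNReal.le_div_iff_mul_le (by simp [ht.ne']) (by simp), mul_comm]
  exact h.mul_le_mul hst

/-- `Φ (s / K) ≤ Φ s / K` for `K ≥ 1`. -/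
theorem apply_div_le (h : StarShaped Φ) {K : ℝ≥0} (hK : 1 ≤ K) (s : ℝ≥0) :
    Φ (s / K) ≤ Φ s / K := by
  have h1 := h K⁻¹ (inv_le_one_of_one_le₀ hK) s
  rw [ENNReal.coe_inv (by positivity), mul_comm, mul_comm (_⁻¹)] at h1
  simpa [div_eq_mul_inv] using h1

theorem apply_half_le (h : StarShaped Φ) (s : ℝ≥0) : 2 * Φ s ≤ Φ (2 * s) := by
  have h1 := h.apply_div_le (K := 2) one_le_two (2 * s)
  rw [mul_div_cancel_left₀ _ two_ne_zero] at h1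
  rw [mul_comm, ← ENNReal.le_div_iff_mul_le (by simp) (by simp)]
  simpa using h1

/-- The modular inequality `∫ Φ(f) ≤ C` with `C` large can be normalized by scaling. -/
theorem apply_mul_le_of_le (h : StarShaped Φ) {K : ℝ≥0} (hK : 1 ≤ K) {s : ℝ≥0} {b : ℝ≥0∞}
    (hb : Φ s ≤ K * b) : Φ (s / K) ≤ b :=
  (h.apply_div_le hK s).trans (ENNReal.div_le_of_le_mul' hb)

/-- A slope g not exceeding Φ(a)/a is beaten by Φ beyond a, because slopes increase, so only
competitors s ≤ a matter and they give at most g a. This replaces the equality case of Young's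
inequality in the duality argument. -/
theorem compl_le (h : StarShaped Φ) {a g : ℝ≥0} (hg : (g : ℝ≥0∞) * a ≤ Φ a)
    (ha : a = 0 → g = 0) : compl Φ g ≤ Φ a := by
  refine iSup_le fun s => ?_
  rcases le_total s a with hs | hs
  · refine tsub_le_self.trans (le_trans ?_ hg)
    rw [ENNReal.coe_mul]
    gcongr
  · rcases eq_or_ne a 0 with h0 | h0
    · simp [ha h0]
    · rw [tsub_eq_zero_of_le]
      · exact zero_le
      · have h1 := h.mul_le_mul hs
        have h2 : (a : ℝ≥0∞) * (g * s : ℝ≥0) ≤ a * Φ s := by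
          calc (a : ℝ≥0∞) * (g * s : ℝ≥0) = s * (g * a) := by push_cast; ring
            _ ≤ s * Φ a := by gcongr
            _ ≤ _ := h1
        rwa [ENNReal.mul_le_mul_iff_right (by simpa using h0) (by simp)] at h2

end StarShaped

/-- Young's inequality. -/
theorem coe_mul_le_compl_add (Φ : ℝ≥0 → ℝ≥0∞) (r s : ℝ≥0) :
    (r : ℝ≥0∞) * s ≤ compl Φ r + Φ s := by
  rw [← tsub_le_iff_right, ← ENNReal.coe_mul]
  exact le_iSup (fun s : ℝ≥0 => ((r * s : ℝ≥0) : ℝ≥0∞) - Φ s) s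

/-- Only this half of biduality is ever used, so neither convexity nor semicontinuity enters. -/
theorem compl_compl_le (Φ : ℝ≥0 → ℝ≥0∞) (s : ℝ≥0) : compl (compl Φ) s ≤ Φ s := by
  refine iSup_le fun r => ?_
  rw [tsub_le_iff_left, mul_comm, ENNReal.coe_mul]
  exact coe_mul_le_compl_add Φ r s

theorem compl_anti {Φ Ψ : ℝ≥0 → ℝ≥0∞} (h : ∀ s, Φ s ≤ Ψ s) (r : ℝ≥0) : compl Ψ r ≤ compl Φ r :=
  iSup_mono fun s => tsub_le_tsub_left (h s) _

/-! ### Generalized inverses -/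

theorem genInv_le {Φ : ℝ≥0 → ℝ≥0∞} {s : ℝ≥0∞} {r : ℝ≥0} (h : s < Φ r) : genInv Φ s ≤ r :=
  iInf₂_le r h

theorem apply_le_of_lt_genInv {Φ : ℝ≥0 → ℝ≥0∞} {s : ℝ≥0∞} {r : ℝ≥0} (h : (r : ℝ≥0∞) < genInv Φ s) :
    Φ r ≤ s := by
  by_contra! h'
  exact absurd (genInv_le h') (not_le.2 h)

theorem lt_apply_of_genInv_lt {Φ : ℝ≥0 → ℝ≥0∞} (hΦ : Monotone Φ) {s : ℝ≥0∞} {r : ℝ≥0}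
    (h : genInv Φ s < r) : s < Φ r := by
  simp only [genInv, iInf_lt_iff] at h
  obtain ⟨r', h1, h2⟩ := h
  exact h1.trans_le (hΦ (by exact_mod_cast h2.le))

theorem genInv_mono (Φ : ℝ≥0 → ℝ≥0∞) : Monotone (genInv Φ) := fun _ _ h =>
  le_iInf₂ fun _ hr => genInv_le (h.trans_lt hr)

theorem genInv_anti {Φ Ψ : ℝ≥0 → ℝ≥0∞} (h : ∀ s, Φ s ≤ Ψ s) (x : ℝ≥0∞) :
    genInv Ψ x ≤ genInv Φ x :=
  le_iInf₂ fun r hr => genInv_le (hr.trans_le (h r))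

theorem le_genInv {Φ : ℝ≥0 → ℝ≥0∞} (hΦ : Monotone Φ) {s : ℝ≥0∞} {r : ℝ≥0} (h : Φ r ≤ s) :
    (r : ℝ≥0∞) ≤ genInv Φ s :=
  le_iInf₂ fun r' hr' => by
    by_contra! h'
    exact absurd (h.trans_lt hr') (not_lt.2 (hΦ (by exact_mod_cast h'.le)))

theorem StarShaped.genInv_mul_le {Φ : ℝ≥0 → ℝ≥0∞} (h : StarShaped Φ) {K : ℝ≥0} (hK : 1 ≤ K)
    (x : ℝ≥0∞) : genInv Φ (K * x) ≤ K * genInv Φ x := by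
  have hK0 : (K : ℝ≥0∞) ≠ 0 := by
    have : K ≠ 0 := by positivity
    simpa using this
  rw [mul_comm (K : ℝ≥0∞) (genInv Φ x), ← ENNReal.div_le_iff hK0 (by simp)]
  refine le_iInf₂ fun r hr => ?_
  rw [ENNReal.div_le_iff hK0 (by simp), ← ENNReal.coe_mul]
  refine genInv_le ?_
  have h1 := h.apply_div_le hK (r * K)
  rw [mul_div_cancel_right₀ _ (by positivity)] at h1
  rw [mul_comm, ← ENNReal.lt_div_iff_mul_lt (Or.inl hK0) (Or.inl (by simp))]
  exact hr.trans_le h1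

theorem IsYoung.genInv_pos {Φ : ℝ≥0 → ℝ≥0∞} (h : IsYoung Φ) {x : ℝ≥0∞} (hx : x ≠ 0) :
    genInv Φ x ≠ 0 := by
  have h1 : ∀ᶠ r in 𝓝[>] (0 : ℝ≥0), Φ r < x :=
    h.tendsto_zero.eventually (gt_mem_nhds (pos_iff_ne_zero.2 hx))
  obtain ⟨r, hr, hr0⟩ := (h1.and self_mem_nhdsWithin).exists
  have h2 := le_genInv h.starShaped.monotone hr.le
  have h3 : (0 : ℝ≥0∞) < r := by simpa using hr0
  exact (h3.trans_le h2).ne'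

theorem IsYoung.genInv_ne_top {Φ : ℝ≥0 → ℝ≥0∞} (h : IsYoung Φ) {x : ℝ≥0∞} (hx : x ≠ ∞) :
    genInv Φ x ≠ ∞ := by
  obtain ⟨r, hr⟩ := (h.tendsto_top.eventually (lt_mem_nhds (lt_top_iff_ne_top.2 hx))).exists
  exact ((genInv_le hr).trans_lt ENNReal.coe_lt_top).ne

/-! ### The Sobolev conjugate in terms of slopes -/

/-- The slope `Φ(t)/t`. -/
def slope (Φ : ℝ≥0 → ℝ≥0∞) (t : ℝ) : ℝ≥0∞ := Φ t.toNNReal / ENNReal.ofReal t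

/-- `∫₀ᵀ (t / Φ(t))^(q - 1) dt`. -/
def slopeInt (Φ : ℝ≥0 → ℝ≥0∞) (q : ℝ) (T : ℝ) : ℝ≥0∞ :=
  ∫⁻ t in Ioc 0 T, slope Φ t ^ (1 - q)

/-- `Ψ (c K(T)) ≤ Φ(T)`, where `K(T) = (∫₀ᵀ (t / Φ(t))^(q - 1) dt)^(1/q)`. -/
structure SlopeDominated (q : ℝ) (c : ℝ≥0) (Φ Ψ : ℝ≥0 → ℝ≥0∞) : Prop where
  ne_zero : ∀ T : ℝ≥0, 0 < T → Φ T ≠ 0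
  le : ∀ T z : ℝ≥0, 0 < T → (z : ℝ≥0∞) ^ q ≤ slopeInt Φ q T → Ψ (c * z) ≤ Φ T

theorem StarShaped.measurable_slope {Φ : ℝ≥0 → ℝ≥0∞} (h : StarShaped Φ) :
    Measurable (slope Φ) :=
  (h.measurable.comp measurable_real_toNNReal).div ENNReal.measurable_ofReal

theorem StarShaped.slope_mono {Φ : ℝ≥0 → ℝ≥0∞} (h : StarShaped Φ) {s t : ℝ} (hs : 0 < s)
    (hst : s ≤ t) : slope Φ s ≤ slope Φ t :=
  h.div_le_div (Real.toNNReal_pos.2 hs) (Real.toNNReal_le_toNNReal hst)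

theorem slope_mul_self (Φ : ℝ≥0 → ℝ≥0∞) {t : ℝ} (ht : 0 < t) :
    slope Φ t * ENNReal.ofReal t = Φ t.toNNReal :=
  ENNReal.div_mul_cancel (by simpa using ht) (by simp)

theorem volume_setOf_ofReal_le_le (x : ℝ≥0∞) :
    volume {t : ℝ | 0 < t ∧ ENNReal.ofReal t ≤ x} ≤ x := by
  rcases eq_or_ne x ∞ with rfl | hx
  · simp
  calc volume {t : ℝ | 0 < t ∧ ENNReal.ofReal t ≤ x} ≤ volume (Ioc 0 x.toReal) := by
        refine measure_mono fun t ht => ⟨ht.1, ?_⟩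
        exact (ENNReal.ofReal_le_iff_le_toReal hx).1 ht.2
    _ = x := by simp [hx]

/-- On this set Φ(τ) ≤ tτ/2, so half of tτ can be absorbed in Young's inequality, leaving τ at most
twice the complementary function at t divided by t. -/
theorem volume_setOf_slope_lt_le (Φ : ℝ≥0 → ℝ≥0∞) {t : ℝ} (ht : 0 < t) :
    volume {τ : ℝ | 0 < τ ∧ 2 * slope Φ τ < ENNReal.ofReal t} ≤
      2 * (compl Φ t.toNNReal / ENNReal.ofReal t) := by
  refine le_trans (measure_mono ?_) (volume_setOf_ofReal_le_le _)
  rintro τ ⟨hτ, h⟩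
  refine ⟨hτ, ?_⟩
  have ht0 : ENNReal.ofReal t ≠ 0 := by simpa using ht
  rw [← mul_div_assoc, ENNReal.le_div_iff_mul_le (Or.inl ht0) (Or.inl (by simp))]
  have h1 := coe_mul_le_compl_add Φ t.toNNReal τ.toNNReal
  have h2 : 2 * Φ τ.toNNReal ≤ ENNReal.ofReal τ * ENNReal.ofReal t := by
    rw [← slope_mul_self Φ hτ, ← mul_assoc, mul_comm]
    gcongr
  have h3 : 2 * (ENNReal.ofReal τ * ENNReal.ofReal t) ≤
      2 * compl Φ t.toNNReal + ENNReal.ofReal τ * ENNReal.ofReal t := by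
    calc 2 * (ENNReal.ofReal τ * ENNReal.ofReal t)
        ≤ 2 * (compl Φ t.toNNReal + Φ τ.toNNReal) := by
          gcongr
          rw [mul_comm]; exact h1
      _ ≤ _ := by rw [mul_add]; gcongr
  rw [two_mul] at h3
  exact (ENNReal.add_le_add_iff_right (by finiteness)).1 h3

/-- After Tonelli the inner integral is t^(-q) times the measure of a sublevel set of the slope, and
the extra factor 1/t from that measure produces the weight t^(-1-q) of the primitive. -/
theorem lintegral_slope_indicator_le {Φ : ℝ≥0 → ℝ≥0∞} (h : StarShaped Φ) {q : ℝ} (s : ℝ≥0) :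
    ∫⁻ τ in Ioi (0 : ℝ), ∫⁻ t in Ioc (0 : ℝ) s,
      {p : ℝ × ℝ | 2 * slope Φ p.1 < ENNReal.ofReal p.2}.indicator
        (fun p => ENNReal.ofReal (p.2 ^ (-q))) (τ, t) ≤ 2 * primitiveDiv (compl Φ) q s := by
  have hm : MeasurableSet {p : ℝ × ℝ | 2 * slope Φ p.1 < ENNReal.ofReal p.2} := by
    refine measurableSet_lt ?_ ?_
    · exact (h.measurable_slope.comp measurable_fst).const_mul 2
    · exact ENNReal.measurable_ofReal.comp measurable_snd
  have hm2 : Measurable ({p : ℝ × ℝ | 2 * slope Φ p.1 < ENNReal.ofReal p.2}.indicator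
        (fun p => ENNReal.ofReal (p.2 ^ (-q)))) := by
    refine Measurable.indicator ?_ hm
    fun_prop
  rw [lintegral_lintegral_swap (by exact hm2.aemeasurable), primitiveDiv,
    ← lintegral_const_mul' _ _ (by simp)]
  refine setLIntegral_mono' measurableSet_Ioc fun t ht => ?_
  have ht0 := ht.1
  have hm3 : MeasurableSet {τ : ℝ | 2 * slope Φ τ < ENNReal.ofReal t} :=
    measurableSet_lt (h.measurable_slope.const_mul 2) measurable_const
  calc ∫⁻ τ in Ioi (0 : ℝ), {p : ℝ × ℝ | 2 * slope Φ p.1 < ENNReal.ofReal p.2}.indicator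
        (fun p => ENNReal.ofReal (p.2 ^ (-q))) (τ, t)
      = ∫⁻ τ in Ioi (0 : ℝ), {τ : ℝ | 2 * slope Φ τ < ENNReal.ofReal t}.indicator
        (fun _ => ENNReal.ofReal (t ^ (-q))) τ := rfl
    _ = ENNReal.ofReal (t ^ (-q)) * volume {τ : ℝ | 0 < τ ∧ 2 * slope Φ τ < ENNReal.ofReal t} := by
        rw [lintegral_indicator_const hm3, Measure.restrict_apply hm3]
        congr 2
        ext τ; simp [and_comm]
    _ ≤ ENNReal.ofReal (t ^ (-q)) * (2 * (compl Φ t.toNNReal / ENNReal.ofReal t)) := by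
        gcongr
        exact volume_setOf_slope_lt_le Φ ht0
    _ = _ := by
        rw [Real.rpow_add ht0, Real.rpow_one, ENNReal.ofReal_mul ht0.le, div_eq_mul_inv,
          div_eq_mul_inv, ENNReal.mul_inv (by simp [ht0]) (by simp), Real.rpow_neg ht0.le,
          ENNReal.ofReal_inv_of_pos (by positivity)]
        ring

/-- Writes a power as an integral over a dyadic shell, bounding the integrand by its value at the
right end. The shell starts at 2a so that t > 2a can encode a set: a sublevel set of the slope in
one use, and in the other, with a half the distance from y to the centre, the event that y lies in
the ball of radius t. -/
theorem rpow_one_sub_le_lintegral {a : ℝ} (ha : 0 < a) {q : ℝ} (hq : 1 < q) :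
    ENNReal.ofReal a ^ (1 - q) ≤
      ENNReal.ofReal (4 ^ q / 2) * ∫⁻ t in Ioc (2 * a) (4 * a), ENNReal.ofReal (t ^ (-q)) := by
  have h1 : ENNReal.ofReal ((4 * a) ^ (-q)) * ENNReal.ofReal (2 * a) ≤
      ∫⁻ t in Ioc (2 * a) (4 * a), ENNReal.ofReal (t ^ (-q)) := by
    calc _ = ∫⁻ _ in Ioc (2 * a) (4 * a), ENNReal.ofReal ((4 * a) ^ (-q)) := by
          rw [lintegral_const, Measure.restrict_apply_univ, Real.volume_Ioc]
          congr 2; ring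
      _ ≤ _ := by
          refine setLIntegral_mono' measurableSet_Ioc fun t ht => ?_
          refine ENNReal.ofReal_le_ofReal ?_
          have : 0 < t := by linarith [ht.1]
          exact Real.rpow_le_rpow_of_nonpos this ht.2 (by linarith)
  calc ENNReal.ofReal a ^ (1 - q) = ENNReal.ofReal (4 ^ q / 2) *
        (ENNReal.ofReal ((4 * a) ^ (-q)) * ENNReal.ofReal (2 * a)) := by
        rw [← ENNReal.ofReal_mul (by positivity), ← ENNReal.ofReal_mul (by positivity),
          ENNReal.ofReal_rpow_of_pos ha, Real.mul_rpow (by norm_num) ha.le, Real.rpow_neg (by norm_num),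
          sub_eq_add_neg, Real.rpow_add ha, Real.rpow_one]
        congr 1
        have : (4 : ℝ) ^ q ≠ 0 := by positivity
        field_simp
    _ ≤ _ := by gcongr

/-- `∫₀ᵀ (t / Φ(t))^(q - 1) dt ≤ 4^q 𝒜(4s) + T s^(1 - q)`. -/
theorem slopeInt_le {Φ : ℝ≥0 → ℝ≥0∞} (h : StarShaped Φ) (hpos : ∀ T : ℝ≥0, 0 < T → Φ T ≠ 0)
    {q : ℝ} (hq : 1 < q) (T : ℝ) (s : ℝ≥0) :
    slopeInt Φ q T ≤ ENNReal.ofReal (4 ^ q) * primitiveDiv (compl Φ) q (4 * s) +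
      ENNReal.ofReal T * (s : ℝ≥0∞) ^ (1 - q) := by
  set F : ℝ → ℝ≥0∞ := fun τ => ∫⁻ t in Ioc (0 : ℝ) ((4 * s : ℝ≥0) : ℝ),
      {p : ℝ × ℝ | 2 * slope Φ p.1 < ENNReal.ofReal p.2}.indicator
        (fun p => ENNReal.ofReal (p.2 ^ (-q))) (τ, t) with hF
  have key : ∀ τ ∈ Ioc 0 T, slope Φ τ ^ (1 - q) ≤
      ENNReal.ofReal (4 ^ q / 2) * F τ + (s : ℝ≥0∞) ^ (1 - q) := by
    intro τ hτ
    -- Large slopes are paid for by the constant term. For a slope a ≤ s the whole shell (2a, 4a]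
    -- lies inside (0, 4s], where the indicator is counted.
    rcases le_total (s : ℝ≥0∞) (slope Φ τ) with h1 | h1
    · refine le_add_left ?_
      rw [← neg_sub, ENNReal.rpow_neg, ENNReal.rpow_neg, ENNReal.inv_le_inv]
      exact ENNReal.rpow_le_rpow h1 (by linarith)
    · refine le_add_right ?_
      have hne : slope Φ τ ≠ ∞ := (h1.trans_lt ENNReal.coe_lt_top).ne
      have hn0 : slope Φ τ ≠ 0 := by
        simp only [slope, ne_eq, ENNReal.div_eq_zero_iff, not_or]
        exact ⟨hpos _ (Real.toNNReal_pos.2 hτ.1), by simp⟩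
      set a := (slope Φ τ).toReal with ha
      have ha0 : 0 < a := ENNReal.toReal_pos hn0 hne
      have haeq : slope Φ τ = ENNReal.ofReal a := (ENNReal.ofReal_toReal hne).symm
      have has : a ≤ s := by
        have := ENNReal.toReal_mono ENNReal.coe_ne_top h1
        simpa using this
      rw [haeq]
      refine (rpow_one_sub_le_lintegral ha0 hq).trans ?_
      gcongr
      calc ∫⁻ t in Ioc (2 * a) (4 * a), ENNReal.ofReal (t ^ (-q))
          = ∫⁻ t in Ioc (2 * a) (4 * a),
            {p : ℝ × ℝ | 2 * slope Φ p.1 < ENNReal.ofReal p.2}.indicator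
              (fun p => ENNReal.ofReal (p.2 ^ (-q))) (τ, t) := by
            refine setLIntegral_congr_fun measurableSet_Ioc fun t ht => ?_
            rw [indicator_of_mem]
            simp only [mem_ofPred_eq, haeq]
            rw [← ENNReal.ofReal_ofNat, ← ENNReal.ofReal_mul (by norm_num)]
            exact (ENNReal.ofReal_lt_ofReal_iff (by linarith [ht.1])).2 ht.1
        _ ≤ F τ := by
            refine lintegral_mono_set fun t ht => ⟨by linarith [ht.1], ?_⟩
            push_cast
            linarith [ht.2]
  calc slopeInt Φ q T ≤ ∫⁻ τ in Ioc 0 T, (ENNReal.ofReal (4 ^ q / 2) * F τ + (s : ℝ≥0∞) ^ (1 - q)) :=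
        setLIntegral_mono' measurableSet_Ioc key
    _ = (∫⁻ τ in Ioc 0 T, ENNReal.ofReal (4 ^ q / 2) * F τ) +
        ENNReal.ofReal T * (s : ℝ≥0∞) ^ (1 - q) := by
        rw [lintegral_add_right _ measurable_const]
        simp [mul_comm]
    _ ≤ _ := by
        gcongr
        rw [lintegral_const_mul' _ _ (by simp)]
        calc ENNReal.ofReal (4 ^ q / 2) * ∫⁻ τ in Ioc 0 T, F τ
            ≤ ENNReal.ofReal (4 ^ q / 2) * (2 * primitiveDiv (compl Φ) q (4 * s)) := by
              gcongr
              exact (lintegral_mono_set Ioc_subset_Ioi_self).trans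
                (lintegral_slope_indicator_le h (4 * s))
          _ = _ := by
              rw [← mul_assoc, ← ENNReal.ofReal_ofNat, ← ENNReal.ofReal_mul (by positivity)]
              congr 2
              ring

/-- Both factors of the integrand are non-decreasing in r, so they are replaced by their values at
the right end. -/
theorem cianchiTransform_le (A : ℝ≥0 → ℝ≥0∞) {q : ℝ} (hq : 1 < q) (w : ℝ≥0) :
    cianchiTransform A q w ≤ (w * genInv (primitiveDiv A q) ((w : ℝ≥0∞) ^ q)) ^ q := by
  have hq0 : 0 ≤ q := by linarith
  calc cianchiTransform A q w ≤ ∫⁻ _ in Ioc (0 : ℝ) w, (w : ℝ≥0∞) ^ (q - 1) *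
        genInv (primitiveDiv A q) ((w : ℝ≥0∞) ^ q) ^ q := by
        refine setLIntegral_mono' measurableSet_Ioc fun r hr => ?_
        have h1 : ENNReal.ofReal r ≤ w := by
          simpa using ENNReal.ofReal_le_ofReal hr.2
        rw [← ENNReal.ofReal_rpow_of_pos hr.1, ← ENNReal.ofReal_rpow_of_pos hr.1]
        refine mul_le_mul' (ENNReal.rpow_le_rpow h1 (by linarith)) (ENNReal.rpow_le_rpow ?_ hq0)
        exact genInv_mono _ (ENNReal.rpow_le_rpow h1 hq0)
    _ = _ := by
        rw [lintegral_const, ENNReal.mul_rpow_of_nonneg _ _ hq0]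
        simp only [Measure.restrict_apply_univ, Real.volume_Ioc, sub_zero, ENNReal.ofReal_coe_nnreal]
        rw [mul_right_comm]
        congr 1
        nth_rewrite 2 [← ENNReal.rpow_one (w : ℝ≥0∞)]
        rw [← ENNReal.rpow_add_of_nonneg _ _ (by linarith) zero_le_one]
        simp

/-- If Φ(T) = 0, the complementary function is at least linear with slope T, and the primitive would
dominate the integral of T t^(-q) near 0, which diverges for q > 1. -/
theorem ne_zero_of_primitiveDiv_compl_lt_top {Φ : ℝ≥0 → ℝ≥0∞} {q : ℝ} (hq : 1 < q)
    (h : primitiveDiv (compl Φ) q 1 < ∞) {T : ℝ≥0} (hT : 0 < T) : Φ T ≠ 0 := by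
  intro h0
  have h1 : ∀ t ∈ Ioc (0 : ℝ) 1, (T : ℝ≥0∞) * ENNReal.ofReal (t ^ (-q)) ≤
      compl Φ t.toNNReal / ENNReal.ofReal (t ^ (1 + q)) := by
    intro t ht
    have h2 := coe_mul_le_compl_add Φ t.toNNReal T
    rw [h0, add_zero] at h2
    have ht0 := ht.1
    rw [ENNReal.le_div_iff_mul_le (Or.inl (by simpa using by positivity)) (Or.inl (by simp)),
      mul_assoc, ← ENNReal.ofReal_mul (by positivity), ← Real.rpow_add ht0, mul_comm,
      show -q + (1 + q) = 1 by ring, Real.rpow_one]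
    exact h2
  have h2 : ∫⁻ t in Ioc (0 : ℝ) 1, ENNReal.ofReal (t ^ (-q)) < ∞ := by
    have h3 : ∫⁻ t in Ioc (0 : ℝ) 1, (T : ℝ≥0∞) * ENNReal.ofReal (t ^ (-q)) < ∞ := by
      refine lt_of_le_of_lt (setLIntegral_mono' measurableSet_Ioc h1) ?_
      simpa [primitiveDiv] using h
    rw [lintegral_const_mul' _ _ (by simp)] at h3
    exact ENNReal.lt_top_of_mul_ne_top_right h3.ne (by simpa using hT.ne')
  have h3 : IntegrableOn (fun t : ℝ => t ^ (-q)) (Ioo 0 1) := by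
    have h4 : IntegrableOn (fun t : ℝ => t ^ (-q)) (Ioc 0 1) := by
      refine ⟨by fun_prop, ?_⟩
      rw [hasFiniteIntegral_iff_ofReal]
      · exact h2
      · filter_upwards [ae_restrict_mem measurableSet_Ioc] with t ht
        exact Real.rpow_nonneg ht.1.le _
    exact h4.mono_set Ioo_subset_Ioc_self
  rw [intervalIntegral.integrableOn_Ioo_rpow_iff one_pos] at h3
  linarith

theorem mul_rpow_slope_le_slopeInt {Φ : ℝ≥0 → ℝ≥0∞} (h : StarShaped Φ) {q : ℝ} (hq : 1 < q)
    (T : ℝ) : ENNReal.ofReal T * slope Φ T ^ (1 - q) ≤ slopeInt Φ q T := by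
  calc _ = ∫⁻ _ in Ioc 0 T, slope Φ T ^ (1 - q) := by simp [mul_comm]
    _ ≤ _ := by
      refine setLIntegral_mono' measurableSet_Ioc fun t ht => ?_
      rw [← neg_sub, ENNReal.rpow_neg, ENNReal.rpow_neg, ENNReal.inv_le_inv]
      exact ENNReal.rpow_le_rpow (h.slope_mono ht.1 ht.2) (by linarith)

/-- The conjugate function `Φ_p` is dominated by `Φ ∘ K⁻¹`, where
`K(T) = (∫₀ᵀ (t / Φ(t))^(q - 1) dt)^(1/q)`. -/
theorem exists_slopeDominated {Φ Ψ : ℝ≥0 → ℝ≥0∞} (hΦ : StarShaped Φ) (hΨ : StarShaped Ψ)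
    {q : ℝ} (hq : 1 < q) (hfin : primitiveDiv (compl Φ) q 1 < ∞)
    (hdom : Dominates (cianchiTransform (compl Φ) q) Ψ) :
    ∃ c : ℝ≥0, 0 < c ∧ SlopeDominated q c Φ Ψ := by
  obtain ⟨c₀, hc₀, hdom⟩ := hdom
  have hq0 : 0 < q := by linarith
  have hq1 : 0 < q - 1 := by linarith
  have hpos : ∀ T : ℝ≥0, 0 < T → Φ T ≠ 0 := fun T hT =>
    ne_zero_of_primitiveDiv_compl_lt_top hq hfin hT
  set c₁ : ℝ≥0 := (4 ^ (-q) / 4) ^ (1 / q) with hc₁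
  have hc₁q : c₁ ^ q = 4 ^ (-q) / 4 := by
    rw [hc₁, ← NNReal.rpow_mul, one_div_mul_cancel hq0.ne', NNReal.rpow_one]
  have hc₁0 : 0 < c₁ := by positivity
  set β : ℝ≥0 := 2 ^ (1 / (q - 1)) with hβ
  set K : ℝ≥0 := max 1 β with hK
  refine ⟨c₁ / c₀ / K, by positivity, hpos, fun T z hT hz => ?_⟩
  rcases eq_or_ne (Φ T) ∞ with htop | htop
  · simp [htop]
  have hLtop : slopeInt Φ q T ≠ ∞ := by
    -- With s = 1/4 the primitive is evaluated at 1, where it is finite by hypothesis.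
    have h1 := slopeInt_le hΦ hpos hq T (1 / 4)
    have h2 : (4 : ℝ≥0) * (1 / 4) = 1 := by norm_num
    rw [h2] at h1
    refine (h1.trans_lt ?_).ne
    refine ENNReal.add_lt_top.2 ⟨ENNReal.mul_lt_top (by simp) hfin, ENNReal.mul_lt_top (by simp) ?_⟩
    rw [lt_top_iff_ne_top]
    refine ENNReal.rpow_ne_top_of_ne_zero ?_ (by simp)
    simp
  set f : ℝ≥0 := (Φ T).toNNReal / T with hf
  have hΦT : Φ T = ((f * T : ℝ≥0) : ℝ≥0∞) := by
    rw [hf, div_mul_cancel₀ _ hT.ne', ENNReal.coe_toNNReal htop]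
  have hf0 : 0 < f := by
    have h1 : 0 < (Φ T).toNNReal := ENNReal.toNNReal_pos (hpos T hT) htop
    positivity
  have hslope : slope Φ T = f := by
    rw [slope, Real.toNNReal_coe, ENNReal.ofReal_coe_nnreal, hΦT, ENNReal.coe_mul,
      ENNReal.mul_div_cancel_right (by simpa using hT.ne') (by simp)]
  set l : ℝ≥0 := (slopeInt Φ q T).toNNReal with hl
  have hL : slopeInt Φ q T = l := (ENNReal.coe_toNNReal hLtop).symm
  have hlf : T * f ^ (1 - q) ≤ l := by
    have h1 := mul_rpow_slope_le_slopeInt hΦ hq (T : ℝ)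
    rw [hslope, hL, ENNReal.ofReal_coe_nnreal, ← ENNReal.coe_rpow_of_ne_zero hf0.ne'] at h1
    exact_mod_cast h1
  have hl0 : 0 < l := lt_of_lt_of_le (by positivity) hlf
  -- This s makes the term T s^(1-q) equal to l/2, so the primitive at 4s must carry the other half
  -- of l.
  set s : ℝ≥0 := (2 * T / l) ^ (1 / (q - 1)) with hs
  have hs0 : 0 < s := by positivity
  have hsq : s ^ (q - 1) = 2 * T / l := by
    rw [hs, ← NNReal.rpow_mul, one_div_mul_cancel hq1.ne', NNReal.rpow_one]
  have hsq' : T * s ^ (1 - q) = l / 2 := by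
    rw [← neg_sub, NNReal.rpow_neg, hsq]
    field_simp
  -- Monotone slopes give l ≥ T f^(1-q); this turns the definition of s into a bound by the slope f
  -- of Φ at T, and hence T s into a multiple of Φ(T).
  have hsf : s ≤ β * f := by
    have h1 : s ^ (q - 1) ≤ (β * f) ^ (q - 1) := by
      rw [hsq, NNReal.mul_rpow, hβ, ← NNReal.rpow_mul, one_div_mul_cancel hq1.ne', NNReal.rpow_one,
        mul_div_assoc]
      gcongr
      rw [div_le_iff₀ hl0]
      calc T = f ^ (q - 1) * (T * f ^ (1 - q)) := by
            rw [mul_left_comm, ← NNReal.rpow_add hf0.ne']; simp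
        _ ≤ _ := by gcongr
    exact (NNReal.rpow_le_rpow_iff hq1).1 h1
  have hzl : z ^ q ≤ l := by
    rw [hL, ← ENNReal.coe_rpow_of_nonneg _ hq0.le] at hz
    exact_mod_cast hz
  have hA : ((4 ^ (-q) / 4 * l : ℝ≥0) : ℝ≥0∞) < primitiveDiv (compl Φ) q (4 * s) := by
    by_contra! hcon
    have h1 := slopeInt_le hΦ hpos hq T s
    rw [hL, ENNReal.ofReal_coe_nnreal, ← ENNReal.coe_rpow_of_ne_zero hs0.ne', ← ENNReal.coe_mul,
      hsq'] at h1
    have h4 : ENNReal.ofReal (4 ^ q) = ((4 ^ q : ℝ≥0) : ℝ≥0∞) := by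
      rw [← ENNReal.ofReal_coe_nnreal]; simp
    have h2 : (l : ℝ≥0∞) ≤ ((4 ^ q * (4 ^ (-q) / 4 * l) + l / 2 : ℝ≥0) : ℝ≥0∞) := by
      refine h1.trans ?_
      rw [h4]
      push_cast
      push_cast at hcon
      gcongr
    have h3 : l ≤ 4 ^ q * (4 ^ (-q) / 4 * l) + l / 2 := by exact_mod_cast h2
    have h5 : (4 : ℝ≥0) ^ q * (4 ^ (-q) / 4 * l) = l / 4 := by
      rw [NNReal.rpow_neg]
      have : (4 : ℝ≥0) ^ q ≠ 0 := by positivity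
      field_simp
    rw [h5] at h3
    have h6 : (l : ℝ) ≤ l / 4 + l / 2 := by exact_mod_cast h3
    have h7 : (0 : ℝ) < l := hl0
    linarith
  have hw : (c₁ * z) ^ q ≤ 4 ^ (-q) / 4 * l := by
    rw [NNReal.mul_rpow, hc₁q]
    gcongr
  have hG : genInv (primitiveDiv (compl Φ) q) (((c₁ * z : ℝ≥0) : ℝ≥0∞) ^ q) ≤ (4 * s : ℝ≥0) := by
    refine genInv_le (lt_of_le_of_lt ?_ hA)
    rw [← ENNReal.coe_rpow_of_nonneg _ hq0.le]
    exact_mod_cast hw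
  have hfinal : Ψ (c₁ * z / c₀) ≤ K * Φ T := by
    calc Ψ (c₁ * z / c₀) ≤ cianchiTransform (compl Φ) q (c₁ * z) := by
          have := hdom (c₁ * z / c₀)
          rwa [mul_div_cancel₀ _ hc₀.ne'] at this
      _ ≤ _ := cianchiTransform_le _ hq _
      _ ≤ (((c₁ * z : ℝ≥0) : ℝ≥0∞) * (4 * s : ℝ≥0)) ^ q := by gcongr
      _ = (((c₁ * z) ^ q * (4 ^ q * s ^ q) : ℝ≥0) : ℝ≥0∞) := by
          rw [← ENNReal.coe_mul, ← ENNReal.coe_rpow_of_nonneg _ hq0.le, NNReal.mul_rpow,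
            NNReal.mul_rpow (x := 4)]
      _ ≤ ((K * (f * T) : ℝ≥0) : ℝ≥0∞) := by
          refine ENNReal.coe_le_coe.2 ?_
          calc (c₁ * z) ^ q * (4 ^ q * s ^ q) ≤ (4 ^ (-q) / 4 * l) * (4 ^ q * s ^ q) := by gcongr
            _ = l * s ^ (q - 1) * s / 4 := by
                rw [NNReal.rpow_neg, mul_assoc l, ← NNReal.rpow_add_one hs0.ne', sub_add_cancel]
                have : (4 : ℝ≥0) ^ q ≠ 0 := by positivity
                field_simp
            _ = T * s / 2 := by
                rw [hsq]; field_simp; norm_num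
            _ ≤ T * s := div_le_self zero_le one_le_two
            _ ≤ T * (K * f) := by
                gcongr
                exact hsf.trans (by gcongr; exact le_max_right _ _)
            _ = _ := by ring
      _ = K * Φ T := by rw [hΦT, ENNReal.coe_mul]
  have := hΨ.apply_mul_le_of_le (K := K) (le_max_left 1 β) hfinal
  convert this using 2
  field_simp

theorem primitiveDiv_mono {A B : ℝ≥0 → ℝ≥0∞} (h : ∀ s, A s ≤ B s) (q : ℝ) (s : ℝ≥0) :
    primitiveDiv A q s ≤ primitiveDiv B q s :=
  lintegral_mono fun _ => ENNReal.div_le_div_right (h _) _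

theorem cianchiTransform_anti {A B : ℝ≥0 → ℝ≥0∞} (h : ∀ s, A s ≤ B s) {q : ℝ} (hq : 0 ≤ q)
    (s : ℝ≥0) : cianchiTransform B q s ≤ cianchiTransform A q s :=
  lintegral_mono fun _ => mul_le_mul_right
    (ENNReal.rpow_le_rpow (genInv_anti (primitiveDiv_mono h q) _) hq) _

/-- The dual of `exists_slopeDominated`. -/
theorem exists_slopeDominated_compl {Φ Ψ : ℝ≥0 → ℝ≥0∞}
    {q : ℝ} (hq : 1 < q) (hfin : primitiveDiv Ψ q 1 < ∞)
    (hdom : Dominates Φ (compl (cianchiTransform Ψ q))) :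
    ∃ c : ℝ≥0, 0 < c ∧ SlopeDominated q c (compl Ψ) (compl Φ) := by
  refine exists_slopeDominated (starShaped_compl _) (starShaped_compl _) hq
    ((primitiveDiv_mono (compl_compl_le Ψ) q 1).trans_lt hfin) ?_
  obtain ⟨c, hc, h⟩ := hdom
  refine ⟨c, hc, fun s => ?_⟩
  -- The transform reverses order, so replacing Ψ by its smaller second complement only enlarges it.
  -- What remains is the complement of the domination hypothesis, tested at r/c.
  refine le_trans ?_ ((compl_compl_le _ _).trans
    (cianchiTransform_anti (compl_compl_le Ψ) (by linarith) _))
  refine iSup_le fun r => ?_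
  refine le_trans ?_ (le_iSup _ (r / c))
  have h1 := h (r / c)
  rw [mul_div_cancel₀ _ hc.ne'] at h1
  refine tsub_le_tsub ?_ h1
  refine ENNReal.coe_le_coe.2 (le_of_eq ?_)
  field_simp

section Measure

/-! ### Distribution functions -/

variable {X : Type*} [MeasurableSpace X] {μ : Measure X}

/-- The distribution function `t ↦ μ {F > t}`. -/
def distrib (μ : Measure X) (F : X → ℝ≥0) (t : ℝ) : ℝ≥0∞ := μ {x | t < F x}

theorem distrib_anti (μ : Measure X) (F : X → ℝ≥0) : Antitone (distrib μ F) :=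
  fun _ _ h => measure_mono fun _ hx => lt_of_le_of_lt h hx

theorem measurable_distrib (μ : Measure X) (F : X → ℝ≥0) : Measurable (distrib μ F) :=
  (distrib_anti μ F).measurable

/-- `∫_{μ{F > t} ≥ v} μ{F > t}^θ dt`. -/
def upperPart (μ : Measure X) (θ : ℝ) (F : X → ℝ≥0) (v : ℝ≥0∞) : ℝ≥0∞ :=
  ∫⁻ t in {t | 0 < t ∧ v ≤ distrib μ F t}, distrib μ F t ^ θ

/-- `∫_{μ{F > t} < v} μ{F > t} dt`. -/
def lowerPart (μ : Measure X) (F : X → ℝ≥0) (v : ℝ≥0∞) : ℝ≥0∞ :=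
  ∫⁻ t in {t | 0 < t ∧ distrib μ F t < v}, distrib μ F t

theorem upperPart_anti (μ : Measure X) (θ : ℝ) (F : X → ℝ≥0) : Antitone (upperPart μ θ F) :=
  fun _ _ h => lintegral_mono_set fun _ ht => ⟨ht.1, h.trans ht.2⟩

/-- Layer cake formula with weights in both variables. -/
theorem lintegral_layer [SFinite μ] {F : X → ℝ≥0} (hF : Measurable F) {W : X → ℝ≥0∞}
    (hW : Measurable W) {H : ℝ → ℝ≥0∞} (hH : Measurable H) :
    ∫⁻ t in Ioi (0 : ℝ), (∫⁻ x in {x | t < F x}, W x ∂μ) * H t =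
      ∫⁻ x, W x * (∫⁻ t in Ioo (0 : ℝ) (F x), H t) ∂μ := by
  have hm : MeasurableSet {p : ℝ × X | p.1 < F p.2} :=
    measurableSet_lt measurable_fst (by fun_prop)
  have hm2 : Measurable (Function.uncurry fun (t : ℝ) (x : X) =>
      {p : ℝ × X | p.1 < F p.2}.indicator (fun p => W p.2 * H p.1) (t, x)) := by
    refine Measurable.indicator ?_ hm
    fun_prop
  have h1 : ∀ t : ℝ, (∫⁻ x in {x | t < F x}, W x ∂μ) * H t =
      ∫⁻ x, {p : ℝ × X | p.1 < F p.2}.indicator (fun p => W p.2 * H p.1) (t, x) ∂μ := by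
    intro t
    have hmt : MeasurableSet {x | t < F x} := measurableSet_lt measurable_const (by fun_prop)
    rw [← lintegral_mul_const _ hW, ← lintegral_indicator hmt]
    rfl
  simp_rw [h1]
  rw [lintegral_lintegral_swap hm2.aemeasurable]
  refine lintegral_congr fun x => ?_
  rw [← lintegral_const_mul _ hH, ← lintegral_indicator measurableSet_Ioi,
    ← lintegral_indicator measurableSet_Ioo]
  refine lintegral_congr fun t => ?_
  by_cases h0 : 0 < t <;> by_cases h1 : t < F x <;> simp [indicator, h0, h1]

theorem lintegral_distrib_mul [SFinite μ] {F : X → ℝ≥0} (hF : Measurable F)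
    {H : ℝ → ℝ≥0∞} (hH : Measurable H) :
    ∫⁻ t in Ioi (0 : ℝ), distrib μ F t * H t = ∫⁻ x, (∫⁻ t in Ioo (0 : ℝ) (F x), H t) ∂μ := by
  simpa [distrib] using lintegral_layer (μ := μ) hF (W := fun _ => 1) measurable_const hH

theorem volume_setOf_ofReal_lt (x : ℝ≥0∞) :
    volume {t : ℝ | 0 < t ∧ ENNReal.ofReal t < x} = x := by
  rcases eq_or_ne x ∞ with rfl | hx
  · have : {t : ℝ | 0 < t ∧ ENNReal.ofReal t < ∞} = Ioi 0 := by ext; simp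
    rw [this, Real.volume_Ioi]
  · have : {t : ℝ | 0 < t ∧ ENNReal.ofReal t < x} = Ioo 0 x.toReal := by
      ext t
      simp only [mem_ofPred_eq, mem_Ioo, and_congr_right_iff]
      intro ht
      rw [ENNReal.ofReal_lt_iff_lt_toReal ht.le hx]
    rw [this, Real.volume_Ioo, sub_zero, ENNReal.ofReal_toReal hx]

theorem lintegral_eq_lintegral_measure_lt [SFinite μ] {f : X → ℝ≥0∞} (hf : Measurable f) :
    ∫⁻ x, f x ∂μ = ∫⁻ t in Ioi (0 : ℝ), μ {x | ENNReal.ofReal t < f x} := by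
  have hm : MeasurableSet {p : ℝ × X | ENNReal.ofReal p.1 < f p.2} :=
    measurableSet_lt (by fun_prop) (by fun_prop)
  have hm2 : Measurable (Function.uncurry fun (t : ℝ) (x : X) =>
      {p : ℝ × X | ENNReal.ofReal p.1 < f p.2}.indicator (fun _ => (1 : ℝ≥0∞)) (t, x)) :=
    measurable_const.indicator hm
  have h1 : ∀ t : ℝ, μ {x | ENNReal.ofReal t < f x} =
      ∫⁻ x, {p : ℝ × X | ENNReal.ofReal p.1 < f p.2}.indicator (fun _ => (1 : ℝ≥0∞)) (t, x) ∂μ := by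
    intro t
    have hmt : MeasurableSet {x | ENNReal.ofReal t < f x} :=
      measurableSet_lt measurable_const hf
    rw [← lintegral_indicator_one hmt]
    rfl
  simp_rw [h1]
  rw [lintegral_lintegral_swap hm2.aemeasurable]
  refine lintegral_congr fun x => ?_
  have hmx : MeasurableSet {t : ℝ | ENNReal.ofReal t < f x} :=
    measurableSet_lt (by fun_prop) measurable_const
  calc f x = volume {t : ℝ | 0 < t ∧ ENNReal.ofReal t < f x} := (volume_setOf_ofReal_lt _).symm
    _ = ∫⁻ t in Ioi (0 : ℝ), {t : ℝ | ENNReal.ofReal t < f x}.indicator 1 t := by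
        rw [lintegral_indicator_one hmx, Measure.restrict_apply hmx]
        congr 1; ext; simp [and_comm]
    _ = _ := rfl

theorem lintegral_le_of_measure_lt_le [SFinite μ] {f g : X → ℝ≥0∞} (hf : Measurable f)
    (hg : Measurable g)
    (h : ∀ t : ℝ, 0 < t → μ {x | ENNReal.ofReal t < f x} ≤ μ {x | ENNReal.ofReal t < g x}) :
    ∫⁻ x, f x ∂μ ≤ ∫⁻ x, g x ∂μ := by
  rw [lintegral_eq_lintegral_measure_lt hf, lintegral_eq_lintegral_measure_lt hg]
  exact setLIntegral_mono' measurableSet_Ioi h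

/-- A set closed under passing to smaller positive numbers either has a largest element or is a
directed countable union of intervals with rational right ends, and monotone convergence applies. -/
theorem setLIntegral_le_of_forall_Ioc {S : Set ℝ} (hS0 : S ⊆ Ioi 0)
    (hS : ∀ t ∈ S, Ioc 0 t ⊆ S) {H : ℝ → ℝ≥0∞} {b : ℝ≥0∞}
    (hb : ∀ t ∈ S, ∫⁻ u in Ioc 0 t, H u ≤ b) : ∫⁻ u in S, H u ≤ b := by
  by_cases hmax : ∃ t ∈ S, ∀ u ∈ S, u ≤ t
  · obtain ⟨t, ht, h⟩ := hmax
    have hSt : S ⊆ Ioc 0 t := fun u hu => ⟨hS0 hu, h u hu⟩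
    exact (lintegral_mono_set hSt).trans (hb t ht)
  · push Not at hmax
    have hU : S ⊆ ⋃ r : {r : ℚ // (r : ℝ) ∈ S}, Ioc (0 : ℝ) (r : ℚ) := by
      intro t ht
      obtain ⟨u, hu, htu⟩ := hmax t ht
      obtain ⟨r, hr1, hr2⟩ := exists_rat_btwn htu
      have h0 : 0 < t := hS0 ht
      exact mem_iUnion.2 ⟨⟨r, hS u hu ⟨h0.trans hr1, hr2.le⟩⟩, h0, hr1.le⟩
    refine (lintegral_mono_set hU).trans ?_
    rw [setLIntegral_iUnion_of_directed]
    · exact iSup_le fun r => hb _ r.2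
    · intro r r'
      rcases le_total r r' with h | h
      · exact ⟨r', Ioc_subset_Ioc_right (by exact_mod_cast h), Subset.rfl⟩
      · exact ⟨r, Subset.rfl, Ioc_subset_Ioc_right (by exact_mod_cast h)⟩

theorem upperPart_le {θ : ℝ} {F : X → ℝ≥0} {v b : ℝ≥0∞}
    (h : ∀ T : ℝ≥0, 0 < T → v ≤ distrib μ F T → ∫⁻ t in Ioc (0 : ℝ) T, distrib μ F t ^ θ ≤ b) :
    upperPart μ θ F v ≤ b := by
  refine setLIntegral_le_of_forall_Ioc (S := {t | 0 < t ∧ v ≤ distrib μ F t})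
    (fun t ht => ht.1) (fun t ht u hu => ⟨hu.1, ht.2.trans (distrib_anti μ F hu.2)⟩) ?_
  · intro t ht
    exact h ⟨t, ht.1.le⟩ ht.1 ht.2

/-! ### Consequences of a unit modular bound -/

/-- By layer cake the left side integrates the slope over (0, F(x)); the slope is largest at F(x),
and there it returns Φ(F(x)). The slope thus serves as a substitute for the derivative of Φ. -/
theorem lintegral_distrib_mul_slope_le [SFinite μ] {F : X → ℝ≥0} (hF : Measurable F)
    {Φ : ℝ≥0 → ℝ≥0∞} (h : StarShaped Φ) :
    ∫⁻ t in Ioi (0 : ℝ), distrib μ F t * slope Φ t ≤ ∫⁻ x, Φ (F x) ∂μ := by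
  rw [lintegral_distrib_mul hF h.measurable_slope]
  refine lintegral_mono fun x => ?_
  calc ∫⁻ t in Ioo (0 : ℝ) (F x), slope Φ t ≤ ∫⁻ _ in Ioo (0 : ℝ) (F x), slope Φ (F x) :=
        setLIntegral_mono' measurableSet_Ioo fun t ht => h.slope_mono ht.1 ht.2.le
    _ = slope Φ (F x) * ENNReal.ofReal (F x) := by simp
    _ ≤ Φ (F x) := by
        rcases eq_or_ne (F x) 0 with h0 | h0
        · simp [h0]
        · rw [slope_mul_self Φ (by positivity), Real.toNNReal_coe]

/-- Hölder's inequality for the distribution function of a function with modular at most `1`. -/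
theorem rpow_lintegral_distrib_le [SFinite μ] {F : X → ℝ≥0} (hF : Measurable F)
    {Φ : ℝ≥0 → ℝ≥0∞} (h : StarShaped Φ) (hpos : ∀ T : ℝ≥0, 0 < T → Φ T ≠ 0)
    (hF1 : ∫⁻ x, Φ (F x) ∂μ ≤ 1) {p q : ℝ} (hpq : p.HolderConjugate q)
    {T : ℝ≥0} (hT : Φ T ≠ ∞) :
    (∫⁻ t in Ioc (0 : ℝ) T, distrib μ F t ^ (1 / p)) ^ q ≤ slopeInt Φ q T := by
  have hp0 := hpq.pos
  have hq0 := hpq.symm.pos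
  have hm1 : Measurable fun t => (distrib μ F t * slope Φ t) ^ (1 / p) :=
    ((measurable_distrib μ F).mul h.measurable_slope).pow_const _
  have hm2 : Measurable fun t => slope Φ t ^ (-(1 / p)) := h.measurable_slope.pow_const _
  have h1 : ∫⁻ t in Ioc (0 : ℝ) T, distrib μ F t ^ (1 / p) ≤ slopeInt Φ q T ^ (1 / q) := by
    -- Insert the slope to the powers 1/p and -1/p. The first factor has p-th power integral at most
    -- the modular, and the second gives the slope integral because -q/p = 1 - q.
    calc ∫⁻ t in Ioc (0 : ℝ) T, distrib μ F t ^ (1 / p)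
        = ∫⁻ t in Ioc (0 : ℝ) T, ((fun t => (distrib μ F t * slope Φ t) ^ (1 / p)) *
            fun t => slope Φ t ^ (-(1 / p))) t := by
          refine setLIntegral_congr_fun measurableSet_Ioc fun t ht => ?_
          have ht0 : 0 < t.toNNReal := Real.toNNReal_pos.2 ht.1
          have hs0 : slope Φ t ≠ 0 := by
            simp only [slope, ne_eq, ENNReal.div_eq_zero_iff, not_or]
            exact ⟨hpos _ ht0, by simp⟩
          have hst : slope Φ t ≠ ∞ := by
            refine ENNReal.div_ne_top ?_ (by simpa using ht.1)
            refine ne_top_of_le_ne_top hT (h.monotone ?_)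
            exact Real.toNNReal_le_iff_le_coe.2 ht.2
          simp only [Pi.mul_apply]
          rw [ENNReal.mul_rpow_of_nonneg _ _ (by positivity), mul_assoc,
            ← ENNReal.rpow_add _ _ hs0 hst]
          simp
      _ ≤ (∫⁻ t in Ioc (0 : ℝ) T, ((distrib μ F t * slope Φ t) ^ (1 / p)) ^ p) ^ (1 / p) *
          (∫⁻ t in Ioc (0 : ℝ) T, (slope Φ t ^ (-(1 / p))) ^ q) ^ (1 / q) :=
          ENNReal.lintegral_mul_le_Lp_mul_Lq _ hpq hm1.aemeasurable hm2.aemeasurable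
      _ ≤ 1 * slopeInt Φ q T ^ (1 / q) := by
          gcongr
          · refine ENNReal.rpow_le_one ?_ (by positivity)
            simp_rw [← ENNReal.rpow_mul, one_div_mul_cancel hp0.ne', ENNReal.rpow_one]
            exact (lintegral_mono_set Ioc_subset_Ioi_self).trans
              ((lintegral_distrib_mul_slope_le hF h).trans hF1)
          · refine le_of_eq ?_
            simp_rw [← ENNReal.rpow_mul]
            have : -(1 / p) * q = 1 - q := by
              have h3 : (1 / p) = 1 - q⁻¹ := by rw [one_div]; linarith [hpq.inv_add_inv_eq_one]
              rw [h3]; field_simp; ring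
            rw [this, slopeInt]
      _ = _ := one_mul _
  calc _ ≤ (slopeInt Φ q T ^ (1 / q)) ^ q := by gcongr
    _ = _ := by rw [← ENNReal.rpow_mul, one_div_mul_cancel hq0.ne', ENNReal.rpow_one]

theorem le_of_forall_coe_gt {x y : ℝ≥0∞} (h : ∀ a : ℝ≥0, y < a → x ≤ a) : x ≤ y := by
  refine le_of_forall_gt_imp_ge_of_dense fun b hb => ?_
  obtain ⟨a, ha, hab⟩ := ENNReal.lt_iff_exists_nnreal_btwn.1 hb
  exact (h a ha).trans hab.le

theorem SlopeDominated.apply_le [SFinite μ] {p q : ℝ} (hpq : p.HolderConjugate q) {c : ℝ≥0}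
    {Φ Ψ : ℝ≥0 → ℝ≥0∞} (hd : SlopeDominated q c Φ Ψ) (hΦ : StarShaped Φ)
    {F : X → ℝ≥0} (hF : Measurable F) (hF1 : ∫⁻ x, Φ (F x) ∂μ ≤ 1) {T z : ℝ≥0} (hT : 0 < T)
    (hz : (z : ℝ≥0∞) ≤ ∫⁻ t in Ioc (0 : ℝ) T, distrib μ F t ^ (1 / p)) : Ψ (c * z) ≤ Φ T := by
  rcases eq_or_ne (Φ T) ∞ with h | h
  · simp [h]
  · refine hd.le T z hT ?_
    exact (ENNReal.rpow_le_rpow hz hpq.symm.nonneg).trans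
      (rpow_lintegral_distrib_le hF hΦ hd.ne_zero hF1 hpq h)

/-- The supremum of `Φ(T)` over `T` with `μ{G > s} ≤ μ{F > T}` for some `s < r`. -/
def comparisonSup (μ : Measure X) (Φ : ℝ≥0 → ℝ≥0∞) (F G : X → ℝ≥0) (r : ℝ≥0) : ℝ≥0∞ :=
  ⨆ (s : ℝ) (T : ℝ≥0) (_ : 0 < s ∧ s < r ∧ distrib μ G s ≤ distrib μ F T), Φ T

theorem comparisonSup_mono (μ : Measure X) (Φ : ℝ≥0 → ℝ≥0∞) (F G : X → ℝ≥0) :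
    Monotone (comparisonSup μ Φ F G) := fun _ r' h =>
  iSup_mono fun _ => iSup_mono fun _ => iSup_mono' fun hs =>
    ⟨⟨hs.1, hs.2.1.trans_le (by exact_mod_cast h), hs.2.2⟩, le_rfl⟩

/-- Superlevel sets are compared. The one at height τ on the left is covered by nested sets {G > r},
each of measure at most that of some {F > T} with Φ(T) > τ, and such a set lies in {Φ(F) > τ}. No
rearrangement is needed. -/
theorem lintegral_comparisonSup_le [SFinite μ] {Φ : ℝ≥0 → ℝ≥0∞} (hΦ : StarShaped Φ)
    {F G : X → ℝ≥0} (hF : Measurable F) (hG : Measurable G) :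
    ∫⁻ y, comparisonSup μ Φ F G (G y) ∂μ ≤ ∫⁻ x, Φ (F x) ∂μ := by
  refine lintegral_le_of_measure_lt_le ((comparisonSup_mono μ Φ F G).measurable.comp hG)
    (hΦ.measurable.comp hF) fun τ _ => ?_
  set S : Set ℝ := {s | 0 < s ∧ ∃ T : ℝ≥0, distrib μ G s ≤ distrib μ F T ∧ ENNReal.ofReal τ < Φ T}
    with hS
  have hU : {y | ENNReal.ofReal τ < comparisonSup μ Φ F G (G y)} ⊆
      ⋃ r : {r : ℚ // (r : ℝ) ∈ S}, {y | ((r : ℚ) : ℝ) < G y} := by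
    intro y hy
    obtain ⟨s, hs⟩ := lt_iSup_iff.1 (show ENNReal.ofReal τ < comparisonSup μ Φ F G (G y) from hy)
    obtain ⟨T, hT⟩ := lt_iSup_iff.1 hs
    obtain ⟨⟨hs0, hsG, hd⟩, hlt⟩ := lt_iSup_iff.1 hT
    obtain ⟨r, hr1, hr2⟩ := exists_rat_btwn hsG
    exact mem_iUnion.2 ⟨⟨r, hs0.trans hr1, T, (distrib_anti μ G hr1.le).trans hd, hlt⟩, hr2⟩
  refine (measure_mono hU).trans ?_
  rw [Directed.measure_iUnion]
  · refine iSup_le fun r => ?_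
    obtain ⟨_, T, hd, hlt⟩ := r.2
    refine hd.trans (measure_mono fun x hx => hlt.trans_le (hΦ.monotone ?_))
    exact_mod_cast (show (T : ℝ) < F x from hx).le
  · intro r r'
    rcases le_total r r' with h | h
    · exact ⟨r, Subset.rfl, fun y hy => lt_of_le_of_lt (b := ((r' : ℚ) : ℝ)) (by exact_mod_cast h) hy⟩
    · exact ⟨r', fun y hy => lt_of_le_of_lt (b := ((r : ℚ) : ℝ)) (by exact_mod_cast h) hy, Subset.rfl⟩

/-- One half of the bilinear estimate: the part of the product of the two distribution functions
where that of `F` is the larger one. -/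
theorem mul_lintegral_distrib_mul_upperPart_le [SFinite μ] {p q : ℝ} (hpq : p.HolderConjugate q)
    {c : ℝ≥0} (hc : 0 < c) {Φ Ψ : ℝ≥0 → ℝ≥0∞} (hd : SlopeDominated q c Φ Ψ) (hΦ : StarShaped Φ)
    {F G : X → ℝ≥0} (hF : Measurable F) (hG : Measurable G) (hF1 : ∫⁻ x, Φ (F x) ∂μ ≤ 1) :
    c * ∫⁻ s in Ioi (0 : ℝ), distrib μ G s * upperPart μ (1 / p) F (distrib μ G s) ≤
      ∫⁻ y, compl Ψ (G y) ∂μ + ∫⁻ x, Φ (F x) ∂μ := by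
  have hmono : Monotone fun s => upperPart μ (1 / p) F (distrib μ G s) :=
    (upperPart_anti μ _ F).comp (distrib_anti μ G)
  rw [lintegral_distrib_mul hG hmono.measurable, ← lintegral_const_mul' _ _ (by simp)]
  calc ∫⁻ y, c * (∫⁻ s in Ioo (0 : ℝ) (G y), upperPart μ (1 / p) F (distrib μ G s)) ∂μ
      ≤ ∫⁻ y, (compl Ψ (G y) + comparisonSup μ Φ F G (G y)) ∂μ := by
        refine lintegral_mono fun y => ?_
        rcases eq_or_ne (G y) 0 with h0 | h0
        · simp [h0]
        set B := compl Ψ (G y) + comparisonSup μ Φ F G (G y) with hB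
        have hk0 : ((G y * c : ℝ≥0) : ℝ≥0∞) ≠ 0 := by
          have : G y * c ≠ 0 := by positivity
          exact_mod_cast this
        have key : ∀ s ∈ Ioo (0 : ℝ) (G y), upperPart μ (1 / p) F (distrib μ G s) ≤
            B / ((G y * c : ℝ≥0) : ℝ≥0∞) := by
          intro s hs
          -- Young's inequality for the pair G(y), c z, followed by Ψ(c z) ≤ Φ(T). The pair (s, T)
          -- is admissible in the comparison supremum, so the bound does not depend on T.
          refine upperPart_le fun T hT hadm => ENNReal.le_of_forall_nnreal_lt fun z hz => ?_
          rw [ENNReal.le_div_iff_mul_le (Or.inl hk0) (Or.inl ENNReal.coe_ne_top)]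
          calc (z : ℝ≥0∞) * ((G y * c : ℝ≥0) : ℝ≥0∞) = (G y : ℝ≥0∞) * ((c * z : ℝ≥0) : ℝ≥0∞) := by
                push_cast; ring
            _ ≤ compl Ψ (G y) + Ψ (c * z) := coe_mul_le_compl_add _ _ _
            _ ≤ B := by
                rw [hB]
                gcongr
                refine (hd.apply_le hpq hΦ hF hF1 hT hz.le).trans ?_
                exact le_iSup_of_le s (le_iSup_of_le T (le_iSup_of_le ⟨hs.1, hs.2, hadm⟩ le_rfl))
        calc (c : ℝ≥0∞) * ∫⁻ s in Ioo (0 : ℝ) (G y), upperPart μ (1 / p) F (distrib μ G s)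
            ≤ c * ∫⁻ _ in Ioo (0 : ℝ) (G y), B / ((G y * c : ℝ≥0) : ℝ≥0∞) := by
              exact mul_le_mul_right (setLIntegral_mono' measurableSet_Ioo key) _
          _ = B / ((G y * c : ℝ≥0) : ℝ≥0∞) * ((G y * c : ℝ≥0) : ℝ≥0∞) := by
              simp; ring
          _ = B := ENNReal.div_mul_cancel hk0 ENNReal.coe_ne_top
    _ = ∫⁻ y, compl Ψ (G y) ∂μ + ∫⁻ y, comparisonSup μ Φ F G (G y) ∂μ :=
        lintegral_add_left ((starShaped_compl Ψ).measurable.comp hG) _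
    _ ≤ _ := add_le_add_right (lintegral_comparisonSup_le hΦ hF hG) _

/-- Some level T with measure at least v already makes the truncated integral exceed z; then Ψ(c z)
≤ Φ(T), and Chebyshev's inequality at level T finishes. -/
theorem mul_apply_le_one_of_lt_upperPart [SFinite μ] {p q : ℝ} (hpq : p.HolderConjugate q)
    {c : ℝ≥0} {Φ Ψ : ℝ≥0 → ℝ≥0∞} (hd : SlopeDominated q c Φ Ψ) (hΦ : StarShaped Φ)
    {F : X → ℝ≥0} (hF : Measurable F) (hF1 : ∫⁻ x, Φ (F x) ∂μ ≤ 1) {v : ℝ≥0∞} {z : ℝ≥0}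
    (hz : (z : ℝ≥0∞) < upperPart μ (1 / p) F v) : v * Ψ (c * z) ≤ 1 := by
  obtain ⟨T, hT, hv, hlt⟩ : ∃ T : ℝ≥0, 0 < T ∧ v ≤ distrib μ F T ∧
      (z : ℝ≥0∞) < ∫⁻ t in Ioc (0 : ℝ) T, distrib μ F t ^ (1 / p) := by
    by_contra! hcon
    exact absurd (upperPart_le hcon) (not_le.2 hz)
  calc v * Ψ (c * z) ≤ distrib μ F T * Φ T := by
        gcongr
        exact hd.apply_le hpq hΦ hF hF1 hT hlt.le
    _ ≤ μ {x | Φ T ≤ Φ (F x)} * Φ T := by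
        gcongr
        refine measure_mono fun x hx => hΦ.monotone ?_
        exact_mod_cast (show (T : ℝ) < F x from hx).le
    _ ≤ ∫⁻ x, Φ (F x) ∂μ := by
        rw [mul_comm]
        exact mul_meas_ge_le_lintegral (hΦ.measurable.comp hF) _
    _ ≤ 1 := hF1

/-! ### Bounds through the generalized inverse -/

/-- Cut at a height a just above Φ⁻¹(1/v). Below it the minimum is at most v; above it the slope is
at least 1/(a v), so the tail is bounded by a v times the modular. -/
theorem lintegral_min_distrib_le [SFinite μ] {Φ : ℝ≥0 → ℝ≥0∞} (hΦ : StarShaped Φ)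
    {F : X → ℝ≥0} (hF : Measurable F) (hF1 : ∫⁻ x, Φ (F x) ∂μ ≤ 1) {v : ℝ≥0} (hv : 0 < v) :
    ∫⁻ t in Ioi (0 : ℝ), min (v : ℝ≥0∞) (distrib μ F t) ≤ 2 * v * genInv Φ (v : ℝ≥0∞)⁻¹ := by
  have hv0 : (v : ℝ≥0∞) ≠ 0 := by simpa using hv.ne'
  have h2v : 2 * (v : ℝ≥0∞) ≠ 0 := by simp [hv0]
  have h2v' : 2 * (v : ℝ≥0∞) ≠ ∞ := by finiteness
  rw [mul_comm, ← ENNReal.div_le_iff h2v h2v']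
  refine le_of_forall_coe_gt fun a ha => ?_
  rw [ENNReal.div_le_iff h2v h2v']
  have haΦ := lt_apply_of_genInv_lt hΦ.monotone ha
  have ha0 : 0 < a := by
    rcases eq_or_ne a 0 with rfl | h
    · simp [hΦ.map_zero] at haΦ
    · positivity
  have ha0' : (a : ℝ≥0∞) ≠ 0 := by simpa using ha0.ne'
  have hslope : ∀ t ∈ Ioi (a : ℝ), 1 ≤ a * v * slope Φ t := by
    intro t ht
    have h1 : slope Φ a ≤ slope Φ t := hΦ.slope_mono (by positivity) (le_of_lt ht)
    calc (1 : ℝ≥0∞) = v * (v : ℝ≥0∞)⁻¹ := (ENNReal.mul_inv_cancel hv0 (by simp)).symm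
      _ ≤ v * Φ a := by gcongr
      _ = v * (slope Φ a * a) := by
          have := slope_mul_self Φ (t := (a : ℝ)) (by positivity)
          rw [Real.toNNReal_coe, ENNReal.ofReal_coe_nnreal] at this
          rw [this]
      _ ≤ v * (slope Φ t * a) := by gcongr
      _ = _ := by ring
  calc ∫⁻ t in Ioi (0 : ℝ), min (v : ℝ≥0∞) (distrib μ F t)
      ≤ (∫⁻ t in Ioc (0 : ℝ) a, min (v : ℝ≥0∞) (distrib μ F t)) +
        ∫⁻ t in Ioi (a : ℝ), min (v : ℝ≥0∞) (distrib μ F t) := by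
        rw [← Ioc_union_Ioi_eq_Ioi (show (0 : ℝ) ≤ a from a.2)]
        exact lintegral_union_le _ _ _
    _ ≤ (∫⁻ t in Ioc (0 : ℝ) a, (v : ℝ≥0∞)) +
        ∫⁻ t in Ioi (a : ℝ), (a * v) * (distrib μ F t * slope Φ t) := by
        refine add_le_add (lintegral_mono fun t => min_le_left _ _)
          (setLIntegral_mono' measurableSet_Ioi fun t ht => (min_le_right _ _).trans ?_)
        calc distrib μ F t = distrib μ F t * 1 := (mul_one _).symm
          _ ≤ distrib μ F t * (a * v * slope Φ t) := by gcongr; exact hslope t ht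
          _ = _ := by ring
    _ ≤ v * a + (a * v) * 1 := by
        refine add_le_add (le_of_eq (by simp)) ?_
        rw [lintegral_const_mul' _ _ (by finiteness)]
        gcongr
        refine (lintegral_mono_set (Ioi_subset_Ioi a.2)).trans ?_
        exact (lintegral_distrib_mul_slope_le hF hΦ).trans hF1
    _ = a * (2 * v) := by ring

theorem lowerPart_le [SFinite μ] {Φ : ℝ≥0 → ℝ≥0∞} (hΦ : StarShaped Φ)
    {F : X → ℝ≥0} (hF : Measurable F) (hF1 : ∫⁻ x, Φ (F x) ∂μ ≤ 1) {v : ℝ≥0} (hv : 0 < v) :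
    lowerPart μ F v ≤ 2 * v * genInv Φ (v : ℝ≥0∞)⁻¹ := by
  refine le_trans ?_ (lintegral_min_distrib_le hΦ hF hF1 hv)
  have hm : MeasurableSet {t : ℝ | 0 < t ∧ distrib μ F t < v} :=
    measurableSet_Ioi.inter (measurableSet_lt (measurable_distrib μ F) measurable_const)
  refine (setLIntegral_mono' hm fun t ht => ?_).trans (lintegral_mono_set fun t ht => ht.1)
  exact le_min ht.2.le le_rfl

/-- Hölder's inequality on a set of finite measure. -/
theorem setLIntegral_le_genInv [SFinite μ] {Φ : ℝ≥0 → ℝ≥0∞} (hΦ : StarShaped Φ)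
    {F : X → ℝ≥0} (hF : Measurable F) {B : Set X} (hB : MeasurableSet B)
    (hF1 : ∫⁻ x, Φ (B.indicator F x) ∂μ ≤ 1) {v : ℝ≥0} (hv : 0 < v) (hBv : μ B = v) :
    ∫⁻ x in B, F x ∂μ ≤ 2 * v * genInv Φ (v : ℝ≥0∞)⁻¹ := by
  refine le_trans (le_of_eq ?_) (lintegral_min_distrib_le hΦ (hF.indicator hB) hF1 hv)
  have h1 := lintegral_distrib_mul (μ := μ) (hF.indicator hB) (H := fun _ => 1) measurable_const
  simp only [mul_one, lintegral_const, Measure.restrict_apply_univ, Real.volume_Ioo, sub_zero,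
    one_mul, ENNReal.ofReal_coe_nnreal] at h1
  rw [← lintegral_indicator hB]
  calc _ = ∫⁻ x, ((B.indicator F x : ℝ≥0) : ℝ≥0∞) ∂μ := by
        refine lintegral_congr fun x => ?_
        by_cases hx : x ∈ B <;> simp [hx]
    _ = _ := by
      rw [← h1]
      refine setLIntegral_congr_fun measurableSet_Ioi fun t ht => ?_
      refine (min_eq_right ?_).symm
      rw [← hBv]
      refine measure_mono fun x hx => ?_
      by_contra hxB
      have h2 : t < ((B.indicator F x : ℝ≥0) : ℝ) := hx
      rw [indicator_of_notMem hxB] at h2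
      exact absurd h2 (not_lt.2 (le_of_lt ht))

/-- Here Φ(a) ≤ 1/v, so the slope on (0, a] is at most 1/(v a) and K(a)^q is at least a (v a)^(q-1),
which is the q-th power of v^(1/p) a. Slope domination at T = a applies. -/
theorem SlopeDominated.mul_apply_le_one {p q : ℝ} (hpq : p.HolderConjugate q) {c : ℝ≥0}
    {Φ Ψ : ℝ≥0 → ℝ≥0∞} (hd : SlopeDominated q c Φ Ψ) (hΦ : StarShaped Φ) (hΨ : StarShaped Ψ)
    {v a : ℝ≥0} (ha : (a : ℝ≥0∞) < genInv Φ (v : ℝ≥0∞)⁻¹) :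
    v * Ψ (c * (v ^ (1 / p) * a)) ≤ 1 := by
  rcases eq_or_ne a 0 with rfl | ha0
  · simp [hΨ.map_zero]
  have ha0 : 0 < a := by positivity
  have hΦa := apply_le_of_lt_genInv ha
  have hq1 : 0 < q - 1 := by linarith [hpq.symm.lt]
  have h1 : (((v ^ (1 / p) * a : ℝ≥0) : ℝ≥0∞)) ^ q ≤ slopeInt Φ q a := by
    refine le_trans ?_ (mul_rpow_slope_le_slopeInt hΦ hpq.symm.lt (a : ℝ))
    have h2 : slope Φ a ≤ ((v * a : ℝ≥0) : ℝ≥0∞)⁻¹ := by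
      rw [slope, Real.toNNReal_coe, ENNReal.ofReal_coe_nnreal, ENNReal.coe_mul,
        ENNReal.mul_inv (by simp) (by simp), div_eq_mul_inv]
      gcongr
    calc (((v ^ (1 / p) * a : ℝ≥0) : ℝ≥0∞)) ^ q = ((a * (v * a) ^ (q - 1) : ℝ≥0) : ℝ≥0∞) := by
          rw [← ENNReal.coe_rpow_of_nonneg _ hpq.symm.nonneg]
          congr 1
          have h3 : (1 / p) * q = q - 1 := by
            have h3 : (1 / p) = 1 - q⁻¹ := by rw [one_div]; linarith [hpq.inv_add_inv_eq_one]
            have := hpq.symm.ne_zero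
            rw [h3]; field_simp
          rw [NNReal.mul_rpow, ← NNReal.rpow_mul, h3, NNReal.mul_rpow, mul_left_comm]
          congr 1
          nth_rewrite 2 [← NNReal.rpow_one a]
          rw [← NNReal.rpow_add ha0.ne']
          ring_nf
      _ ≤ ENNReal.ofReal a * slope Φ a ^ (1 - q) := by
          rw [ENNReal.ofReal_coe_nnreal, ENNReal.coe_mul, ← neg_sub q 1, ENNReal.rpow_neg,
            ENNReal.coe_rpow_of_nonneg _ hq1.le]
          gcongr
          rw [← ENNReal.inv_rpow]
          gcongr
          exact ENNReal.le_inv_iff_le_inv.1 h2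
  calc v * Ψ (c * (v ^ (1 / p) * a)) ≤ v * (v : ℝ≥0∞)⁻¹ := by
        gcongr
        exact (hd.le a _ ha0 h1).trans hΦa
    _ ≤ 1 := ENNReal.mul_inv_le_one _

/-- With p = n/α and v = tⁿ this compares t^α Φ⁻¹(t⁻ⁿ) with Ψ⁻¹(t⁻ⁿ), the form needed for the far
part of the potential. -/
theorem SlopeDominated.genInv_le {p q : ℝ} (hpq : p.HolderConjugate q) {c : ℝ≥0}
    {Φ Ψ : ℝ≥0 → ℝ≥0∞} (hd : SlopeDominated q c Φ Ψ) (hΦ : StarShaped Φ) (hΨ : StarShaped Ψ)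
    (hc : 0 < c) {v : ℝ≥0} (hv : 0 < v) :
    (c * v ^ (1 / p) : ℝ≥0) * genInv Φ (v : ℝ≥0∞)⁻¹ ≤ genInv Ψ (v : ℝ≥0∞)⁻¹ := by
  have hk : ((c * v ^ (1 / p) : ℝ≥0) : ℝ≥0∞) ≠ 0 := by
    have : c * v ^ (1 / p) ≠ 0 := by positivity
    exact_mod_cast this
  rw [mul_comm, ← ENNReal.le_div_iff_mul_le (Or.inl hk) (Or.inl ENNReal.coe_ne_top)]
  refine ENNReal.le_of_forall_nnreal_lt fun a ha => ?_
  rw [ENNReal.le_div_iff_mul_le (Or.inl hk) (Or.inl ENNReal.coe_ne_top), ← ENNReal.coe_mul]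
  refine le_genInv hΨ.monotone ?_
  rw [← one_div, ENNReal.le_div_iff_mul_le (by simp [hv.ne']) (by simp), mul_comm]
  convert hd.mul_apply_le_one hpq hΦ hΨ ha using 3
  ring

end Measure

section Potential

/-! ### Exchanging the two distribution functions -/

/-- Both sides integrate the same product over pairs (s, t), up to the diagonal where the two
measures agree. Tonelli thus converts the lower part for F into an upper part for G, making the
bilinear estimate symmetric. -/
theorem lintegral_rpow_mul_lowerPart_le {X : Type*} [MeasurableSpace X] {μ : Measure X}
    {θ : ℝ} (F G : X → ℝ≥0) :
    ∫⁻ s in Ioi (0 : ℝ), distrib μ G s ^ θ * lowerPart μ F (distrib μ G s) ≤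
      ∫⁻ t in Ioi (0 : ℝ), distrib μ F t * upperPart μ θ G (distrib μ F t) := by
  have hdF := measurable_distrib μ F
  have hdG := measurable_distrib μ G
  have hm : MeasurableSet {p : ℝ × ℝ | distrib μ F p.2 < distrib μ G p.1} :=
    measurableSet_lt (by fun_prop) (by fun_prop)
  have hm2 : Measurable (Function.uncurry fun (s t : ℝ) =>
      {p : ℝ × ℝ | distrib μ F p.2 < distrib μ G p.1}.indicator
        (fun p => distrib μ G p.1 ^ θ * distrib μ F p.2) (s, t)) := by
    refine Measurable.indicator ?_ hm
    fun_prop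
  calc ∫⁻ s in Ioi (0 : ℝ), distrib μ G s ^ θ * lowerPart μ F (distrib μ G s)
      = ∫⁻ s in Ioi (0 : ℝ), ∫⁻ t in Ioi (0 : ℝ),
        {p : ℝ × ℝ | distrib μ F p.2 < distrib μ G p.1}.indicator
        (fun p => distrib μ G p.1 ^ θ * distrib μ F p.2) (s, t) := by
        refine lintegral_congr fun s => ?_
        have hms : MeasurableSet {t | distrib μ F t < distrib μ G s} :=
          measurableSet_lt hdF measurable_const
        have hset : {t | 0 < t ∧ distrib μ F t < distrib μ G s} =
            {t | distrib μ F t < distrib μ G s} ∩ Ioi 0 := by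
          ext; simp [and_comm]
        rw [lowerPart, ← lintegral_const_mul _ hdF, hset, ← Measure.restrict_restrict hms,
          ← lintegral_indicator hms]
        rfl
    _ = ∫⁻ t in Ioi (0 : ℝ), ∫⁻ s in Ioi (0 : ℝ),
        {p : ℝ × ℝ | distrib μ F p.2 < distrib μ G p.1}.indicator
        (fun p => distrib μ G p.1 ^ θ * distrib μ F p.2) (s, t) :=
        lintegral_lintegral_swap hm2.aemeasurable
    _ ≤ _ := by
        refine lintegral_mono fun t => ?_
        have hms : MeasurableSet {s | distrib μ F t ≤ distrib μ G s} :=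
          measurableSet_le measurable_const hdG
        have hset : {s | 0 < s ∧ distrib μ F t ≤ distrib μ G s} =
            {s | distrib μ F t ≤ distrib μ G s} ∩ Ioi 0 := by
          ext; simp [and_comm]
        simp only [upperPart]
        rw [← lintegral_const_mul _ (hdG.pow_const θ), hset, ← Measure.restrict_restrict hms,
          ← lintegral_indicator hms]
        refine lintegral_mono fun s => ?_
        by_cases h : distrib μ F t < distrib μ G s
        · simp [indicator, h, h.le, mul_comm]
        · simp [indicator, h]

/-! ### The Riesz potential of a nonnegative function -/

variable {n : ℕ}

/-- The kernel `|x|^(α - n)`. -/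
def rieszKernel (α : ℝ) (x : EuclideanSpace ℝ (Fin n)) : ℝ≥0∞ :=
  ENNReal.ofReal ((‖x‖ ^ ((n : ℝ) - α))⁻¹)

/-- The Riesz potential of a nonnegative function, with values in `[0,∞]`. -/
def potential (α : ℝ) (F : EuclideanSpace ℝ (Fin n) → ℝ≥0) (x : EuclideanSpace ℝ (Fin n)) : ℝ≥0∞ :=
  ∫⁻ y, rieszKernel α (x - y) * F y

theorem measurable_rieszKernel (α : ℝ) : Measurable (rieszKernel (n := n) α) := by
  unfold rieszKernel
  fun_prop

theorem rieszKernel_sub_comm (α : ℝ) (x y : EuclideanSpace ℝ (Fin n)) :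
    rieszKernel α (x - y) = rieszKernel α (y - x) := by
  simp only [rieszKernel, norm_sub_rev]

theorem measurable_potential (α : ℝ) {F : EuclideanSpace ℝ (Fin n) → ℝ≥0} (hF : Measurable F) :
    Measurable (potential α F) := by
  have h := measurable_rieszKernel (n := n) α
  refine Measurable.lintegral_prod_right
    (f := fun x y : EuclideanSpace ℝ (Fin n) => rieszKernel α (x - y) * (F y : ℝ≥0∞)) ?_
  fun_prop

/-- Scaling: the kernel is homogeneous of degree α - n and Lebesgue measure of degree n. -/
theorem lintegral_ball_rieszKernel {α : ℝ} {ρ : ℝ} (hρ : 0 < ρ) :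
    ∫⁻ x in Metric.ball (0 : EuclideanSpace ℝ (Fin n)) ρ, rieszKernel α x =
      ENNReal.ofReal (ρ ^ α) *
        ∫⁻ x in Metric.ball (0 : EuclideanSpace ℝ (Fin n)) 1, rieszKernel α x := by
  have hk := measurable_rieszKernel (n := n) α
  have hg : Measurable ((Metric.ball (0 : EuclideanSpace ℝ (Fin n)) ρ).indicator
    (rieszKernel α)) := hk.indicator measurableSet_ball
  have h1 : ∫⁻ x : EuclideanSpace ℝ (Fin n),
      (Metric.ball (0 : EuclideanSpace ℝ (Fin n)) ρ).indicator (rieszKernel α) (ρ • x) =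
      ENNReal.ofReal ((ρ ^ n)⁻¹) *
        ∫⁻ x in Metric.ball (0 : EuclideanSpace ℝ (Fin n)) ρ, rieszKernel α x := by
    rw [← lintegral_indicator measurableSet_ball]
    rw [← lintegral_map hg (measurable_const_smul ρ), Measure.map_addHaar_smul _ hρ.ne',
      lintegral_smul_measure, finrank_euclideanSpace_fin, abs_of_pos (by positivity), smul_eq_mul]
  have h2 : ∀ x : EuclideanSpace ℝ (Fin n),
      (Metric.ball (0 : EuclideanSpace ℝ (Fin n)) ρ).indicator (rieszKernel α) (ρ • x) =
      ENNReal.ofReal ((ρ ^ ((n : ℝ) - α))⁻¹) *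
        (Metric.ball (0 : EuclideanSpace ℝ (Fin n)) 1).indicator (rieszKernel α) x := by
    intro x
    have hx : ρ • x ∈ Metric.ball (0 : EuclideanSpace ℝ (Fin n)) ρ ↔
        x ∈ Metric.ball (0 : EuclideanSpace ℝ (Fin n)) 1 := by
      simp only [mem_ball_zero_iff, norm_smul, Real.norm_of_nonneg hρ.le]
      exact mul_lt_iff_lt_one_right hρ
    by_cases h : x ∈ Metric.ball (0 : EuclideanSpace ℝ (Fin n)) 1
    · rw [indicator_of_mem h, indicator_of_mem (hx.2 h), rieszKernel, rieszKernel,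
        ← ENNReal.ofReal_mul (by positivity), norm_smul, Real.norm_of_nonneg hρ.le,
        Real.mul_rpow hρ.le (norm_nonneg _), mul_inv]
    · rw [indicator_of_notMem h, indicator_of_notMem (hx.not.2 h), mul_zero]
  simp_rw [h2] at h1
  rw [lintegral_const_mul' _ _ (by simp), lintegral_indicator measurableSet_ball] at h1
  calc _ = ENNReal.ofReal (ρ ^ n) * (ENNReal.ofReal ((ρ ^ n)⁻¹) *
        ∫⁻ x in Metric.ball (0 : EuclideanSpace ℝ (Fin n)) ρ, rieszKernel α x) := by
        rw [← mul_assoc, ← ENNReal.ofReal_mul (by positivity), mul_inv_cancel₀ (by positivity)]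
        simp
    _ = _ := by
        rw [← h1, ← mul_assoc, ← ENNReal.ofReal_mul (by positivity), Real.rpow_sub hρ,
          Real.rpow_natCast]
        congr 2
        field_simp

theorem lintegral_unitBall_rieszKernel_lt_top {α : ℝ} (hα : 0 < α) (hαn : α < n) :
    ∫⁻ x in Metric.ball (0 : EuclideanSpace ℝ (Fin n)) 1, rieszKernel α x < ∞ := by
  have hn : 1 ≤ n := by
    have : (0 : ℝ) < n := hα.trans hαn
    exact_mod_cast this
  have h := integrableOn_ball_of_norm_le_rpow (μ := (volume : Measure (EuclideanSpace ℝ (Fin n))))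
    (f := fun x => (‖x‖ ^ ((n : ℝ) - α))⁻¹) (C := 1) (α := n - α) (r := 1)
    (by simpa using hn) (by simp [hα]) ?_
    (Measurable.aestronglyMeasurable (by fun_prop))
  · have h2 := h.2
    rw [hasFiniteIntegral_iff_ofReal] at h2
    · exact h2
    · exact Eventually.of_forall fun x => by positivity
  · refine Eventually.of_forall fun x => ?_
    rw [Real.norm_of_nonneg (by positivity), Real.rpow_neg (norm_nonneg _), one_mul]

theorem rieszKernel_le_of_le {α : ℝ} (hαn : α < n) {ρ : ℝ} (hρ : 0 < ρ)
    {x : EuclideanSpace ℝ (Fin n)} (hx : ρ ≤ ‖x‖) :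
    rieszKernel α x ≤ ENNReal.ofReal ((ρ ^ ((n : ℝ) - α))⁻¹) := by
  refine ENNReal.ofReal_le_ofReal (inv_anti₀ (by positivity) ?_)
  exact Real.rpow_le_rpow hρ.le hx (by linarith)

/-- `∫_S |x - y|^(α - n) dx ≤ C |S|^(α/n)`. -/
theorem exists_setLIntegral_rieszKernel_le {α : ℝ} (hα : 0 < α) (hαn : α < n) :
    ∃ C : ℝ≥0, 0 < C ∧ ∀ (S : Set (EuclideanSpace ℝ (Fin n))) (y : EuclideanSpace ℝ (Fin n)),
      ∫⁻ x in S, rieszKernel α (x - y) ≤ C * volume S ^ (α / n) := by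
  have hn : (0 : ℝ) < n := hα.trans hαn
  set C₁ := ∫⁻ x in Metric.ball (0 : EuclideanSpace ℝ (Fin n)) 1, rieszKernel α x with hC₁
  have hC₁top : C₁ ≠ ∞ := (lintegral_unitBall_rieszKernel_lt_top hα hαn).ne
  refine ⟨C₁.toNNReal + 1, by positivity, fun S y => ?_⟩
  have hC : ((C₁.toNNReal + 1 : ℝ≥0) : ℝ≥0∞) = C₁ + 1 := by
    rw [ENNReal.coe_add, ENNReal.coe_toNNReal hC₁top, ENNReal.coe_one]
  rw [hC]
  rcases eq_or_ne (volume S) 0 with h0 | h0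
  · rw [Measure.restrict_eq_zero.2 h0]; simp
  rcases eq_or_ne (volume S) ∞ with ht | ht
  · rw [ht, ENNReal.top_rpow_of_pos (by positivity), ENNReal.mul_top (by simp)]
    exact le_top
  set v := (volume S).toReal with hv
  have hv0 : 0 < v := ENNReal.toReal_pos h0 ht
  have hSv : volume S = ENNReal.ofReal v := (ENNReal.ofReal_toReal ht).symm
  -- At this radius the integral inside the ball and the bound ρ^(α-n)|S| outside it are both of
  -- order |S|^(α/n).
  set ρ := v ^ (1 / (n : ℝ)) with hρ
  have hρ0 : 0 < ρ := by positivity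
  have hρα : ρ ^ α = v ^ (α / n) := by
    rw [hρ, ← Real.rpow_mul hv0.le]; congr 1; field_simp
  have hρn : (ρ ^ ((n : ℝ) - α))⁻¹ * v = v ^ (α / n) := by
    rw [Real.rpow_sub hρ0, hρα, hρ, ← Real.rpow_mul hv0.le, one_div_mul_cancel hn.ne',
      Real.rpow_one]
    field_simp
  have hball : ∫⁻ x in Metric.ball y ρ, rieszKernel α (x - y) = ENNReal.ofReal (ρ ^ α) * C₁ := by
    rw [hC₁, ← lintegral_ball_rieszKernel hρ0, ← lintegral_indicator measurableSet_ball,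
      ← lintegral_indicator measurableSet_ball,
      ← lintegral_sub_right_eq_self
        ((Metric.ball (0 : EuclideanSpace ℝ (Fin n)) ρ).indicator (rieszKernel α)) y]
    refine lintegral_congr fun x => ?_
    by_cases h : x ∈ Metric.ball y ρ
    · have h' : x - y ∈ Metric.ball (0 : EuclideanSpace ℝ (Fin n)) ρ := by
        simpa [dist_eq_norm] using h
      rw [indicator_of_mem h, indicator_of_mem h']
    · have h' : x - y ∉ Metric.ball (0 : EuclideanSpace ℝ (Fin n)) ρ := by
        simpa [dist_eq_norm] using h
      rw [indicator_of_notMem h, indicator_of_notMem h']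
  calc ∫⁻ x in S, rieszKernel α (x - y)
      ≤ ∫⁻ x in S, ((Metric.ball y ρ).indicator (fun x => rieszKernel α (x - y)) x +
        ENNReal.ofReal ((ρ ^ ((n : ℝ) - α))⁻¹)) := by
        refine lintegral_mono fun x => ?_
        by_cases h : x ∈ Metric.ball y ρ
        · rw [indicator_of_mem h]; exact le_add_right le_rfl
        · refine le_add_left (rieszKernel_le_of_le hαn hρ0 ?_)
          simpa [dist_eq_norm] using h
    _ = (∫⁻ x in S, (Metric.ball y ρ).indicator (fun x => rieszKernel α (x - y)) x) +
        ENNReal.ofReal ((ρ ^ ((n : ℝ) - α))⁻¹) * volume S := by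
        rw [lintegral_add_right _ measurable_const]; simp
    _ ≤ (∫⁻ x, (Metric.ball y ρ).indicator (fun x => rieszKernel α (x - y)) x) +
        ENNReal.ofReal ((ρ ^ ((n : ℝ) - α))⁻¹) * volume S := by
        gcongr
        exact Measure.restrict_le_self
    _ = ENNReal.ofReal (v ^ (α / n)) * C₁ + ENNReal.ofReal (v ^ (α / n)) := by
        rw [lintegral_indicator measurableSet_ball, hball, hρα, hSv,
          ← ENNReal.ofReal_mul (by positivity), hρn]
    _ = _ := by
        rw [hSv, ENNReal.ofReal_rpow_of_pos hv0]; ring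

theorem setLIntegral_potential_eq (α : ℝ) {F : EuclideanSpace ℝ (Fin n) → ℝ≥0} (hF : Measurable F)
    (S : Set (EuclideanSpace ℝ (Fin n))) :
    ∫⁻ x in S, potential α F x = ∫⁻ y, (∫⁻ x in S, rieszKernel α (x - y)) * F y := by
  have h := measurable_rieszKernel (n := n) α
  simp only [potential]
  rw [lintegral_lintegral_swap]
  · refine lintegral_congr fun y => ?_
    rw [lintegral_mul_const _ (by fun_prop)]
  · exact Measurable.aemeasurable (by fun_prop)

/-- The integral of a potential over a set, estimated by the distribution function. -/
theorem setLIntegral_potential_le {α : ℝ} {C : ℝ≥0}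
    (hC : ∀ (S : Set (EuclideanSpace ℝ (Fin n))) (y : EuclideanSpace ℝ (Fin n)),
      ∫⁻ x in S, rieszKernel α (x - y) ≤ C * volume S ^ (α / n))
    {F : EuclideanSpace ℝ (Fin n) → ℝ≥0} (hF : Measurable F)
    (S : Set (EuclideanSpace ℝ (Fin n))) :
    ∫⁻ x in S, potential α F x ≤ C * (volume S * upperPart volume (α / n) F (volume S) +
      volume S ^ (α / n) * lowerPart volume F (volume S)) := by
  have hk := measurable_rieszKernel (n := n) α
  have hd := measurable_distrib volume F
  set W : EuclideanSpace ℝ (Fin n) → ℝ≥0∞ := fun y => ∫⁻ x in S, rieszKernel α (x - y) with hW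
  have hWm : Measurable W := by
    refine Measurable.lintegral_prod_left
      (f := fun x y : EuclideanSpace ℝ (Fin n) => rieszKernel α (x - y)) ?_
    fun_prop
  have h1 : ∫⁻ x in S, potential α F x =
      ∫⁻ t in Ioi (0 : ℝ), ∫⁻ y in {y | t < F y}, W y := by
    have := lintegral_layer (μ := volume) hF hWm (H := fun _ => 1) measurable_const
    simp only [mul_one, lintegral_const, Measure.restrict_apply_univ, Real.volume_Ioo, sub_zero,
      one_mul, ENNReal.ofReal_coe_nnreal] at this
    rw [this, setLIntegral_potential_eq α hF]
  have hb1 : ∀ t : ℝ, ∫⁻ y in {y | t < F y}, W y ≤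
      C * (volume S ^ (α / n) * distrib volume F t) := by
    intro t
    calc _ ≤ ∫⁻ _ in {y | t < F y}, C * volume S ^ (α / n) := lintegral_mono fun y => hC S y
      _ = _ := by rw [lintegral_const, Measure.restrict_apply_univ, mul_assoc, distrib]
  -- The kernel is symmetric, so its bound can also be applied to the set {F > t} instead of S. Each
  -- level uses whichever version puts the power α/n on the larger measure.
  have hb2 : ∀ t : ℝ, ∫⁻ y in {y | t < F y}, W y ≤
      C * (volume S * distrib volume F t ^ (α / n)) := by
    intro t
    rw [hW, lintegral_lintegral_swap (Measurable.aemeasurable (by fun_prop))]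
    calc ∫⁻ x in S, ∫⁻ y in {y | t < F y}, rieszKernel α (x - y)
        ≤ ∫⁻ _ in S, C * distrib volume F t ^ (α / n) := by
          refine lintegral_mono fun x => ?_
          simp_rw [rieszKernel_sub_comm α x]
          exact hC _ x
      _ = _ := by rw [lintegral_const, Measure.restrict_apply_univ]; ring
  have hset : Ioi (0 : ℝ) = {t | 0 < t ∧ volume S ≤ distrib volume F t} ∪
      {t | 0 < t ∧ distrib volume F t < volume S} := by
    ext t
    simp only [mem_Ioi, mem_union, mem_ofPred_eq]
    rcases le_or_gt (volume S) (distrib volume F t) with h | h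
    · simp [h]
    · simp [h]
  rw [h1, hset]
  refine (lintegral_union_le _ _ _).trans ?_
  rw [mul_add]
  refine add_le_add ?_ ?_
  · refine (lintegral_mono hb2).trans (le_of_eq ?_)
    rw [lintegral_const_mul _ (by fun_prop), lintegral_const_mul _ (by fun_prop), upperPart]
  · refine (lintegral_mono hb1).trans (le_of_eq ?_)
    rw [lintegral_const_mul _ (by fun_prop), lintegral_const_mul _ (by fun_prop), lowerPart]

/-! ### Weak and strong type estimates for the Riesz potential in Orlicz spaces -/

/-- Weak type estimate for the Riesz potential, in modular form. -/
theorem exists_weak_potential {α : ℝ} (hα : 0 < α) (hαn : α < n) {q : ℝ}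
    (hpq : ((n : ℝ) / α).HolderConjugate q) {c : ℝ≥0} (hc : 0 < c) {Φ Ψ : ℝ≥0 → ℝ≥0∞}
    (hΦ : StarShaped Φ) (hΨ : StarShaped Ψ) (hd : SlopeDominated q c Φ Ψ) :
    ∃ K : ℝ≥0, 1 ≤ K ∧ ∀ F : EuclideanSpace ℝ (Fin n) → ℝ≥0, Measurable F →
      ∫⁻ x, Φ (F x) ≤ 1 → ∀ t : ℝ≥0,
        Ψ t * volume {x | ((K * t : ℝ≥0) : ℝ≥0∞) < potential α F x} ≤ 1 := by
  obtain ⟨C, hC0, hC⟩ := exists_setLIntegral_rieszKernel_le hα hαn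
  have hθ : 1 / ((n : ℝ) / α) = α / n := one_div_div _ _
  -- The constant 4C/c exceeds the 3C/c that the upper and lower parts can produce together; the
  -- added 1 only ensures K ≥ 1.
  refine ⟨4 * C / c + 1, le_add_left le_rfl, fun F hF hF1 t => ?_⟩
  rcases eq_or_ne t 0 with rfl | ht
  · simp [hΨ.map_zero]
  refine le_trans (mul_le_mul_right (measure_mono fun x hx => lt_of_le_of_lt
    (b := (((4 * C / c + 1) * t : ℝ≥0) : ℝ≥0∞)) ?_ hx) _)
    (?_ : Ψ t * volume {x | ((4 * C / c * t : ℝ≥0) : ℝ≥0∞) < potential α F x} ≤ 1)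
  · exact ENNReal.coe_le_coe.2 (by gcongr; exact le_add_right le_rfl)
  have hm : MeasurableSet {x | ((4 * C / c * t : ℝ≥0) : ℝ≥0∞) < potential α F x} :=
    measurableSet_lt measurable_const (measurable_potential α hF)
  set S := {x | ((4 * C / c * t : ℝ≥0) : ℝ≥0∞) < potential α F x} with hS
  -- Intersecting with balls makes the measure finite, so that it can serve as v and be cancelled.
  have key : ∀ N : ℕ, Ψ t * volume (S ∩ Metric.ball 0 N) ≤ 1 := by
    intro N
    have hfin : volume (S ∩ Metric.ball 0 N) ≠ ∞ :=
      (measure_mono inter_subset_right).trans_lt measure_ball_lt_top |>.ne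
    rcases eq_or_ne (volume (S ∩ Metric.ball 0 N)) 0 with h0 | h0
    · simp [h0]
    obtain ⟨v, hv⟩ : ∃ v : ℝ≥0, (v : ℝ≥0∞) = volume (S ∩ Metric.ball 0 N) :=
      ⟨_, ENNReal.coe_toNNReal hfin⟩
    rw [← hv] at h0 ⊢
    have hv0 : 0 < v := by
      rw [pos_iff_ne_zero]; rintro rfl; simp at h0
    rw [mul_comm]
    set z : ℝ≥0 := t / c with hz
    have hcz : c * z = t := mul_div_cancel₀ _ hc.ne'
    have hz0 : 0 < z := by positivity
    by_cases h1 : (z : ℝ≥0∞) < upperPart volume (α / n) F v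
    · rw [← hcz]
      rw [← hθ] at h1
      exact mul_apply_le_one_of_lt_upperPart hpq hd hΦ hF hF1 h1
    by_cases h2 : ((z / v ^ (α / n) : ℝ≥0) : ℝ≥0∞) < genInv Φ (v : ℝ≥0∞)⁻¹
    · have := hd.mul_apply_le_one hpq hΦ hΨ h2
      rw [hθ, mul_div_cancel₀ _ (by positivity), hcz] at this
      exact this
    -- If neither alternative holds, the upper part contributes at most C z v and the lower part at
    -- most 2C z v, while the average over the level set is at least 4C z.
    exfalso
    rw [not_lt] at h1 h2
    have h3 : ((4 * C / c * t : ℝ≥0) : ℝ≥0∞) * v ≤ ∫⁻ x in S ∩ Metric.ball 0 N, potential α F x := by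
      rw [hv, ← setLIntegral_const]
      exact setLIntegral_mono' (hm.inter measurableSet_ball) fun x hx => le_of_lt hx.1
    have h4 := setLIntegral_potential_le hC hF (S ∩ Metric.ball 0 N)
    rw [← hv] at h4
    have h5 : (C : ℝ≥0∞) * (v * upperPart volume (α / n) F v +
        (v : ℝ≥0∞) ^ (α / n) * lowerPart volume F v) ≤ ((3 * C * z * v : ℝ≥0) : ℝ≥0∞) := by
      calc _ ≤ (C : ℝ≥0∞) * (v * z + (v : ℝ≥0∞) ^ (α / n) *
            (2 * v * ((z / v ^ (α / n) : ℝ≥0) : ℝ≥0∞))) := by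
            gcongr
            exact (lowerPart_le hΦ hF hF1 hv0).trans (by gcongr)
        _ = ((C * (v * z + v ^ (α / n) * (2 * v * (z / v ^ (α / n)))) : ℝ≥0) : ℝ≥0∞) := by
            rw [← ENNReal.coe_rpow_of_ne_zero hv0.ne']
            push_cast
            rfl
        _ = _ := by
            congr 1
            have : v ^ (α / n) ≠ 0 := by positivity
            field_simp
            norm_num
    have h6 := h3.trans (h4.trans h5)
    rw [← ENNReal.coe_mul, ENNReal.coe_le_coe] at h6
    have h7 : 4 * C / c * t * v = 4 * C * z * v := by rw [hz]; field_simp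
    rw [h7] at h6
    have h8 : (0 : ℝ) < C * z * v := by positivity
    have h9 : (4 * C * z * v : ℝ) ≤ 3 * C * z * v := by exact_mod_cast h6
    linarith
  have hU : S = ⋃ N : ℕ, S ∩ Metric.ball 0 N := by
    rw [← inter_iUnion, Metric.iUnion_ball_nat, inter_univ]
  rw [hU, Directed.measure_iUnion, ENNReal.mul_iSup]
  · exact iSup_le key
  · refine Monotone.directed_le fun N M h => ?_
    exact inter_subset_inter_right _ (Metric.ball_subset_ball (by exact_mod_cast h))

/-- The infinity set lies in every level set, so its measure times Ψ(t) stays bounded while Ψ(t)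
tends to infinity. -/
theorem ae_lt_top_of_forall_mul_measure_le {X : Type*} [MeasurableSpace X] {μ : Measure X}
    {Ψ : ℝ≥0 → ℝ≥0∞} (hΨ : Tendsto Ψ atTop (𝓝 ∞)) {K : ℝ≥0} {u : X → ℝ≥0∞}
    (h : ∀ t : ℝ≥0, Ψ t * μ {x | ((K * t : ℝ≥0) : ℝ≥0∞) < u x} ≤ 1) : ∀ᵐ x ∂μ, u x < ∞ := by
  rw [ae_iff]
  by_contra h0
  have h1 : ∀ t : ℝ≥0, Ψ t ≤ 1 / μ {x | ¬ u x < ∞} := by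
    intro t
    rw [ENNReal.le_div_iff_mul_le (Or.inl h0) (by simp)]
    refine le_trans (mul_le_mul_right (measure_mono fun x hx => ?_) _) (h t)
    have hx' : u x = ∞ := by simpa using hx
    simp only [mem_ofPred_eq, hx']
    exact ENNReal.coe_lt_top
  have h2 : ∞ ≤ 1 / μ {x | ¬ u x < ∞} := le_of_tendsto' hΨ h1
  rw [top_le_iff, ENNReal.div_eq_top] at h2
  rcases h2 with h2 | h2
  · exact h0 h2.2
  · exact absurd h2.1 (by simp)

/-! ### Strong type estimate by duality -/

/-- The bilinear form of the strong type estimate. -/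
theorem exists_bilinear_potential {α : ℝ} (hα : 0 < α) (hαn : α < n) {q : ℝ}
    (hpq : ((n : ℝ) / α).HolderConjugate q) {c c' : ℝ≥0} (hc : 0 < c) (hc' : 0 < c')
    {Φ Ψ : ℝ≥0 → ℝ≥0∞} (hΦ : StarShaped Φ)
    (hd : SlopeDominated q c Φ Ψ) (hd' : SlopeDominated q c' (compl Ψ) (compl Φ)) :
    ∃ D : ℝ≥0, ∀ F G : EuclideanSpace ℝ (Fin n) → ℝ≥0, Measurable F → Measurable G →
      ∫⁻ x, Φ (F x) ≤ 1 → ∫⁻ x, compl Ψ (G x) ≤ 1 →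
        ∫⁻ x, potential α F x * G x ≤ D := by
  obtain ⟨C, hC0, hC⟩ := exists_setLIntegral_rieszKernel_le hα hαn
  have hθ : 1 / ((n : ℝ) / α) = α / n := one_div_div _ _
  refine ⟨C * (2 / c + 2 / c'), fun F G hF hG hF1 hG1 => ?_⟩
  have hlayer : ∫⁻ x, potential α F x * G x =
      ∫⁻ s in Ioi (0 : ℝ), ∫⁻ x in {x | s < G x}, potential α F x := by
    have := lintegral_layer (μ := volume) hG (measurable_potential α hF) (H := fun _ => 1)
      measurable_const
    simp only [mul_one, lintegral_const, Measure.restrict_apply_univ, Real.volume_Ioo, sub_zero,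
      one_mul, ENNReal.ofReal_coe_nnreal] at this
    exact this.symm
  have hU := mul_lintegral_distrib_mul_upperPart_le hpq hc hd hΦ hF hG hF1
  have hL := mul_lintegral_distrib_mul_upperPart_le hpq hc' hd' (starShaped_compl Ψ) hG hF hG1
  rw [hθ] at hU hL
  have hdiv : ∀ {k : ℝ≥0} {x y : ℝ≥0∞}, 0 < k → (k : ℝ≥0∞) * x ≤ y → y ≤ 2 →
      x ≤ ((2 / k : ℝ≥0) : ℝ≥0∞) := by
    intro k x y hk h1 h2
    rw [ENNReal.coe_div hk.ne', ENNReal.le_div_iff_mul_le (by simp [hk.ne']) (by simp), mul_comm]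
    exact h1.trans h2
  have hU' := hdiv hc hU ((add_le_add hG1 hF1).trans one_add_one_eq_two.le)
  have hL' := hdiv hc' hL ((add_le_add
    ((lintegral_mono fun x => compl_compl_le Φ (F x)).trans hF1) hG1).trans one_add_one_eq_two.le)
  have hmono : Monotone fun s => upperPart volume (α / n) F (distrib volume G s) :=
    (upperPart_anti volume _ F).comp (distrib_anti volume G)
  calc ∫⁻ x, potential α F x * G x
      ≤ ∫⁻ s in Ioi (0 : ℝ), C * (distrib volume G s *
          upperPart volume (α / n) F (distrib volume G s) +
          distrib volume G s ^ (α / n) * lowerPart volume F (distrib volume G s)) := by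
        rw [hlayer]
        exact lintegral_mono fun s => setLIntegral_potential_le hC hF _
    _ = C * ((∫⁻ s in Ioi (0 : ℝ), distrib volume G s *
          upperPart volume (α / n) F (distrib volume G s)) +
          ∫⁻ s in Ioi (0 : ℝ), distrib volume G s ^ (α / n) *
            lowerPart volume F (distrib volume G s)) := by
        rw [lintegral_const_mul' _ _ (by simp), lintegral_add_left]
        exact (measurable_distrib volume G).mul hmono.measurable
    _ ≤ C * (((2 / c : ℝ≥0) : ℝ≥0∞) + ((2 / c' : ℝ≥0) : ℝ≥0∞)) := by
        refine mul_le_mul_right (add_le_add hU' ?_) _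
        exact (lintegral_rpow_mul_lowerPart_le F G).trans hL'
    _ = _ := by push_cast; rfl

/-- A function bounded as a functional on the unit ball of the complementary Orlicz class has a
bounded modular. -/
theorem lintegral_apply_le_one_of_bilinear {Ψ : ℝ≥0 → ℝ≥0∞} (hΨ : StarShaped Ψ)
    {u : EuclideanSpace ℝ (Fin n) → ℝ≥0} (hu : Measurable u) {D K : ℝ≥0} (hDK : D < K)
    (h : ∀ G : EuclideanSpace ℝ (Fin n) → ℝ≥0, Measurable G → ∫⁻ x, compl Ψ (G x) ≤ 1 →
      ∫⁻ x, (u x : ℝ≥0∞) * G x ≤ D) :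
    ∫⁻ x, Ψ (u x / K) ≤ 1 := by
  have hK : 0 < K := zero_le.trans_lt hDK
  -- The truncation has finite values and slopes. A minimum of convex functions need not be convex,
  -- but it stays star-shaped.
  set ΨN : ℕ → ℝ≥0 → ℝ≥0∞ := fun N s => min (Ψ s) (N * s) with hΨN
  have hstar : ∀ N, StarShaped (ΨN N) := by
    intro N a ha s
    simp only [hΨN]
    rw [mul_min]
    refine min_le_min (hΨ a ha s) (le_of_eq ?_)
    push_cast
    ring
  set w : ℕ → EuclideanSpace ℝ (Fin n) → ℝ≥0 := fun N =>
    (Metric.ball 0 N).indicator fun x => min (u x / K) N with hw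
  have hwm : ∀ N, Measurable (w N) := fun N =>
    Measurable.indicator (by fun_prop) measurableSet_ball
  have hwu : ∀ N x, w N x ≤ u x / K := by
    intro N x
    by_cases hx : x ∈ Metric.ball (0 : EuclideanSpace ℝ (Fin n)) N
    · simp only [hw, indicator_of_mem hx]; exact min_le_left _ _
    · simp only [hw, indicator_of_notMem hx]; exact zero_le
  have key : ∀ N, ∫⁻ x, ΨN N (w N x) ≤ 1 := by
    intro N
    by_contra! hI
    have hIfin : ∫⁻ x, ΨN N (w N x) ≠ ∞ := by
      refine ne_of_lt ?_
      calc ∫⁻ x, ΨN N (w N x) ≤ ∫⁻ x : EuclideanSpace ℝ (Fin n),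
            (Metric.ball 0 (N : ℝ)).indicator (fun _ => (N * N : ℝ≥0∞)) x := by
            refine lintegral_mono fun x => (min_le_right _ _).trans ?_
            by_cases hx : x ∈ Metric.ball (0 : EuclideanSpace ℝ (Fin n)) N
            · simp only [hw, indicator_of_mem hx]
              gcongr
              exact_mod_cast min_le_right (u x / K) N
            · simp [hw, indicator_of_notMem hx]
        _ = N * N * volume (Metric.ball (0 : EuclideanSpace ℝ (Fin n)) N) := by
            rw [lintegral_indicator_const measurableSet_ball]
        _ < ∞ := ENNReal.mul_lt_top (by finiteness) measure_ball_lt_top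
    obtain ⟨I, hIeq⟩ : ∃ I : ℝ≥0, (I : ℝ≥0∞) = ∫⁻ x, ΨN N (w N x) :=
      ⟨_, ENNReal.coe_toNNReal hIfin⟩
    rw [← hIeq] at hI
    have hI1 : 1 < I := by exact_mod_cast hI
    have hI0 : 0 < I := one_pos.trans hI1
    -- The test function is the slope of the truncated Ψ along w, normalized by I. If the modular I
    -- exceeds 1, it is admissible and yields K ≤ D, a contradiction.
    set g : EuclideanSpace ℝ (Fin n) → ℝ≥0 := fun x => (ΨN N (w N x) / w N x).toNNReal with hg
    have hgm : Measurable g :=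
      (((hstar N).measurable.comp (hwm N)).div (by fun_prop)).ennreal_toNNReal
    have hgw : ∀ x, (g x : ℝ≥0∞) * w N x = ΨN N (w N x) := by
      intro x
      rcases eq_or_ne (w N x) 0 with h0 | h0
      · simp [h0, (hstar N).map_zero]
      · have h0' : (w N x : ℝ≥0∞) ≠ 0 := by simpa using h0
        have hfin : ΨN N (w N x) ≠ ∞ :=
          ((min_le_right _ _).trans_lt (by finiteness)).ne
        rw [hg, ENNReal.coe_toNNReal (ENNReal.div_ne_top hfin h0'),
          ENNReal.div_mul_cancel h0' (by simp)]
    have hcompl : ∀ x, compl Ψ (g x / I) ≤ ΨN N (w N x) / I := by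
      intro x
      refine ((starShaped_compl Ψ).apply_div_le hI1.le _).trans ?_
      gcongr
      refine (compl_anti (fun s => min_le_left (Ψ s) (N * s)) _).trans ?_
      refine (hstar N).compl_le (hgw x).le fun h0 => ?_
      simp [hg, h0, (hstar N).map_zero]
    have hI0' : (I : ℝ≥0∞) ≠ 0 := by simpa using hI0.ne'
    have h1 : ∫⁻ x, compl Ψ (g x / I) ≤ 1 := by
      calc _ ≤ ∫⁻ x, ΨN N (w N x) / I := lintegral_mono hcompl
        _ = (∫⁻ x, ΨN N (w N x)) / I := by
            simp_rw [div_eq_mul_inv]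
            rw [lintegral_mul_const' _ _ (by simpa using hI0')]
        _ = 1 := by rw [← hIeq, ENNReal.div_self hI0' (by simp)]
    have h2 := h (fun x => g x / I) (by fun_prop) h1
    have h3 : (K : ℝ≥0∞) ≤ ∫⁻ x, (u x : ℝ≥0∞) * ((g x / I : ℝ≥0) : ℝ≥0∞) := by
      calc (K : ℝ≥0∞) = (K * (I : ℝ≥0∞)⁻¹) * ∫⁻ x, ΨN N (w N x) := by
            rw [← hIeq, mul_assoc, ENNReal.inv_mul_cancel hI0' (by simp), mul_one]
        _ = ∫⁻ x, (K * (I : ℝ≥0∞)⁻¹) * ΨN N (w N x) := by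
            rw [lintegral_const_mul' _ _ (by
              exact ENNReal.mul_ne_top (by simp) (by simpa using hI0'))]
        _ ≤ _ := by
            refine lintegral_mono fun x => ?_
            calc (K * (I : ℝ≥0∞)⁻¹) * ΨN N (w N x)
                = ((K * w N x : ℝ≥0) : ℝ≥0∞) * ((g x / I : ℝ≥0) : ℝ≥0∞) := by
                  rw [← hgw x, ENNReal.coe_div hI0.ne', ENNReal.coe_mul, div_eq_mul_inv]
                  ring
              _ ≤ _ := by
                  gcongr
                  calc K * w N x ≤ K * (u x / K) := by gcongr; exact hwu N x
                    _ = u x := mul_div_cancel₀ _ hK.ne'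
    exact absurd (ENNReal.coe_le_coe.1 (h3.trans h2)) (not_le.2 hDK)
  have hlim : ∀ x, Tendsto (fun N => ΨN N (w N x)) atTop (𝓝 (Ψ (u x / K))) := by
    intro x
    have h1 : ∀ᶠ N : ℕ in atTop, ΨN N (w N x) = min (Ψ (u x / K)) (N * ((u x / K : ℝ≥0) : ℝ≥0∞)) := by
      obtain ⟨N₁, hN₁⟩ := exists_nat_ge (u x / K)
      obtain ⟨N₂, hN₂⟩ := exists_nat_gt ‖x‖
      filter_upwards [eventually_ge_atTop (max N₁ N₂)] with N hN
      have hx : x ∈ Metric.ball (0 : EuclideanSpace ℝ (Fin n)) N := by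
        rw [mem_ball_zero_iff]
        exact hN₂.trans_le (by exact_mod_cast (le_max_right _ _).trans hN)
      have h2 : u x / K ≤ N := hN₁.trans (by exact_mod_cast (le_max_left _ _).trans hN)
      simp only [hw, hΨN, indicator_of_mem hx, min_eq_left h2]
    refine Tendsto.congr' (h1.mono fun N hN => hN.symm) ?_
    rcases eq_or_ne (u x / K) 0 with h0 | h0
    · simp [h0, hΨ.map_zero]
    · have h2 : Tendsto (fun N : ℕ => (N : ℝ≥0∞) * ((u x / K : ℝ≥0) : ℝ≥0∞)) atTop (𝓝 ∞) := by
        have := ENNReal.Tendsto.mul_const (b := ((u x / K : ℝ≥0) : ℝ≥0∞))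
          ENNReal.tendsto_nat_nhds_top (Or.inl ENNReal.top_ne_zero)
        rwa [ENNReal.top_mul (by exact_mod_cast h0)] at this
      simpa using (tendsto_const_nhds (x := Ψ (u x / K))).min h2
  calc ∫⁻ x, Ψ (u x / K) = ∫⁻ x, liminf (fun N => ΨN N (w N x)) atTop :=
        lintegral_congr fun x => (hlim x).liminf_eq.symm
    _ ≤ liminf (fun N => ∫⁻ x, ΨN N (w N x)) atTop :=
        lintegral_liminf_le fun N => (hstar N).measurable.comp (hwm N)
    _ ≤ 1 := by
        refine (liminf_le_liminf (Eventually.of_forall key)).trans ?_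
        simp

/-- Strong type estimate for the Riesz potential, in modular form. -/
theorem exists_strong_potential {α : ℝ} (hα : 0 < α) (hαn : α < n) {q : ℝ}
    (hpq : ((n : ℝ) / α).HolderConjugate q) {c c' : ℝ≥0} (hc : 0 < c) (hc' : 0 < c')
    {Φ Ψ : ℝ≥0 → ℝ≥0∞} (hΦ : StarShaped Φ) (hΨ : StarShaped Ψ)
    (hd : SlopeDominated q c Φ Ψ) (hd' : SlopeDominated q c' (compl Ψ) (compl Φ)) :
    ∃ K : ℝ≥0, 1 ≤ K ∧ ∀ F : EuclideanSpace ℝ (Fin n) → ℝ≥0, Measurable F →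
      ∫⁻ x, Φ (F x) ≤ 1 → ∫⁻ x, Ψ ((potential α F x).toNNReal / K) ≤ 1 := by
  obtain ⟨D, hD⟩ := exists_bilinear_potential hα hαn hpq hc hc' hΦ hd hd'
  refine ⟨D + 1, le_add_left le_rfl, fun F hF hF1 => ?_⟩
  refine lintegral_apply_le_one_of_bilinear hΨ (measurable_potential α hF).ennreal_toNNReal
    (lt_add_one D) fun G hG hG1 => le_trans (lintegral_mono fun x => ?_) (hD F G hF hG hF1 hG1)
  exact mul_le_mul_left ENNReal.coe_toNNReal_le_self _

end Potential

section Morrey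

variable {n : ℕ} {𝕜 : Type*} [RCLike 𝕜]

/-! ### Orlicz norms on balls -/

theorem orliczNorm_le {Φ : ℝ≥0 → ℝ≥0∞} {f : EuclideanSpace ℝ (Fin n) → 𝕜} {l : ℝ≥0} (hl : 0 < l)
    (h : ∫⁻ x, Φ (‖f x‖₊ / l) ≤ 1) : orliczNorm Φ f ≤ l :=
  iInf_le_of_le l (iInf_le_of_le hl (iInf_le _ h))

theorem weakOrliczNorm_le {Φ : ℝ≥0 → ℝ≥0∞} {f : EuclideanSpace ℝ (Fin n) → 𝕜} {l : ℝ≥0}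
    (hl : 0 < l)
    (h : ∀ t : ℝ≥0, 0 < t → Φ t * volume {x | t < ‖f x‖₊ / l} ≤ 1) : weakOrliczNorm Φ f ≤ l :=
  iInf_le_of_le l (iInf_le_of_le hl (iInf_le _ (iSup₂_le h)))

theorem exists_lintegral_le_one_of_orliczNorm_lt {Φ : ℝ≥0 → ℝ≥0∞}
    {f : EuclideanSpace ℝ (Fin n) → 𝕜} {b : ℝ≥0∞} (h : orliczNorm Φ f < b) :
    ∃ l : ℝ≥0, 0 < l ∧ (l : ℝ≥0∞) < b ∧ ∫⁻ x, Φ (‖f x‖₊ / l) ≤ 1 := by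
  simp only [orliczNorm, iInf_lt_iff] at h
  obtain ⟨l, hl, h1, h2⟩ := h
  exact ⟨l, hl, h2, h1⟩

theorem lintegral_le_one_of_orliczNorm_lt {Φ : ℝ≥0 → ℝ≥0∞} (hΦ : StarShaped Φ)
    {f : EuclideanSpace ℝ (Fin n) → 𝕜} {l : ℝ≥0} (h : orliczNorm Φ f < l) :
    ∫⁻ x, Φ (‖f x‖₊ / l) ≤ 1 := by
  obtain ⟨l', hl', hlt, h1⟩ := exists_lintegral_le_one_of_orliczNorm_lt h
  refine le_trans (lintegral_mono fun x => hΦ.monotone ?_) h1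
  have : l' ≤ l := by exact_mod_cast hlt.le
  gcongr

theorem orliczNorm_mono {Φ : ℝ≥0 → ℝ≥0∞} (hΦ : StarShaped Φ)
    {f g : EuclideanSpace ℝ (Fin n) → 𝕜} (h : ∀ x, ‖f x‖₊ ≤ ‖g x‖₊) :
    orliczNorm Φ f ≤ orliczNorm Φ g :=
  iInf_mono fun l => iInf_mono fun _ => iInf_mono' fun h1 =>
    ⟨le_trans (lintegral_mono fun x => hΦ.monotone (by have := h x; gcongr)) h1, le_rfl⟩

theorem orliczNorm_congr_ae {Φ : ℝ≥0 → ℝ≥0∞} {f g : EuclideanSpace ℝ (Fin n) → 𝕜}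
    (h : f =ᵐ[volume] g) : orliczNorm Φ f = orliczNorm Φ g := by
  have h1 : ∀ l : ℝ≥0, ∫⁻ x, Φ (‖f x‖₊ / l) = ∫⁻ x, Φ (‖g x‖₊ / l) := fun l =>
    lintegral_congr_ae (h.mono fun x hx => by simp only [hx])
  simp only [orliczNorm, h1]

theorem morreyNorm_congr_ae {Φ : ℝ≥0 → ℝ≥0∞} {φ : EuclideanSpace ℝ (Fin n) → ℝ → ℝ}
    {f g : EuclideanSpace ℝ (Fin n) → 𝕜} (h : f =ᵐ[volume] g) :
    morreyNorm Φ φ f = morreyNorm Φ φ g := by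
  have h1 : ∀ (x : EuclideanSpace ℝ (Fin n)) (r : ℝ),
      orliczNorm Φ ((Metric.ball x r).indicator f) = orliczNorm Φ ((Metric.ball x r).indicator g) :=
    fun x r => orliczNorm_congr_ae (h.mono fun y hy => by simp only [indicator, hy])
  simp only [morreyNorm, h1]

/-- `Φ⁻¹(|B(x,t)|⁻¹)` and `Φ⁻¹(t⁻ⁿ)` are comparable. -/
theorem exists_genInv_ball_comparable (n : ℕ) :
    ∃ K : ℝ≥0, 1 ≤ K ∧ ∀ (x : EuclideanSpace ℝ (Fin n)) (t : ℝ), 0 < t →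
      volume (Metric.ball x t) ≤ K * ENNReal.ofReal (t ^ n) ∧
      ∀ Φ : ℝ≥0 → ℝ≥0∞, StarShaped Φ →
        genInv Φ (volume (Metric.ball x t))⁻¹ ≤ K * genInv Φ (ENNReal.ofReal ((t ^ n)⁻¹)) ∧
        genInv Φ (ENNReal.ofReal ((t ^ n)⁻¹)) ≤ K * genInv Φ (volume (Metric.ball x t))⁻¹ := by
  set κ : ℝ≥0 := (volume (Metric.ball (0 : EuclideanSpace ℝ (Fin n)) 1)).toNNReal with hκ
  have hκeq : volume (Metric.ball (0 : EuclideanSpace ℝ (Fin n)) 1) = κ :=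
    (ENNReal.coe_toNNReal measure_ball_lt_top.ne).symm
  have hκ0 : κ ≠ 0 := by
    intro h
    have h1 := Metric.measure_ball_pos volume (0 : EuclideanSpace ℝ (Fin n)) one_pos
    rw [hκeq, h] at h1
    simp at h1
  have hκ0' : (κ : ℝ≥0∞) ≠ 0 := by simpa using hκ0
  refine ⟨max 1 (max κ κ⁻¹), le_max_left _ _, fun x t ht => ?_⟩
  have hvol : volume (Metric.ball x t) = κ * ENNReal.ofReal (t ^ n) := by
    rw [Measure.addHaar_ball_of_pos _ x ht, hκeq, finrank_euclideanSpace_fin, mul_comm]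
  have hK1 : κ ≤ max 1 (max κ κ⁻¹) := (le_max_left _ _).trans (le_max_right _ _)
  have hK2 : κ⁻¹ ≤ max 1 (max κ κ⁻¹) := (le_max_right _ _).trans (le_max_right _ _)
  have hinv : (volume (Metric.ball x t))⁻¹ = (κ⁻¹ : ℝ≥0) * ENNReal.ofReal ((t ^ n)⁻¹) := by
    rw [hvol, ENNReal.mul_inv (by simp) (by simp), ENNReal.coe_inv hκ0,
      ENNReal.ofReal_inv_of_pos (by positivity)]
  refine ⟨?_, fun Φ hΦ => ⟨?_, ?_⟩⟩
  · rw [hvol]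
    gcongr
  · refine le_trans (genInv_mono Φ ?_) (hΦ.genInv_mul_le (le_max_left _ _) _)
    rw [hinv]
    gcongr
  · refine le_trans (genInv_mono Φ ?_) (hΦ.genInv_mul_le (le_max_left _ _) _)
    have : ENNReal.ofReal ((t ^ n)⁻¹) = κ * (volume (Metric.ball x t))⁻¹ := by
      rw [hinv, ENNReal.coe_inv hκ0, ← mul_assoc, ENNReal.mul_inv_cancel hκ0' (by simp), one_mul]
    rw [this]
    gcongr

/-! ### Far part of the potential and tail integrals -/

/-- Hölder's inequality on a ball. -/
theorem setLIntegral_ball_le {Φ : ℝ≥0 → ℝ≥0∞} (hΦ : IsYoung Φ)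
    {f : EuclideanSpace ℝ (Fin n) → 𝕜} (hf : StronglyMeasurable f) (x : EuclideanSpace ℝ (Fin n))
    {t : ℝ} (ht : 0 < t) :
    ∫⁻ y in Metric.ball x t, ‖f y‖₊ ≤ 2 * volume (Metric.ball x t) *
      genInv Φ (volume (Metric.ball x t))⁻¹ * orliczNorm Φ ((Metric.ball x t).indicator f) := by
  set B := Metric.ball x t with hB
  have hBm : MeasurableSet B := measurableSet_ball
  obtain ⟨v, hv⟩ : ∃ v : ℝ≥0, (v : ℝ≥0∞) = volume B :=
    ⟨_, ENNReal.coe_toNNReal measure_ball_lt_top.ne⟩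
  have hv0 : 0 < v := by
    have h1 := Metric.measure_ball_pos volume x ht
    rw [← hB, ← hv] at h1
    simpa using h1
  rw [← hv]
  have hv0' : (v : ℝ≥0∞) ≠ 0 := by simpa using hv0.ne'
  have hg0 : genInv Φ (v : ℝ≥0∞)⁻¹ ≠ 0 := hΦ.genInv_pos (by simp)
  have hgt : genInv Φ (v : ℝ≥0∞)⁻¹ ≠ ∞ := hΦ.genInv_ne_top (by simpa using hv0.ne')
  have h0 : 2 * (v : ℝ≥0∞) * genInv Φ (v : ℝ≥0∞)⁻¹ ≠ 0 := by simp [hv0', hg0]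
  have h0' : 2 * (v : ℝ≥0∞) * genInv Φ (v : ℝ≥0∞)⁻¹ ≠ ∞ := by finiteness
  rw [mul_comm, ← ENNReal.div_le_iff h0 h0']
  refine le_of_forall_coe_gt fun l hl => ?_
  rw [ENNReal.div_le_iff h0 h0']
  have hl0 : 0 < l := by
    have : (0 : ℝ≥0∞) < l := zero_le.trans_lt hl
    exact_mod_cast this
  have hl0' : (l : ℝ≥0∞) ≠ 0 := by simpa using hl0.ne'
  have hmeas : Measurable fun y => ‖f y‖₊ / l := hf.measurable.nnnorm.div_const l
  have h1 : ∫⁻ y, Φ (B.indicator (fun y => ‖f y‖₊ / l) y) ≤ 1 := by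
    refine le_trans (le_of_eq (lintegral_congr fun y => ?_))
      (lintegral_le_one_of_orliczNorm_lt hΦ.starShaped hl)
    by_cases hy : y ∈ B <;> simp [hy]
  have h2 := setLIntegral_le_genInv hΦ.starShaped hmeas hBm h1 hv0 hv.symm
  calc ∫⁻ y in B, (‖f y‖₊ : ℝ≥0∞) = l * ∫⁻ y in B, ((‖f y‖₊ / l : ℝ≥0) : ℝ≥0∞) := by
        rw [← lintegral_const_mul' _ _ (by simp)]
        refine lintegral_congr fun y => ?_
        rw [← ENNReal.coe_mul, mul_div_cancel₀ _ hl0.ne']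
    _ ≤ _ := by gcongr

/-- The part of the potential that comes from outside the double ball. -/
theorem potential_compl_ball_le {α : ℝ} (hαn : α < n)
    {F : EuclideanSpace ℝ (Fin n) → ℝ≥0} (hF : Measurable F) {x₀ x : EuclideanSpace ℝ (Fin n)}
    {r : ℝ} (hr : 0 < r) (hx : x ∈ Metric.ball x₀ r) :
    potential α ((Metric.ball x₀ (2 * r))ᶜ.indicator F) x ≤
      ENNReal.ofReal (4 ^ ((n : ℝ) - α + 1) / 2) *
        ∫⁻ t in Ioi (2 * r), ENNReal.ofReal (t ^ (-((n : ℝ) - α + 1))) *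
          ∫⁻ y in Metric.ball x₀ t, F y := by
  set q : ℝ := (n : ℝ) - α + 1 with hq
  have hq1 : 1 < q := by linarith
  have hm : MeasurableSet {p : EuclideanSpace ℝ (Fin n) × ℝ | dist p.1 x₀ < p.2} :=
    measurableSet_lt (by fun_prop) (by fun_prop)
  have hm2 : Measurable (Function.uncurry fun (y : EuclideanSpace ℝ (Fin n)) (t : ℝ) =>
      {p : EuclideanSpace ℝ (Fin n) × ℝ | dist p.1 x₀ < p.2}.indicator
        (fun p => ENNReal.ofReal (p.2 ^ (-q)) * (F p.1 : ℝ≥0∞)) (y, t)) := by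
    refine Measurable.indicator ?_ hm
    fun_prop
  calc potential α ((Metric.ball x₀ (2 * r))ᶜ.indicator F) x
      ≤ ∫⁻ y, ENNReal.ofReal (4 ^ q / 2) * ∫⁻ t in Ioi (2 * r),
        {p : EuclideanSpace ℝ (Fin n) × ℝ | dist p.1 x₀ < p.2}.indicator
          (fun p => ENNReal.ofReal (p.2 ^ (-q)) * (F p.1 : ℝ≥0∞)) (y, t) := by
        refine lintegral_mono fun y => ?_
        by_cases hy : y ∈ Metric.ball x₀ (2 * r)
        · simp [hy]
        · have hy' : 2 * r ≤ dist y x₀ := by simpa using hy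
          have hxd : dist x x₀ < r := hx
          have hpos : 0 < dist y x₀ / 2 := by linarith
          have h1 : dist y x₀ / 2 ≤ ‖x - y‖ := by
            rw [← dist_eq_norm]
            have := dist_triangle y x x₀
            rw [dist_comm y x] at this
            linarith
          -- Since 1 - q = α - n, the kernel at half the distance d from y to x₀ becomes an integral
          -- over d < t ≤ 2d. Such t satisfy both y ∈ B(x₀, t) and t > 2r.
          have h2 : rieszKernel α (x - y) ≤ ENNReal.ofReal (4 ^ q / 2) *
              ∫⁻ t in Ioc (2 * (dist y x₀ / 2)) (4 * (dist y x₀ / 2)), ENNReal.ofReal (t ^ (-q)) := by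
            refine (rieszKernel_le_of_le hαn hpos h1).trans (le_trans (le_of_eq ?_)
              (rpow_one_sub_le_lintegral hpos hq1))
            rw [ENNReal.ofReal_rpow_of_pos hpos, ← Real.rpow_neg hpos.le]
            congr 2
            rw [hq]; ring
          have hyc : y ∈ (Metric.ball x₀ (2 * r))ᶜ := hy
          rw [indicator_of_mem hyc]
          calc rieszKernel α (x - y) * (F y : ℝ≥0∞)
              ≤ (ENNReal.ofReal (4 ^ q / 2) *
                ∫⁻ t in Ioc (2 * (dist y x₀ / 2)) (4 * (dist y x₀ / 2)),
                  ENNReal.ofReal (t ^ (-q))) * F y := by gcongr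
            _ = ENNReal.ofReal (4 ^ q / 2) *
                ∫⁻ t in Ioc (2 * (dist y x₀ / 2)) (4 * (dist y x₀ / 2)),
                  {p : EuclideanSpace ℝ (Fin n) × ℝ | dist p.1 x₀ < p.2}.indicator
                  (fun p => ENNReal.ofReal (p.2 ^ (-q)) * (F p.1 : ℝ≥0∞)) (y, t) := by
                rw [mul_assoc, ← lintegral_mul_const' _ _ (by simp)]
                congr 1
                refine setLIntegral_congr_fun measurableSet_Ioc fun t ht => ?_
                have : (y, t) ∈ {p : EuclideanSpace ℝ (Fin n) × ℝ | dist p.1 x₀ < p.2} := by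
                  show dist y x₀ < t
                  linarith [ht.1]
                rw [indicator_of_mem this]
            _ ≤ _ := by
                refine mul_le_mul_right (lintegral_mono_set fun t ht => ?_) _
                show 2 * r < t
                linarith [ht.1]
    _ = ENNReal.ofReal (4 ^ q / 2) * ∫⁻ t in Ioi (2 * r), ∫⁻ y,
        {p : EuclideanSpace ℝ (Fin n) × ℝ | dist p.1 x₀ < p.2}.indicator
          (fun p => ENNReal.ofReal (p.2 ^ (-q)) * (F p.1 : ℝ≥0∞)) (y, t) := by
        rw [lintegral_const_mul' _ _ (by simp), lintegral_lintegral_swap hm2.aemeasurable]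
    _ = _ := by
        congr 1
        refine lintegral_congr fun t => ?_
        rw [← lintegral_const_mul' _ _ (by simp), ← lintegral_indicator measurableSet_ball]
        rfl

/-- `∫_r^∞ N(t) Ψ⁻¹(t⁻ⁿ) dt/t`. -/
def tailInt (n : ℕ) (Ψ : ℝ≥0 → ℝ≥0∞) (N : ℝ → ℝ≥0∞) (r : ℝ) : ℝ≥0∞ :=
  ∫⁻ t in Ioi r, N t * genInv Ψ (ENNReal.ofReal ((t ^ n)⁻¹)) / ENNReal.ofReal t

/-- The Orlicz norm of `f` on the ball of radius `t`. -/
def ballNorm (Φ : ℝ≥0 → ℝ≥0∞) (f : EuclideanSpace ℝ (Fin n) → 𝕜) (x : EuclideanSpace ℝ (Fin n))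
    (t : ℝ) : ℝ≥0∞ := orliczNorm Φ ((Metric.ball x t).indicator f)

theorem ballNorm_mono {Φ : ℝ≥0 → ℝ≥0∞} (hΦ : StarShaped Φ) (f : EuclideanSpace ℝ (Fin n) → 𝕜)
    (x : EuclideanSpace ℝ (Fin n)) : Monotone (ballNorm Φ f x) := by
  intro s t hst
  refine orliczNorm_mono hΦ fun y => ?_
  by_cases hy : y ∈ Metric.ball x s
  · rw [indicator_of_mem hy, indicator_of_mem (Metric.ball_subset_ball hst hy)]
  · simp [hy]

/-- Restrict the tail to (2r, 4r]: the ball norm has not decreased, the inverse loses at most 4ⁿ,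
and dt/t contributes at least 1/2. The near part is thereby controlled by the same tail integral as
the far part. -/
theorem genInv_mul_ballNorm_le {Φ Ψ : ℝ≥0 → ℝ≥0∞} (hΦ : StarShaped Φ) (hΨ : StarShaped Ψ)
    (f : EuclideanSpace ℝ (Fin n) → 𝕜) (x : EuclideanSpace ℝ (Fin n)) {r : ℝ} (hr : 0 < r) :
    genInv Ψ (ENNReal.ofReal ((r ^ n)⁻¹)) * ballNorm Φ f x (2 * r) ≤
      2 * 4 ^ n * tailInt n Ψ (ballNorm Φ f x) r := by
  set G := genInv Ψ (ENNReal.ofReal ((r ^ n)⁻¹)) with hG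
  have h1 : ∀ t ∈ Ioc (2 * r) (4 * r), ballNorm Φ f x (2 * r) * (G / 4 ^ n) / ENNReal.ofReal (4 * r)
      ≤ ballNorm Φ f x t * genInv Ψ (ENNReal.ofReal ((t ^ n)⁻¹)) / ENNReal.ofReal t := by
    intro t ht
    have ht0 : 0 < t := by linarith [ht.1]
    gcongr
    · exact ballNorm_mono hΦ f x ht.1.le
    · refine ENNReal.div_le_of_le_mul' ?_
      have h2 := hΨ.genInv_mul_le (K := 4 ^ n) (one_le_pow₀ (by norm_num))
        (ENNReal.ofReal ((t ^ n)⁻¹))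
      push_cast at h2
      refine le_trans (genInv_mono Ψ ?_) h2
      rw [show (4 : ℝ≥0∞) ^ n = ENNReal.ofReal (4 ^ n) by
        rw [ENNReal.ofReal_pow (by norm_num)]; simp, ← ENNReal.ofReal_mul (by positivity)]
      refine ENNReal.ofReal_le_ofReal ?_
      rw [← div_eq_mul_inv, le_div_iff₀ (by positivity), inv_mul_le_iff₀ (by positivity),
        ← mul_pow, mul_comm]
      exact pow_le_pow_left₀ ht0.le ht.2 n
    · exact ht.2
  have h2 : ∫⁻ _ in Ioc (2 * r) (4 * r),
      ballNorm Φ f x (2 * r) * (G / 4 ^ n) / ENNReal.ofReal (4 * r) ≤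
      tailInt n Ψ (ballNorm Φ f x) r := by
    refine (setLIntegral_mono' measurableSet_Ioc h1).trans (lintegral_mono_set fun t ht => ?_)
    exact lt_trans (by linarith) ht.1
  rw [lintegral_const, Measure.restrict_apply_univ, Real.volume_Ioc] at h2
  have h3 : ENNReal.ofReal (4 * r) = 2 * ENNReal.ofReal (4 * r - 2 * r) := by
    rw [show 4 * r = 2 * (2 * r) by ring, ENNReal.ofReal_mul (by norm_num)]
    congr 1
    · simp
    · congr 1; ring
  have h40 : (4 : ℝ≥0∞) ^ n ≠ 0 := by simp
  have h4t : (4 : ℝ≥0∞) ^ n ≠ ∞ := by finiteness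
  set R := ENNReal.ofReal (4 * r - 2 * r) with hR
  have hR0 : R ≠ 0 := by
    rw [hR, ne_eq, ENNReal.ofReal_eq_zero]; linarith
  have hRt : R ≠ ∞ := by simp [hR]
  calc G * ballNorm Φ f x (2 * r)
      = 2 * 4 ^ n * (ballNorm Φ f x (2 * r) * (G / 4 ^ n) / ENNReal.ofReal (4 * r) * R) := by
        rw [h3, div_eq_mul_inv, div_eq_mul_inv, ENNReal.mul_inv (by simp) (by simp)]
        calc G * ballNorm Φ f x (2 * r)
            = G * ballNorm Φ f x (2 * r) * (2 * 2⁻¹) * (4 ^ n * (4 ^ n)⁻¹) * (R * R⁻¹) := by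
              rw [ENNReal.mul_inv_cancel (by simp) (by simp), ENNReal.mul_inv_cancel h40 h4t,
                ENNReal.mul_inv_cancel hR0 hRt]
              simp
          _ = _ := by ring
    _ ≤ _ := by gcongr

/-- Outside the double ball the potential is controlled by the tail integral. -/
theorem exists_potential_compl_ball_le_tailInt {α : ℝ} (hα : 0 < α) (hαn : α < n) {q : ℝ}
    (hpq : ((n : ℝ) / α).HolderConjugate q) {c : ℝ≥0} (hc : 0 < c) {Φ Ψ : ℝ≥0 → ℝ≥0∞}
    (hΦ : IsYoung Φ) (hΨ : StarShaped Ψ) (hd : SlopeDominated q c Φ Ψ) :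
    ∃ A : ℝ≥0, ∀ f : EuclideanSpace ℝ (Fin n) → 𝕜, StronglyMeasurable f →
      ∀ (x₀ : EuclideanSpace ℝ (Fin n)) (r : ℝ), 0 < r → ∀ x ∈ Metric.ball x₀ r,
        potential α ((Metric.ball x₀ (2 * r))ᶜ.indicator fun y => ‖f y‖₊) x ≤
          A * tailInt n Ψ (ballNorm Φ f x₀) r := by
  obtain ⟨K, hK1, hK⟩ := exists_genInv_ball_comparable n
  have hn : (0 : ℝ) < n := hα.trans hαn
  have hc0 : (c : ℝ≥0∞) ≠ 0 := by simpa using hc.ne'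
  refine ⟨(4 ^ ((n : ℝ) - α + 1) / 2 : ℝ).toNNReal * (2 * K * K * c⁻¹), fun f hf x₀ r hr x hx => ?_⟩
  refine (potential_compl_ball_le hαn hf.measurable.nnnorm hr hx).trans ?_
  rw [ENNReal.coe_mul, mul_assoc, tailInt, ← lintegral_const_mul' _ _ ENNReal.coe_ne_top]
  refine mul_le_mul_right ((lintegral_mono_set (Ioi_subset_Ioi (by linarith))).trans
    (setLIntegral_mono' measurableSet_Ioi fun t ht => ?_)) _
  have ht0 : 0 < t := hr.trans ht
  obtain ⟨hvol, hcomp⟩ := hK x₀ t ht0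
  obtain ⟨hcomp, -⟩ := hcomp Φ hΦ.starShaped
  set g := genInv Φ (ENNReal.ofReal ((t ^ n)⁻¹)) with hg
  have hNec : c * (ENNReal.ofReal (t ^ α) * g) ≤ genInv Ψ (ENNReal.ofReal ((t ^ n)⁻¹)) := by
    have h1 := hd.genInv_le hpq hΦ.starShaped hΨ hc (v := (t ^ n).toNNReal)
      (Real.toNNReal_pos.2 (by positivity))
    have h2 : (((t ^ n).toNNReal : ℝ≥0) : ℝ≥0∞)⁻¹ = ENNReal.ofReal ((t ^ n)⁻¹) :=
      (ENNReal.ofReal_inv_of_pos (by positivity)).symm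
    have h3 : (((t ^ n).toNNReal ^ (1 / ((n : ℝ) / α)) : ℝ≥0) : ℝ≥0∞) = ENNReal.ofReal (t ^ α) := by
      rw [ENNReal.ofReal, ← Real.toNNReal_rpow_of_nonneg (by positivity), ← Real.rpow_natCast,
        ← Real.rpow_mul ht0.le, one_div_div, mul_div_cancel₀ _ hn.ne']
    rw [h2, ENNReal.coe_mul, h3, mul_assoc] at h1
    exact h1
  -- The volume from Hölder's inequality leaves t^α · 1/t; the factor t^α turns Φ⁻¹ into Ψ⁻¹ and 1/t
  -- remains as the measure of the tail.
  have hpow : ENNReal.ofReal (t ^ (-((n : ℝ) - α + 1))) * ENNReal.ofReal (t ^ n) =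
      ENNReal.ofReal (t ^ α) * (ENNReal.ofReal t)⁻¹ := by
    rw [← ENNReal.ofReal_mul (by positivity), ← ENNReal.ofReal_inv_of_pos ht0,
      ← ENNReal.ofReal_mul (by positivity), ← Real.rpow_natCast, ← Real.rpow_add ht0,
      ← Real.rpow_neg_one t, ← Real.rpow_add ht0]
    congr 2
    ring
  calc ENNReal.ofReal (t ^ (-((n : ℝ) - α + 1))) * ∫⁻ y in Metric.ball x₀ t, (‖f y‖₊ : ℝ≥0∞)
      ≤ ENNReal.ofReal (t ^ (-((n : ℝ) - α + 1))) * (2 * (K * ENNReal.ofReal (t ^ n)) *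
        (K * g) * ballNorm Φ f x₀ t) := by
        refine mul_le_mul_right ((setLIntegral_ball_le hΦ hf x₀ ht0).trans ?_) _
        rw [ballNorm]
        gcongr
    _ = (2 * K * K) * ((ENNReal.ofReal (t ^ (-((n : ℝ) - α + 1))) * ENNReal.ofReal (t ^ n)) *
        g * ballNorm Φ f x₀ t) := by ring
    _ = (2 * K * K) * (c : ℝ≥0∞)⁻¹ * ((c * (ENNReal.ofReal (t ^ α) * g)) *
        (ENNReal.ofReal t)⁻¹ * ballNorm Φ f x₀ t) := by
        rw [hpow]
        calc _ = (2 * K * K) * ((c : ℝ≥0∞)⁻¹ * c) * (ENNReal.ofReal (t ^ α) * (ENNReal.ofReal t)⁻¹ *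
              g * ballNorm Φ f x₀ t) := by
              rw [ENNReal.inv_mul_cancel hc0 (by simp), mul_one]
          _ = _ := by ring
    _ ≤ (2 * K * K) * (c : ℝ≥0∞)⁻¹ * (genInv Ψ (ENNReal.ofReal ((t ^ n)⁻¹)) *
        (ENNReal.ofReal t)⁻¹ * ballNorm Φ f x₀ t) := by gcongr
    _ = _ := by
        rw [div_eq_mul_inv]
        push_cast [ENNReal.coe_inv hc.ne']
        ring

/-- The tail integral is controlled by the Morrey norm through the Zygmund condition. -/
theorem exists_tailInt_le {φ₁ φ₂ : EuclideanSpace ℝ (Fin n) → ℝ → ℝ} {Φ Ψ : ℝ≥0 → ℝ≥0∞}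
    (hΦ : IsYoung Φ) (hφ₁ : ∀ x, ∀ r > 0, 0 < φ₁ x r) (hZ : ZygmundCond φ₁ φ₂ Φ Ψ) :
    ∃ A : ℝ≥0, ∀ f : EuclideanSpace ℝ (Fin n) → 𝕜, morreyNorm Φ φ₁ f < ∞ →
      ∀ (x : EuclideanSpace ℝ (Fin n)) (r : ℝ), 0 < r →
        tailInt n Ψ (ballNorm Φ f x) r ≤
          A * ENNReal.ofReal (φ₂ x r) * morreyNorm Φ φ₁ f := by
  obtain ⟨K, hK1, hK⟩ := exists_genInv_ball_comparable n
  obtain ⟨C, hZ⟩ := hZ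
  refine ⟨K * C, fun f hfin x r hr => ?_⟩
  set M := morreyNorm Φ φ₁ f with hM
  set e : ℝ → ℝ≥0∞ := fun t =>
    essInf (fun s : ℝ => ENNReal.ofReal (φ₁ x s) / genInv Φ (ENNReal.ofReal ((s ^ n)⁻¹)))
      (volume.restrict (Ioi t)) with he
  have hball : ∀ s, 0 < s → ballNorm Φ f x s ≤
      ENNReal.ofReal (φ₁ x s) / genInv Φ (ENNReal.ofReal ((s ^ n)⁻¹)) * (K * M) := by
    intro s hs
    have h1 : (ENNReal.ofReal (φ₁ x s))⁻¹ * genInv Φ ((volume (Metric.ball x s))⁻¹) *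
        ballNorm Φ f x s ≤ M := by
      rw [hM, morreyNorm]
      exact le_iSup_of_le x (le_iSup_of_le s (le_iSup_of_le hs le_rfl))
    have hφ0 : ENNReal.ofReal (φ₁ x s) ≠ 0 := by simpa using hφ₁ x s hs
    have hg0 : genInv Φ (ENNReal.ofReal ((s ^ n)⁻¹)) ≠ 0 :=
      hΦ.genInv_pos (by rw [ne_eq, ENNReal.ofReal_eq_zero, not_le]; positivity)
    have hgt : genInv Φ (ENNReal.ofReal ((s ^ n)⁻¹)) ≠ ∞ := hΦ.genInv_ne_top (by simp)
    rw [mul_comm, ← mul_div_assoc, ENNReal.le_div_iff_mul_le (Or.inl hg0) (Or.inl hgt)]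
    calc ballNorm Φ f x s * genInv Φ (ENNReal.ofReal ((s ^ n)⁻¹))
        ≤ ballNorm Φ f x s * (K * genInv Φ ((volume (Metric.ball x s))⁻¹)) := by
          gcongr
          exact ((hK x s hs).2 Φ hΦ.starShaped).2
      _ = K * ((ENNReal.ofReal (φ₁ x s))⁻¹ * genInv Φ ((volume (Metric.ball x s))⁻¹) *
          ballNorm Φ f x s) * ENNReal.ofReal (φ₁ x s) := by
          calc _ = K * (((ENNReal.ofReal (φ₁ x s))⁻¹ * ENNReal.ofReal (φ₁ x s)) *
                genInv Φ ((volume (Metric.ball x s))⁻¹) * ballNorm Φ f x s) := by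
                rw [ENNReal.inv_mul_cancel hφ0 (by simp)]; ring
            _ = _ := by ring
      _ ≤ K * M * ENNReal.ofReal (φ₁ x s) := by gcongr
  -- The norm on B(x, t) is at most that on B(x, s) for every s > t, so the Morrey bound at s passes
  -- to the essential infimum over s. The case K M = 0 is separate because of the division.
  have hess : ∀ t ∈ Ioi r, ballNorm Φ f x t ≤ K * M * e t := by
    intro t ht
    have ht0 : 0 < t := hr.trans ht
    rcases eq_or_ne ((K : ℝ≥0∞) * M) 0 with h0 | h0
    · have := hball t ht0
      rw [h0, mul_zero] at this
      exact this.trans zero_le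
    · have hKM : (K : ℝ≥0∞) * M ≠ ∞ := ENNReal.mul_ne_top (by simp) hfin.ne
      rw [mul_comm, ← ENNReal.div_le_iff h0 hKM, he]
      refine le_essInf_of_ae_le _ ?_
      filter_upwards [ae_restrict_mem measurableSet_Ioi] with s hs
      rw [ENNReal.div_le_iff h0 hKM]
      exact (ballNorm_mono hΦ.starShaped f x (le_of_lt hs)).trans (hball s (ht0.trans hs))
  calc tailInt n Ψ (ballNorm Φ f x) r
      ≤ ∫⁻ t in Ioi r, K * M * (e t * genInv Ψ (ENNReal.ofReal ((t ^ n)⁻¹)) / ENNReal.ofReal t) := by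
        refine setLIntegral_mono' measurableSet_Ioi fun t ht => ?_
        rw [← mul_div_assoc, ← mul_assoc]
        gcongr
        exact hess t ht
    _ = K * M * ∫⁻ t in Ioi r, e t * genInv Ψ (ENNReal.ofReal ((t ^ n)⁻¹)) / ENNReal.ofReal t :=
        lintegral_const_mul' _ _ (ENNReal.mul_ne_top (by simp) hfin.ne)
    _ ≤ K * M * (C * ENNReal.ofReal (φ₂ x r)) := by
        gcongr
        exact hZ x r hr
    _ = _ := by push_cast; ring

/-! ### Pointwise domination of the Riesz potential -/

theorem enorm_rieszIntegrand (α : ℝ) (f : EuclideanSpace ℝ (Fin n) → 𝕜)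
    (x y : EuclideanSpace ℝ (Fin n)) :
    ‖rieszIntegrand α f x y‖ₑ = rieszKernel α (x - y) * ‖f y‖₊ := by
  rw [rieszIntegrand, enorm_smul, rieszKernel, Real.enorm_of_nonneg (by positivity)]
  rfl

theorem nnnorm_rieszPotential_le (α : ℝ) (f : EuclideanSpace ℝ (Fin n) → 𝕜)
    (x : EuclideanSpace ℝ (Fin n)) :
    (‖rieszPotential α f x‖₊ : ℝ≥0∞) ≤ potential α (fun y => ‖f y‖₊) x := by
  refine (enorm_integral_le_lintegral_enorm _).trans (le_of_eq ?_)
  exact lintegral_congr fun y => enorm_rieszIntegrand α f x y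

theorem potential_eq_add_compl (α : ℝ) {F : EuclideanSpace ℝ (Fin n) → ℝ≥0} (hF : Measurable F)
    {B : Set (EuclideanSpace ℝ (Fin n))} (hB : MeasurableSet B) (x : EuclideanSpace ℝ (Fin n)) :
    potential α F x = potential α (B.indicator F) x + potential α (Bᶜ.indicator F) x := by
  have h := measurable_rieszKernel (n := n) α
  have hFB := hF.indicator hB
  rw [potential, potential, potential, ← lintegral_add_left (by fun_prop)]
  refine lintegral_congr fun y => ?_
  rw [← mul_add, ← ENNReal.coe_add]
  congr 2
  by_cases hy : y ∈ B <;> simp [hy]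

theorem potential_div (α : ℝ) (F : EuclideanSpace ℝ (Fin n) → ℝ≥0) {l : ℝ≥0} (hl : 0 < l)
    (x : EuclideanSpace ℝ (Fin n)) :
    potential α (fun y => F y / l) x = potential α F x / l := by
  simp only [potential]
  rw [div_eq_mul_inv, ← lintegral_mul_const' _ _ (by simpa using hl.ne')]
  refine lintegral_congr fun y => ?_
  rw [ENNReal.coe_div hl.ne', div_eq_mul_inv, mul_assoc]

theorem stronglyMeasurable_rieszPotential (α : ℝ) {f : EuclideanSpace ℝ (Fin n) → 𝕜}
    (hf : StronglyMeasurable f) : StronglyMeasurable (rieszPotential α f) := by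
  refine StronglyMeasurable.integral_prod_right
    (f := fun x y : EuclideanSpace ℝ (Fin n) => rieszIntegrand α f x y) ?_
  refine StronglyMeasurable.smul (Measurable.stronglyMeasurable ?_) (hf.comp_measurable measurable_snd)
  fun_prop

theorem integrable_rieszIntegrand (α : ℝ) {f : EuclideanSpace ℝ (Fin n) → 𝕜}
    (hf : StronglyMeasurable f) {x : EuclideanSpace ℝ (Fin n)}
    (h : potential α (fun y => ‖f y‖₊) x < ∞) : Integrable (rieszIntegrand α f x) := by
  refine ⟨?_, ?_⟩
  · refine StronglyMeasurable.aestronglyMeasurable ?_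
    refine StronglyMeasurable.smul (Measurable.stronglyMeasurable ?_) hf
    fun_prop
  · rw [HasFiniteIntegral]
    refine lt_of_le_of_lt (le_of_eq ?_) h
    exact lintegral_congr fun y => enorm_rieszIntegrand α f x y

/-! ### Local estimates -/

theorem nnnorm_rieszPotential_div_le (α : ℝ) {f : EuclideanSpace ℝ (Fin n) → 𝕜}
    (hf : StronglyMeasurable f) {B : Set (EuclideanSpace ℝ (Fin n))} (hB : MeasurableSet B)
    {l : ℝ≥0} (hl : 0 < l) (x : EuclideanSpace ℝ (Fin n)) :
    ((‖rieszPotential α f x‖₊ / l : ℝ≥0) : ℝ≥0∞) ≤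
      potential α (fun y => B.indicator (fun y => ‖f y‖₊) y / l) x +
      potential α (Bᶜ.indicator fun y => ‖f y‖₊) x / l := by
  rw [potential_div α _ hl, ← ENNReal.add_div, ENNReal.coe_div hl.ne',
    ← potential_eq_add_compl α hf.measurable.nnnorm hB]
  gcongr
  exact nnnorm_rieszPotential_le α f x

theorem lintegral_indicator_div_le_one {Φ : ℝ≥0 → ℝ≥0∞} (hΦ : StarShaped Φ)
    {f : EuclideanSpace ℝ (Fin n) → 𝕜} {x₀ : EuclideanSpace ℝ (Fin n)} {r : ℝ} {l : ℝ≥0}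
    (h : ballNorm Φ f x₀ r < l) :
    ∫⁻ y, Φ ((Metric.ball x₀ r).indicator (fun y => ‖f y‖₊) y / l) ≤ 1 := by
  refine le_trans (le_of_eq (lintegral_congr fun y => ?_)) (lintegral_le_one_of_orliczNorm_lt hΦ h)
  by_cases hy : y ∈ Metric.ball x₀ r <;> simp [hy]

/-- Reduces a bound with the product g a to scales X with P < X g. The strict inequality makes both
the near norm less than X and the far potential divided by X less than g. -/
theorem mul_le_of_forall_le_coe {g a K P : ℝ≥0∞} (hg0 : g ≠ 0) (hgt : g ≠ ∞) (hK0 : K ≠ 0)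
    (hKt : K ≠ ∞) (h : ∀ X : ℝ≥0, 0 < X → P < X * g → a ≤ K * X) : g * a ≤ K * P := by
  have h1 : a / K ≤ P / g := by
    refine le_of_forall_coe_gt fun X hX => ?_
    have hX0 : 0 < X := by
      have : (0 : ℝ≥0∞) < X := zero_le.trans_lt hX
      exact_mod_cast this
    rw [ENNReal.div_le_iff hK0 hKt, mul_comm]
    exact h X hX0 ((ENNReal.div_lt_iff (Or.inl hg0) (Or.inl hgt)).1 hX)
  rw [ENNReal.div_le_iff hK0 hKt] at h1
  calc g * a ≤ g * (P / g * K) := by gcongr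
    _ = K * (P / g * g) := by ring
    _ = K * P := by rw [ENNReal.div_mul_cancel hg0 hgt]

/-- Local strong type estimate. -/
theorem genInv_mul_orliczNorm_rieszPotential_le {α : ℝ} {Φ Ψ : ℝ≥0 → ℝ≥0∞}
    (hΦ : StarShaped Φ) (hΨ : IsYoung Ψ) {K : ℝ≥0} (hK : 1 ≤ K)
    (hstrong : ∀ F : EuclideanSpace ℝ (Fin n) → ℝ≥0, Measurable F → ∫⁻ x, Φ (F x) ≤ 1 →
      (∀ᵐ x, potential α F x < ∞) ∧ ∫⁻ x, Ψ ((potential α F x).toNNReal / K) ≤ 1)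
    {f : EuclideanSpace ℝ (Fin n) → 𝕜} (hf : StronglyMeasurable f)
    {x₀ : EuclideanSpace ℝ (Fin n)} {r : ℝ} (hr : 0 < r) {P : ℝ≥0∞}
    (hP1 : genInv Ψ (volume (Metric.ball x₀ r))⁻¹ * ballNorm Φ f x₀ (2 * r) ≤ P)
    (hP2 : ∀ x ∈ Metric.ball x₀ r,
      potential α ((Metric.ball x₀ (2 * r))ᶜ.indicator fun y => ‖f y‖₊) x ≤ P) :
    genInv Ψ (volume (Metric.ball x₀ r))⁻¹ *
      orliczNorm Ψ ((Metric.ball x₀ r).indicator (rieszPotential α f)) ≤ (4 * K : ℝ≥0) * P := by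
  have hΨs := hΨ.starShaped
  set B := Metric.ball x₀ r with hB
  set g := genInv Ψ (volume B)⁻¹ with hg
  have hvt : volume B ≠ ∞ := measure_ball_lt_top.ne
  have hv0 : volume B ≠ 0 := (Metric.measure_ball_pos volume x₀ hr).ne'
  have hg0 : g ≠ 0 := hΨ.genInv_pos (by simpa using hvt)
  have hgt : g ≠ ∞ := hΨ.genInv_ne_top (by simpa using hv0)
  have hK0 : 0 < K := one_pos.trans_le hK
  refine mul_le_of_forall_le_coe hg0 hgt (by simpa using hK0.ne') ENNReal.coe_ne_top
    fun X hX0 hPX => ?_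
  rw [← ENNReal.coe_mul]
  refine orliczNorm_le (by positivity) ?_
  have hN : ballNorm Φ f x₀ (2 * r) < X := by
    have h1 := hP1.trans_lt hPX
    rw [mul_comm, ENNReal.mul_lt_mul_iff_left hg0 hgt] at h1
    exact h1
  have hXt : (X : ℝ≥0∞) ≠ 0 := by simpa using hX0.ne'
  set F₁ : EuclideanSpace ℝ (Fin n) → ℝ≥0 :=
    fun y => (Metric.ball x₀ (2 * r)).indicator (fun y => ‖f y‖₊) y / X with hF₁
  have hF₁m : Measurable F₁ :=
    (hf.measurable.nnnorm.indicator measurableSet_ball).div_const X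
  obtain ⟨hfin, hmod⟩ := hstrong F₁ hF₁m (lintegral_indicator_div_le_one hΦ hN)
  have hm1 : Measurable fun x => Ψ ((potential α F₁ x).toNNReal / K) :=
    hΨs.measurable.comp ((measurable_potential α hF₁m).ennreal_toNNReal.div_const K)
  calc ∫⁻ x, Ψ (‖B.indicator (rieszPotential α f) x‖₊ / (4 * K * X))
      ≤ ∫⁻ x, (Ψ ((potential α F₁ x).toNNReal / K) / 2 +
          B.indicator (fun _ => (volume B)⁻¹ / 2) x) := by
        refine lintegral_mono_ae (hfin.mono fun x hx => ?_)
        by_cases hxB : x ∈ B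
        swap
        · simp [hxB, hΨs.map_zero]
        rw [indicator_of_mem hxB, indicator_of_mem hxB]
        set a := (potential α F₁ x).toNNReal with ha
        have haeq : potential α F₁ x = a := (ENNReal.coe_toNNReal hx.ne).symm
        have hbg : potential α ((Metric.ball x₀ (2 * r))ᶜ.indicator fun y => ‖f y‖₊) x / X < g := by
          rw [ENNReal.div_lt_iff (Or.inl hXt) (Or.inl (by simp)), mul_comm g]
          exact (hP2 x hxB).trans_lt hPX
        obtain ⟨b, hb⟩ : ∃ b : ℝ≥0, (b : ℝ≥0∞) =
            potential α ((Metric.ball x₀ (2 * r))ᶜ.indicator fun y => ‖f y‖₊) x / X :=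
          ⟨_, ENNReal.coe_toNNReal (hbg.trans_le le_top).ne⟩
        rw [← hb] at hbg
        have hsplit : ‖rieszPotential α f x‖₊ / X ≤ a + b := by
          have h1 := nnnorm_rieszPotential_div_le α hf (B := Metric.ball x₀ (2 * r))
            measurableSet_ball hX0 x
          rw [← hb, ← hF₁, haeq] at h1
          exact_mod_cast h1
        -- Of the factor 4, one 2 replaces a sum by a maximum and the other halves Ψ. The near and
        -- far parts then each contribute at most 1/2 to the modular.
        have hsplit' : ‖rieszPotential α f x‖₊ / (4 * K * X) ≤ max (a / K) b / 2 := by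
          have h1 : ‖rieszPotential α f x‖₊ / (4 * K * X) =
              (‖rieszPotential α f x‖₊ / X) / K / 4 := by field_simp
          have h2 : b / K ≤ b := div_le_self zero_le hK
          calc ‖rieszPotential α f x‖₊ / (4 * K * X) ≤ (a + b) / K / 4 := by rw [h1]; gcongr
            _ = (a / K + b / K) / 4 := by rw [add_div]
            _ ≤ (max (a / K) b + max (a / K) b) / 4 := by
                gcongr
                · exact le_max_left _ _
                · exact h2.trans (le_max_right _ _)
            _ = max (a / K) b / 2 := by rw [← two_mul]; field_simp; ring
        have hhalf : ∀ s, Ψ (s / 2) ≤ Ψ s / 2 := fun s => by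
          simpa using hΨs.apply_div_le (K := 2) one_le_two s
        refine (hΨs.monotone hsplit').trans ((hhalf _).trans ?_)
        rcases le_total (a / K) b with h | h
        · rw [max_eq_right h]
          refine le_add_left ?_
          gcongr
          exact apply_le_of_lt_genInv hbg
        · rw [max_eq_left h]
          exact le_add_right le_rfl
    _ = (∫⁻ x, Ψ ((potential α F₁ x).toNNReal / K)) / 2 + (volume B)⁻¹ / 2 * volume B := by
        rw [lintegral_add_left (hm1.div_const 2), lintegral_indicator_const measurableSet_ball]
        congr 1
        simp_rw [div_eq_mul_inv]
        rw [lintegral_mul_const' _ _ (by simp)]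
    _ ≤ 1 / 2 + 1 / 2 := by
        refine add_le_add (ENNReal.div_le_div_right hmod 2) (le_of_eq ?_)
        rw [div_eq_mul_inv, mul_right_comm, ENNReal.inv_mul_cancel hv0 hvt, div_eq_mul_inv]
    _ = 1 := ENNReal.add_halves 1

/-- Local weak type estimate. -/
theorem genInv_mul_weakOrliczNorm_rieszPotential_le {α : ℝ} {Φ Ψ : ℝ≥0 → ℝ≥0∞}
    (hΦ : StarShaped Φ) (hΨ : IsYoung Ψ) {K : ℝ≥0} (hK : 1 ≤ K)
    (hweak : ∀ F : EuclideanSpace ℝ (Fin n) → ℝ≥0, Measurable F → ∫⁻ x, Φ (F x) ≤ 1 →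
      ∀ t : ℝ≥0, Ψ t * volume {x | ((K * t : ℝ≥0) : ℝ≥0∞) < potential α F x} ≤ 1)
    {f : EuclideanSpace ℝ (Fin n) → 𝕜} (hf : StronglyMeasurable f)
    {x₀ : EuclideanSpace ℝ (Fin n)} {r : ℝ} (hr : 0 < r) {P : ℝ≥0∞}
    (hP1 : genInv Ψ (volume (Metric.ball x₀ r))⁻¹ * ballNorm Φ f x₀ (2 * r) ≤ P)
    (hP2 : ∀ x ∈ Metric.ball x₀ r,
      potential α ((Metric.ball x₀ (2 * r))ᶜ.indicator fun y => ‖f y‖₊) x ≤ P) :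
    genInv Ψ (volume (Metric.ball x₀ r))⁻¹ *
      weakOrliczNorm Ψ ((Metric.ball x₀ r).indicator (rieszPotential α f)) ≤ (4 * K : ℝ≥0) * P := by
  have hΨs := hΨ.starShaped
  set B := Metric.ball x₀ r with hB
  set g := genInv Ψ (volume B)⁻¹ with hg
  have hvt : volume B ≠ ∞ := measure_ball_lt_top.ne
  have hv0 : volume B ≠ 0 := (Metric.measure_ball_pos volume x₀ hr).ne'
  have hg0 : g ≠ 0 := hΨ.genInv_pos (by simpa using hvt)
  have hgt : g ≠ ∞ := hΨ.genInv_ne_top (by simpa using hv0)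
  have hK0 : 0 < K := one_pos.trans_le hK
  refine mul_le_of_forall_le_coe hg0 hgt (by simpa using hK0.ne') ENNReal.coe_ne_top
    fun X hX0 hPX => ?_
  rw [← ENNReal.coe_mul]
  refine weakOrliczNorm_le (by positivity) fun t _ => ?_
  have hN : ballNorm Φ f x₀ (2 * r) < X := by
    have h1 := hP1.trans_lt hPX
    rw [mul_comm, ENNReal.mul_lt_mul_iff_left hg0 hgt] at h1
    exact h1
  have hXt : (X : ℝ≥0∞) ≠ 0 := by simpa using hX0.ne'
  set F₁ : EuclideanSpace ℝ (Fin n) → ℝ≥0 :=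
    fun y => (Metric.ball x₀ (2 * r)).indicator (fun y => ‖f y‖₊) y / X with hF₁
  have hF₁m : Measurable F₁ :=
    (hf.measurable.nnnorm.indicator measurableSet_ball).div_const X
  -- The level is doubled because Ψ(t) ≤ Ψ(2t)/2, which again leaves 1/2 for each part.
  have hw := hweak F₁ hF₁m (lintegral_indicator_div_le_one hΦ hN) (2 * t)
  set S₁ := {x | ((K * (2 * t) : ℝ≥0) : ℝ≥0∞) < potential α F₁ x} with hS₁
  -- The far part is at most g throughout B, so its exceptional set is all of B or empty; in the
  -- first case Ψ(2t) ≤ 1/|B|.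
  set S₂ := {x | x ∈ B ∧ ((2 * t : ℝ≥0) : ℝ≥0∞) < g} with hS₂
  have hsub : {x | t < ‖B.indicator (rieszPotential α f) x‖₊ / (4 * K * X)} ⊆ S₁ ∪ S₂ := by
    intro x hx
    have hx' : t < ‖B.indicator (rieszPotential α f) x‖₊ / (4 * K * X) := hx
    by_cases hxB : x ∈ B
    swap
    · simp [hxB] at hx'
    rw [indicator_of_mem hxB] at hx'
    by_contra hcon
    simp only [mem_union, not_or, hS₁, hS₂, mem_ofPred_eq, not_lt, not_and] at hcon
    obtain ⟨h1, h2⟩ := hcon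
    have h2 := h2 hxB
    have hbg : potential α ((Metric.ball x₀ (2 * r))ᶜ.indicator fun y => ‖f y‖₊) x / X ≤ g := by
      refine ENNReal.div_le_of_le_mul ?_
      rw [mul_comm g]
      exact (hP2 x hxB).trans hPX.le
    have h3 := nnnorm_rieszPotential_div_le α hf (B := Metric.ball x₀ (2 * r))
      measurableSet_ball hX0 x
    have h4 : ((‖rieszPotential α f x‖₊ / X : ℝ≥0) : ℝ≥0∞) ≤
        ((K * (2 * t) + 2 * t : ℝ≥0) : ℝ≥0∞) := by
      rw [ENNReal.coe_add]
      exact h3.trans (add_le_add h1 (hbg.trans h2))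
    rw [ENNReal.coe_le_coe, div_le_iff₀ hX0] at h4
    rw [lt_div_iff₀ (by positivity)] at hx'
    have h5 : (K * (2 * t) + 2 * t) * X ≤ t * (4 * K * X) := by
      have h6 : 2 * t ≤ K * (2 * t) := le_mul_of_one_le_left zero_le hK
      calc (K * (2 * t) + 2 * t) * X ≤ (K * (2 * t) + K * (2 * t)) * X := by gcongr
        _ = t * (4 * K * X) := by ring
    exact absurd (hx'.trans_le (h4.trans h5)) (lt_irrefl _)
  have hhalf : Ψ t ≤ Ψ (2 * t) / 2 := by
    have := hΨs.apply_half_le t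
    rw [ENNReal.le_div_iff_mul_le (by simp) (by simp), mul_comm]
    exact this
  calc Ψ t * volume {x | t < ‖B.indicator (rieszPotential α f) x‖₊ / (4 * K * X)}
      ≤ Ψ (2 * t) / 2 * (volume S₁ + volume S₂) := by
        gcongr
        exact (measure_mono hsub).trans (measure_union_le _ _)
    _ = Ψ (2 * t) * volume S₁ / 2 + Ψ (2 * t) * volume S₂ / 2 := by
        simp only [div_eq_mul_inv]; ring
    _ ≤ 1 / 2 + 1 / 2 := by
        refine add_le_add (ENNReal.div_le_div_right hw 2) (ENNReal.div_le_div_right ?_ 2)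
        by_cases h : ((2 * t : ℝ≥0) : ℝ≥0∞) < g
        · calc Ψ (2 * t) * volume S₂ ≤ (volume B)⁻¹ * volume B := by
                gcongr
                · exact apply_le_of_lt_genInv h
                · exact fun x hx => hx.1
            _ = 1 := ENNReal.inv_mul_cancel hv0 hvt
        · have : S₂ = ∅ := eq_empty_of_forall_notMem fun x hx => h hx.2
          simp [this]
    _ = 1 := ENNReal.add_halves 1

/-- The two quantities that control the Riesz potential on a ball. -/
theorem exists_local_bounds {α : ℝ} (hα : 0 < α) (hαn : α < n) {q : ℝ}
    (hpq : ((n : ℝ) / α).HolderConjugate q) {c : ℝ≥0} (hc : 0 < c) {Φ Ψ : ℝ≥0 → ℝ≥0∞}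
    (hΦ : IsYoung Φ) (hΨ : IsYoung Ψ) (hd : SlopeDominated q c Φ Ψ)
    {φ₁ φ₂ : EuclideanSpace ℝ (Fin n) → ℝ → ℝ} (hφ₁ : ∀ x, ∀ r > 0, 0 < φ₁ x r)
    (hZ : ZygmundCond φ₁ φ₂ Φ Ψ) :
    ∃ A : ℝ≥0, ∀ f : EuclideanSpace ℝ (Fin n) → 𝕜, StronglyMeasurable f → morreyNorm Φ φ₁ f < ∞ →
      ∀ (x₀ : EuclideanSpace ℝ (Fin n)) (r : ℝ), 0 < r →
        genInv Ψ (volume (Metric.ball x₀ r))⁻¹ * ballNorm Φ f x₀ (2 * r) ≤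
          A * ENNReal.ofReal (φ₂ x₀ r) * morreyNorm Φ φ₁ f ∧
        ∀ x ∈ Metric.ball x₀ r,
          potential α ((Metric.ball x₀ (2 * r))ᶜ.indicator fun y => ‖f y‖₊) x ≤
            A * ENNReal.ofReal (φ₂ x₀ r) * morreyNorm Φ φ₁ f := by
  obtain ⟨K, hK1, hK⟩ := exists_genInv_ball_comparable n
  obtain ⟨A₁, hA₁⟩ := exists_potential_compl_ball_le_tailInt (𝕜 := 𝕜) hα hαn hpq hc hΦ
    hΨ.starShaped hd
  obtain ⟨A₂, hA₂⟩ := exists_tailInt_le (𝕜 := 𝕜) hΦ hφ₁ hZ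
  refine ⟨(K * (2 * 4 ^ n) + A₁) * A₂, fun f hf hfin x₀ r hr => ?_⟩
  have hJ := hA₂ f hfin x₀ r hr
  set J := tailInt n Ψ (ballNorm Φ f x₀) r with hJdef
  have hB : ∀ {a : ℝ≥0∞}, a ≤ ((K * (2 * 4 ^ n) + A₁ : ℝ≥0) : ℝ≥0∞) * J →
      a ≤ (((K * (2 * 4 ^ n) + A₁) * A₂ : ℝ≥0) : ℝ≥0∞) * ENNReal.ofReal (φ₂ x₀ r) *
        morreyNorm Φ φ₁ f := by
    intro a ha
    refine (ha.trans (mul_le_mul_right hJ _)).trans (le_of_eq ?_)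
    rw [ENNReal.coe_mul]; ring
  refine ⟨hB ?_, fun x hx => hB ((hA₁ f hf x₀ r hr x hx).trans ?_)⟩
  · calc genInv Ψ (volume (Metric.ball x₀ r))⁻¹ * ballNorm Φ f x₀ (2 * r)
        ≤ K * genInv Ψ (ENNReal.ofReal ((r ^ n)⁻¹)) * ballNorm Φ f x₀ (2 * r) := by
          gcongr
          exact ((hK x₀ r hr).2 Ψ hΨ.starShaped).1
      _ = K * (genInv Ψ (ENNReal.ofReal ((r ^ n)⁻¹)) * ballNorm Φ f x₀ (2 * r)) := mul_assoc _ _ _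
      _ ≤ K * (2 * 4 ^ n * J) :=
          mul_le_mul_right (genInv_mul_ballNorm_le hΦ.starShaped hΨ.starShaped f x₀ hr) _
      _ = ((K * (2 * 4 ^ n) : ℝ≥0) : ℝ≥0∞) * J := by push_cast; ring
      _ ≤ _ := by
          gcongr
          exact le_add_right le_rfl
  · gcongr
    exact le_add_left le_rfl

/-! ### Absolute convergence and local integrability -/

/-- The near part is f, integrable on the double ball, against a kernel with uniformly bounded
integral over the ball; the far part is bounded there. This yields both almost everywhere
convergence and the local integrability required by the target spaces. -/
theorem setLIntegral_ball_potential_lt_top {α : ℝ} (hα : 0 < α) (hαn : α < n)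
    {Φ Ψ : ℝ≥0 → ℝ≥0∞} (hΦ : IsYoung Φ) (hΨ : IsYoung Ψ)
    {f : EuclideanSpace ℝ (Fin n) → 𝕜} (hf : StronglyMeasurable f)
    {x₀ : EuclideanSpace ℝ (Fin n)} {r : ℝ} (hr : 0 < r) {P : ℝ≥0∞} (hP : P < ∞)
    (hP1 : genInv Ψ (volume (Metric.ball x₀ r))⁻¹ * ballNorm Φ f x₀ (2 * r) ≤ P)
    (hP2 : ∀ x ∈ Metric.ball x₀ r,
      potential α ((Metric.ball x₀ (2 * r))ᶜ.indicator fun y => ‖f y‖₊) x ≤ P) :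
    ∫⁻ x in Metric.ball x₀ r, potential α (fun y => ‖f y‖₊) x < ∞ := by
  obtain ⟨C, hC0, hC⟩ := exists_setLIntegral_rieszKernel_le hα hαn
  have hFm : Measurable fun y => ‖f y‖₊ := hf.measurable.nnnorm
  have hFB : Measurable ((Metric.ball x₀ (2 * r)).indicator fun y => ‖f y‖₊) :=
    hFm.indicator measurableSet_ball
  have hBt : ∀ {s : ℝ}, volume (Metric.ball x₀ s) < ∞ := measure_ball_lt_top
  have hball : ∫⁻ y in Metric.ball x₀ (2 * r), (‖f y‖₊ : ℝ≥0∞) < ∞ := by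
    refine (setLIntegral_ball_le hΦ hf x₀ (by linarith)).trans_lt ?_
    have h2r : volume (Metric.ball x₀ (2 * r)) ≠ 0 :=
      (Metric.measure_ball_pos volume x₀ (by linarith)).ne'
    have hg : genInv Φ (volume (Metric.ball x₀ (2 * r)))⁻¹ < ∞ :=
      (hΦ.genInv_ne_top (by simpa using h2r)).lt_top
    have hN : ballNorm Φ f x₀ (2 * r) < ∞ :=
      ENNReal.lt_top_of_mul_ne_top_right (hP1.trans_lt hP).ne
        (hΨ.genInv_pos (by simpa using hBt.ne))
    exact ENNReal.mul_lt_top (ENNReal.mul_lt_top (ENNReal.mul_lt_top (by simp) hBt) hg) hN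
  simp_rw [potential_eq_add_compl α hFm (measurableSet_ball (x := x₀) (ε := 2 * r))]
  rw [lintegral_add_left (measurable_potential α hFB)]
  refine ENNReal.add_lt_top.2 ⟨?_, ?_⟩
  · rw [setLIntegral_potential_eq α hFB]
    calc ∫⁻ y, (∫⁻ x in Metric.ball x₀ r, rieszKernel α (x - y)) *
          ((Metric.ball x₀ (2 * r)).indicator (fun y => ‖f y‖₊) y : ℝ≥0)
        ≤ ∫⁻ y, C * volume (Metric.ball x₀ r) ^ (α / n) *
          (Metric.ball x₀ (2 * r)).indicator (fun y => (‖f y‖₊ : ℝ≥0∞)) y := by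
          refine lintegral_mono fun y => mul_le_mul' (hC _ y) (le_of_eq ?_)
          by_cases hy : y ∈ Metric.ball x₀ (2 * r) <;> simp [hy]
      _ < ∞ := by
          have hfin : (C : ℝ≥0∞) * volume (Metric.ball x₀ r) ^ (α / n) < ∞ :=
            ENNReal.mul_lt_top (by simp) (ENNReal.rpow_lt_top_of_nonneg (by positivity) hBt.ne)
          rw [lintegral_const_mul' _ _ hfin.ne, lintegral_indicator measurableSet_ball]
          exact ENNReal.mul_lt_top hfin hball
  · calc _ ≤ ∫⁻ _ in Metric.ball x₀ r, P := setLIntegral_mono' measurableSet_ball hP2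
      _ = P * volume (Metric.ball x₀ r) := by simp
      _ < ∞ := ENNReal.mul_lt_top hP hBt

theorem ae_of_forall_ball {p : EuclideanSpace ℝ (Fin n) → Prop}
    (h : ∀ r : ℝ, 0 < r → ∀ᵐ x ∂volume.restrict (Metric.ball (0 : EuclideanSpace ℝ (Fin n)) r), p x) :
    ∀ᵐ x, p x := by
  have h1 : ∀ᵐ x ∂volume.restrict
      (⋃ N : ℕ, Metric.ball (0 : EuclideanSpace ℝ (Fin n)) ((N : ℝ) + 1)), p x :=
    (ae_restrict_iUnion_iff _ _).2 fun N => h _ (by positivity)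
  have h2 : (⋃ N : ℕ, Metric.ball (0 : EuclideanSpace ℝ (Fin n)) ((N : ℝ) + 1)) = univ := by
    refine eq_univ_of_forall fun x => mem_iUnion.2 ?_
    obtain ⟨N, hN⟩ := exists_nat_gt ‖x‖
    exact ⟨N, by rw [mem_ball_zero_iff]; linarith⟩
  rwa [h2, Measure.restrict_univ] at h1

/-- Absolute convergence and local integrability of the Riesz potential. -/
theorem integrable_of_setLIntegral_potential_lt_top {α : ℝ} {f : EuclideanSpace ℝ (Fin n) → 𝕜}
    (hf : StronglyMeasurable f)
    (h : ∀ (x₀ : EuclideanSpace ℝ (Fin n)) (r : ℝ), 0 < r →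
      ∫⁻ x in Metric.ball x₀ r, potential α (fun y => ‖f y‖₊) x < ∞) :
    (∀ᵐ x, Integrable (rieszIntegrand α f x) volume) ∧
      ∀ (x₀ : EuclideanSpace ℝ (Fin n)) (r : ℝ), 0 < r →
        LocallyIntegrable ((Metric.ball x₀ r).indicator (rieszPotential α f)) volume := by
  have hm := measurable_potential α (F := fun y => ‖f y‖₊) hf.measurable.nnnorm
  refine ⟨?_, fun x₀ r hr => ?_⟩
  · refine ae_of_forall_ball fun r hr => ?_
    filter_upwards [ae_lt_top hm (h 0 r hr).ne] with x hx
    exact integrable_rieszIntegrand α hf hx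
  · refine Integrable.locallyIntegrable ?_
    rw [integrable_indicator_iff measurableSet_ball]
    refine ⟨(stronglyMeasurable_rieszPotential α hf).aestronglyMeasurable, ?_⟩
    exact (lintegral_mono fun x => nnnorm_rieszPotential_le α f x).trans_lt (h x₀ r hr)

theorem aestronglyMeasurable_of_memMorrey {Φ : ℝ≥0 → ℝ≥0∞}
    {φ : EuclideanSpace ℝ (Fin n) → ℝ → ℝ} {f : EuclideanSpace ℝ (Fin n) → 𝕜}
    (h : MemMorrey Φ φ f) : AEStronglyMeasurable f volume := by
  have h2 : (⋃ N : ℕ, Metric.ball (0 : EuclideanSpace ℝ (Fin n)) ((N : ℝ) + 1)) = univ := by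
    refine eq_univ_of_forall fun x => mem_iUnion.2 ?_
    obtain ⟨N, hN⟩ := exists_nat_gt ‖x‖
    exact ⟨N, by rw [mem_ball_zero_iff]; linarith⟩
  rw [← Measure.restrict_univ (μ := volume), ← h2, aestronglyMeasurable_iUnion_iff]
  intro N
  rw [← aestronglyMeasurable_indicator_iff measurableSet_ball]
  exact (h.1 0 (N + 1) (by positivity)).1.aestronglyMeasurable

theorem rieszIntegrand_congr_ae (α : ℝ) {f g : EuclideanSpace ℝ (Fin n) → 𝕜}
    (h : f =ᵐ[volume] g) (x : EuclideanSpace ℝ (Fin n)) :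
    rieszIntegrand α f x =ᵐ[volume] rieszIntegrand α g x :=
  h.mono fun y hy => by simp only [rieszIntegrand, hy]

theorem rieszPotential_congr_ae (α : ℝ) {f g : EuclideanSpace ℝ (Fin n) → 𝕜}
    (h : f =ᵐ[volume] g) : rieszPotential α f = rieszPotential α g :=
  funext fun x => integral_congr_ae (rieszIntegrand_congr_ae α h x)

theorem inv_mul_mul_le_of_mul_le {φ g a : ℝ≥0∞} (hφ0 : φ ≠ 0) (hφt : φ ≠ ∞) {K A : ℝ≥0} {M : ℝ≥0∞}
    (h : g * a ≤ K * (A * φ * M)) : φ⁻¹ * g * a ≤ ((K * A : ℝ≥0) : ℝ≥0∞) * M := by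
  calc φ⁻¹ * g * a = φ⁻¹ * (g * a) := mul_assoc _ _ _
    _ ≤ φ⁻¹ * (K * (A * φ * M)) := by gcongr
    _ = (φ⁻¹ * φ) * ((K * A) * M) := by ring
    _ = _ := by rw [ENNReal.inv_mul_cancel hφ0 hφt, one_mul, ENNReal.coe_mul]

/-! ### Assembly of the Morrey bounds -/

/-- Boundedness of the Riesz potential between Morrey spaces, given the strong type estimate. -/
theorem exists_morrey_bound {α : ℝ} (hα : 0 < α) (hαn : α < n) {q : ℝ}
    (hpq : ((n : ℝ) / α).HolderConjugate q) {c : ℝ≥0} (hc : 0 < c) {Φ Ψ : ℝ≥0 → ℝ≥0∞}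
    (hΦ : IsYoung Φ) (hΨ : IsYoung Ψ) (hd : SlopeDominated q c Φ Ψ)
    {φ₁ φ₂ : EuclideanSpace ℝ (Fin n) → ℝ → ℝ} (hφ₁ : ∀ x, ∀ r > 0, 0 < φ₁ x r)
    (hφ₂ : ∀ x, ∀ r > 0, 0 < φ₂ x r) (hZ : ZygmundCond φ₁ φ₂ Φ Ψ) {K : ℝ≥0} (hK : 1 ≤ K)
    (hstrong : ∀ F : EuclideanSpace ℝ (Fin n) → ℝ≥0, Measurable F → ∫⁻ x, Φ (F x) ≤ 1 →
      (∀ᵐ x, potential α F x < ∞) ∧ ∫⁻ x, Ψ ((potential α F x).toNNReal / K) ≤ 1) :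
    ∃ C : ℝ≥0, ∀ f : EuclideanSpace ℝ (Fin n) → 𝕜, MemMorrey Φ φ₁ f →
        (∀ᵐ x, Integrable (rieszIntegrand α f x) volume) ∧
        MemMorrey Ψ φ₂ (rieszPotential α f) ∧
        morreyNorm Ψ φ₂ (rieszPotential α f) ≤ C * morreyNorm Φ φ₁ f := by
  obtain ⟨A, hA⟩ := exists_local_bounds (𝕜 := 𝕜) hα hαn hpq hc hΦ hΨ hd hφ₁ hZ
  refine ⟨4 * K * A, fun f₀ hf₀ => ?_⟩
  -- A strongly measurable representative changes neither the Morrey norm nor the potential, even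
  -- pointwise.
  obtain ⟨f, hf, hff⟩ := aestronglyMeasurable_of_memMorrey hf₀
  have hM : morreyNorm Φ φ₁ f < ∞ := by rw [← morreyNorm_congr_ae hff]; exact hf₀.2
  rw [rieszPotential_congr_ae α hff, morreyNorm_congr_ae hff]
  have hPfin : ∀ x r, (A : ℝ≥0∞) * ENNReal.ofReal (φ₂ x r) * morreyNorm Φ φ₁ f < ∞ := fun x r =>
    ENNReal.mul_lt_top (by finiteness) hM
  have hbound : ∀ (x : EuclideanSpace ℝ (Fin n)) (r : ℝ), 0 < r →
      genInv Ψ (volume (Metric.ball x r))⁻¹ *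
        orliczNorm Ψ ((Metric.ball x r).indicator (rieszPotential α f)) ≤
        (4 * K : ℝ≥0) * (A * ENNReal.ofReal (φ₂ x r) * morreyNorm Φ φ₁ f) := fun x r hr =>
    genInv_mul_orliczNorm_rieszPotential_le hΦ.starShaped hΨ hK hstrong hf hr
      (hA f hf hM x r hr).1 (hA f hf hM x r hr).2
  obtain ⟨hinteg, hloc⟩ := integrable_of_setLIntegral_potential_lt_top (α := α) hf fun x r hr =>
    setLIntegral_ball_potential_lt_top hα hαn hΦ hΨ hf hr (hPfin x r)
      (hA f hf hM x r hr).1 (hA f hf hM x r hr).2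
  have hnorm : morreyNorm Ψ φ₂ (rieszPotential α f) ≤
      ((4 * K * A : ℝ≥0) : ℝ≥0∞) * morreyNorm Φ φ₁ f := by
    refine iSup_le fun x => iSup_le fun r => iSup_le fun hr => ?_
    exact inv_mul_mul_le_of_mul_le (by simpa using hφ₂ x r hr) (by simp) (hbound x r hr)
  refine ⟨?_, ⟨fun x r hr => ⟨hloc x r hr, ?_⟩, ?_⟩, hnorm⟩
  · filter_upwards [hinteg] with x hx
    exact hx.congr (rieszIntegrand_congr_ae α hff x).symm
  · have hfin : orliczNorm Ψ ((Metric.ball x r).indicator (rieszPotential α f)) < ∞ :=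
      ENNReal.lt_top_of_mul_ne_top_right
        ((hbound x r hr).trans_lt (ENNReal.mul_lt_top ENNReal.coe_lt_top (hPfin x r))).ne
        (hΨ.genInv_pos (by simpa using (measure_ball_lt_top (μ := volume) (x := x) (r := r)).ne))
    obtain ⟨l, hl, -, h1⟩ := exists_lintegral_le_one_of_orliczNorm_lt hfin
    refine ⟨l⁻¹, by positivity, lt_of_le_of_lt ?_ ENNReal.one_lt_top⟩
    refine le_trans (le_of_eq (lintegral_congr fun y => ?_)) h1
    rw [div_eq_inv_mul]
  · exact hnorm.trans_lt (ENNReal.mul_lt_top ENNReal.coe_lt_top hM)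

/-- Boundedness of the Riesz potential from Morrey to weak Morrey spaces, given the weak type
estimate. -/
theorem exists_weakMorrey_bound {α : ℝ} (hα : 0 < α) (hαn : α < n) {q : ℝ}
    (hpq : ((n : ℝ) / α).HolderConjugate q) {c : ℝ≥0} (hc : 0 < c) {Φ Ψ : ℝ≥0 → ℝ≥0∞}
    (hΦ : IsYoung Φ) (hΨ : IsYoung Ψ) (hd : SlopeDominated q c Φ Ψ)
    {φ₁ φ₂ : EuclideanSpace ℝ (Fin n) → ℝ → ℝ} (hφ₁ : ∀ x, ∀ r > 0, 0 < φ₁ x r)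
    (hφ₂ : ∀ x, ∀ r > 0, 0 < φ₂ x r) (hZ : ZygmundCond φ₁ φ₂ Φ Ψ) {K : ℝ≥0} (hK : 1 ≤ K)
    (hweak : ∀ F : EuclideanSpace ℝ (Fin n) → ℝ≥0, Measurable F → ∫⁻ x, Φ (F x) ≤ 1 →
      ∀ t : ℝ≥0, Ψ t * volume {x | ((K * t : ℝ≥0) : ℝ≥0∞) < potential α F x} ≤ 1) :
    ∃ C : ℝ≥0, ∀ f : EuclideanSpace ℝ (Fin n) → 𝕜, MemMorrey Φ φ₁ f →
        (∀ᵐ x, Integrable (rieszIntegrand α f x) volume) ∧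
        MemWeakMorrey Ψ φ₂ (rieszPotential α f) ∧
        weakMorreyNorm Ψ φ₂ (rieszPotential α f) ≤ C * morreyNorm Φ φ₁ f := by
  obtain ⟨A, hA⟩ := exists_local_bounds (𝕜 := 𝕜) hα hαn hpq hc hΦ hΨ hd hφ₁ hZ
  refine ⟨4 * K * A, fun f₀ hf₀ => ?_⟩
  obtain ⟨f, hf, hff⟩ := aestronglyMeasurable_of_memMorrey hf₀
  have hM : morreyNorm Φ φ₁ f < ∞ := by rw [← morreyNorm_congr_ae hff]; exact hf₀.2
  rw [rieszPotential_congr_ae α hff, morreyNorm_congr_ae hff]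
  have hPfin : ∀ x r, (A : ℝ≥0∞) * ENNReal.ofReal (φ₂ x r) * morreyNorm Φ φ₁ f < ∞ := fun x r =>
    ENNReal.mul_lt_top (by finiteness) hM
  have hbound : ∀ (x : EuclideanSpace ℝ (Fin n)) (r : ℝ), 0 < r →
      genInv Ψ (volume (Metric.ball x r))⁻¹ *
        weakOrliczNorm Ψ ((Metric.ball x r).indicator (rieszPotential α f)) ≤
        (4 * K : ℝ≥0) * (A * ENNReal.ofReal (φ₂ x r) * morreyNorm Φ φ₁ f) := fun x r hr =>
    genInv_mul_weakOrliczNorm_rieszPotential_le hΦ.starShaped hΨ hK hweak hf hr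
      (hA f hf hM x r hr).1 (hA f hf hM x r hr).2
  obtain ⟨hinteg, hloc⟩ := integrable_of_setLIntegral_potential_lt_top (α := α) hf fun x r hr =>
    setLIntegral_ball_potential_lt_top hα hαn hΦ hΨ hf hr (hPfin x r)
      (hA f hf hM x r hr).1 (hA f hf hM x r hr).2
  have hnorm : weakMorreyNorm Ψ φ₂ (rieszPotential α f) ≤
      ((4 * K * A : ℝ≥0) : ℝ≥0∞) * morreyNorm Φ φ₁ f := by
    refine iSup_le fun x => iSup_le fun r => iSup_le fun hr => ?_
    exact inv_mul_mul_le_of_mul_le (by simpa using hφ₂ x r hr) (by simp) (hbound x r hr)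
  refine ⟨?_, ⟨fun x r hr => ⟨hloc x r hr, ?_⟩, ?_⟩, hnorm⟩
  · filter_upwards [hinteg] with x hx
    exact hx.congr (rieszIntegrand_congr_ae α hff x).symm
  · exact ENNReal.lt_top_of_mul_ne_top_right
      ((hbound x r hr).trans_lt (ENNReal.mul_lt_top ENNReal.coe_lt_top (hPfin x r))).ne
      (hΨ.genInv_pos (by simpa using (measure_ball_lt_top (μ := volume) (x := x) (r := r)).ne))
  · exact hnorm.trans_lt (ENNReal.mul_lt_top ENNReal.coe_lt_top hM)

end Morrey

end OrliczMorrey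

end

open OrliczMorrey in
theorem mainTheorem1 {𝕜 : Type*} [RCLike 𝕜] (n : ℕ) (α : ℝ) (hα : 0 < α) (hαn : α < n)
    (Φ Ψ : ℝ≥0 → ℝ≥0∞) (hΦ : OrliczMorrey.IsYoung Φ) (hΨ : OrliczMorrey.IsYoung Ψ)
    (φ₁ φ₂ : EuclideanSpace ℝ (Fin n) → ℝ → ℝ)
    (hφ₁ : OrliczMorrey.IsMorreyWeight φ₁) (hφ₂ : OrliczMorrey.IsMorreyWeight φ₂)
    (hZ : OrliczMorrey.ZygmundCond φ₁ φ₂ Φ Ψ) :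
    (OrliczMorrey.CondStrong n α Φ Ψ →
      ∃ C : ℝ≥0, ∀ f : EuclideanSpace ℝ (Fin n) → 𝕜, OrliczMorrey.MemMorrey Φ φ₁ f →
        (∀ᵐ x, Integrable (OrliczMorrey.rieszIntegrand α f x) volume) ∧
        OrliczMorrey.MemMorrey Ψ φ₂ (OrliczMorrey.rieszPotential α f) ∧
        OrliczMorrey.morreyNorm Ψ φ₂ (OrliczMorrey.rieszPotential α f)
          ≤ C * OrliczMorrey.morreyNorm Φ φ₁ f) ∧
    (OrliczMorrey.CondWeak n α Φ Ψ →
      ∃ C : ℝ≥0, ∀ f : EuclideanSpace ℝ (Fin n) → 𝕜, OrliczMorrey.MemMorrey Φ φ₁ f →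
        (∀ᵐ x, Integrable (OrliczMorrey.rieszIntegrand α f x) volume) ∧
        OrliczMorrey.MemWeakMorrey Ψ φ₂ (OrliczMorrey.rieszPotential α f) ∧
        OrliczMorrey.weakMorreyNorm Ψ φ₂ (OrliczMorrey.rieszPotential α f)
          ≤ C * OrliczMorrey.morreyNorm Φ φ₁ f) := by
  have hn : (0 : ℝ) < n := hα.trans hαn
  have hnα : (0 : ℝ) < n - α := by linarith
  have hq : (n : ℝ) / α / ((n : ℝ) / α - 1) = n / (n - α) := by
    field_simp
  have hq1 : 1 < (n : ℝ) / (n - α) := by rw [one_lt_div hnα]; linarith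
  have hpq : ((n : ℝ) / α).HolderConjugate (n / (n - α)) := by
    rw [Real.holderConjugate_iff, one_lt_div hα]
    refine ⟨hαn, ?_⟩
    field_simp
    ring
  have hΦs := hΦ.starShaped
  have hΨs := hΨ.starShaped
  have hdom : CondWeak n α Φ Ψ → ∃ c : ℝ≥0, 0 < c ∧ SlopeDominated (n / (n - α)) c Φ Ψ := by
    rintro ⟨h1, h2⟩
    rw [upperConj, hq] at h2
    exact exists_slopeDominated hΦs hΨs hq1 h1 h2
  refine ⟨fun ⟨h1, h2, h3, h4⟩ => ?_, fun h => ?_⟩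
  · obtain ⟨c, hc, hd⟩ := hdom ⟨h1, h4⟩
    rw [lowerConj, hq] at h3
    obtain ⟨c', hc', hd'⟩ := exists_slopeDominated_compl hq1 h2 h3
    -- The weak estimate is needed here too: it shows that the potential is finite almost
    -- everywhere, so truncating infinite values to 0 in the strong estimate loses nothing.
    obtain ⟨Kw, -, hw⟩ := exists_weak_potential hα hαn hpq hc hΦs hΨs hd
    obtain ⟨K, hK, hs⟩ := exists_strong_potential hα hαn hpq hc hc' hΦs hΨs hd hd'
    exact exists_morrey_bound hα hαn hpq hc hΦ hΨ hd hφ₁.1 hφ₂.1 hZ hK fun F hF hF1 =>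
      ⟨ae_lt_top_of_forall_mul_measure_le hΨ.tendsto_top (hw F hF hF1), hs F hF hF1⟩
  · obtain ⟨c, hc, hd⟩ := hdom h
    obtain ⟨K, hK, hw⟩ := exists_weak_potential hα hαn hpq hc hΦs hΨs hd
    exact exists_weakMorrey_bound hα hαn hpq hc hΦ hΨ hd hφ₁.1 hφ₂.1 hZ hK hw
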